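/- **Setting.** Robots are disks of radius $r>0$. Let $d=\frac{2r}{\sqrt3-1}$ and let $L\subset\mathbb R^2$ be the hexagonal lattice $d\,(\mathbb Z+\mathbb Z e^{i\pi/3})$ with origin $O$; two lattice points are adjacent if their distance is $d$. Let $p_1,\dots,p_6$ be the neighbours of $O$, numbered clockwise, with $p_3$ to the right of $O$ (so $p_1,p_2$ lie above and $p_4,p_5$ below). $H_1$ and $H_2$ denote the sets of lattice points with ordinate $\ge\sqrt3\,d$ and $\le-\sqrt3\,d$. *Ribbons.* For $P\subseteq L$, the hop count $h(x)$ of $x\in P\cup\{O,p_1,\dots,p_6\}$ is the length of a shortest lattice path from $x$ to $O$ inside $P\cup\{O,p_1,\dots,p_6\}$ ($-1$ if there is none). A ribbon of $P$ is a connected component of the set of points of $P$ with a given hop count $k$, its gradient; its length is its number of vertices. It is directed: there is an arc $x\to y$ if $y$ arises from $x$ by rotating clockwise by $\pi/3$ around a neighbour with hop count $k-1$. Ribbon order: $x<y$ if a directed path leads from $y$ to $x$ ("$x$ is in front of $y$"). A ribbon $Q$ is the parent of a ribbon $R$ if its gradient is one less and every vertex of $R$ is adjacent to a vertex of $Q$.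 Tree order: $Q<R$ if $Q$ is an ancestor of $R$. A complete tree order is a strict total order on the ribbons extending the tree order. The ribbons of $S$ and of $H_2$ (idle ribbons) are those for $P=S$ and $P=H_2$. *Shape.* $S\subseteq H_1$ is a finite set of $N$ lattice points and $D\subseteq S$ (the holes) such that $L\setminus S$ is connected as a set of lattice points ($S$ itself has no holes) and the ribbonization of $S$ is proper: every $x\in S$ has $h(x)>0$; every ribbon has length $\ge2$; there is exactly one ribbon of gradient $2$ and it has length $3$; points of $S$ adjacent to a lattice point outside $S$ are not in $D$; if $x,y\in S$ have distance $2d$, the lattice point between them is in $S$; if $x,y\in S$ have distance $\sqrt3\,d$, at least one of their two common neighbours is in $S$. *Initial configuration.* Seed robots at $B=\{O,p_1,p_2,p_4,p_5\}$, which know their coordinates, and idle robots at a finite set $J\subseteq H_2$ such that each idle ribbon is empty or filled and all idle ribbons of smaller gradient than a filled one are filled; there are enough of them: $|J|\ge N$. Put $I=B\cup J$. Fix a complete tree order on the ribbons of $S$. *Movement sequences.* Recursively for $k=1,\dots,N$: $s_k$ is the largest point of $J$ on the largest idle ribbon not yet in $s$; $t_k$ is the smallest point of $S$ on the smallest ribbon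 not yet in $t$; ${s_r}_k$ is the smallest point of $S$ on the largest ribbon not yet in $s_r$. Let $R$ be the ribbon of ${s_r}_k$ and $c(R)=|R\cap D|$. If ${s_r}_k$ is among the first $c(R)$ vertices of $R$ (*recycled robot*), ${t_r}_k$ is the smallest point of $\{s_1,\dots,s_N\}$ on the smallest idle ribbon not yet in $t_r$; otherwise (*rearranged robot*) ${t_r}_k$ is the smallest point of $S\setminus D$ on the largest ribbon not yet in $t_r$. Points are compared in the ribbon orders, ribbons of $S$ in the complete tree order, idle ribbons in the tree order. Let $(a_1,\dots,a_{2N})=(s_1,\dots,s_N,{s_r}_1,\dots,{s_r}_N)$ and $(b_1,\dots,b_{2N})=(t_1,\dots,t_N,{t_r}_1,\dots,{t_r}_N)$. With multisets, let $C_k=I\oplus\{b_1,\dots,b_{k-1}\}\ominus\{a_1,\dots,a_{k-1}\}$ (positions occupied before epoch $k$) and $Q_k=C_k\ominus\{a_k\}$ (positions of the robots stationary in epoch $k$). *Motion.* A robot *follows* a set $G\subseteq Q_k$ by clockwise rotations by $\pi/3$ between lattice points around robots of $G$ at distance $d$, always keeping distance $\ge d$ to all robots of $G$. Edge-following is the case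 $G=Q_k$; ribbon-following on a ribbon $R$ of $S$ is the case that $G$ consists of the robots of $Q_k$ on the parent ribbon of $R$ (on $\{p_2,p_1\}$ if $R$ has gradient $2$). A path is *unobstructed* if all its points have distance $\ge2r$ from all robots of $Q_k$. A merging point of $R$ is a lattice point $m\notin S$ adjacent to the first vertex $x$ of $R$ such that $x$ and $m$ have a common neighbour on that parent ribbon (resp. on $\{p_2,p_1\}$). *Localization.* A resting robot is localizable if it is a seed, or was localizable earlier and has not moved since, or has three noncollinear localizable resting robots within distance $2d$. The moving robot of epoch $k$ can localize itself at a point if three noncollinear localizable robots of $Q_k$ lie within distance $2d$ of it. **Theorem.** The movement sequences exist and are unique, and they satisfy: 1. The final collection of robots forms the desired shape: as multisets, $(\{b_1,\dots,b_{2N}\}\ominus\{a_1,\dots,a_{2N}\})\sqcap H_1=S\setminus D$, and $(I\oplus\{b_1,\dots,b_{2N}\}\ominus\{a_1,\dots,a_{2N}\})\sqcap H_1=S\setminus D$. 2. For every $1\le k\le 2N$, $a_k\in C_k$ and $b_k\notin Q_k$. The moving robot of epoch $k$ travels from $a_k$ to $b_k$ on an unobstructed path; at each lattice point that it leaves there is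 exactly one robot of the followed set around which it can rotate. More precisely: - if $k\le N$, it goes from $a_k$ to $b_k$ by edge-following, and can localize itself at $a_k$ and $b_k$; - if $k>N$ and the robot is a rearranged one, it goes from $a_k$ to $b_k$ by ribbon-following through vertices of the ribbon $R$ of $a_k$, and can localize itself at $a_k$ and $b_k$; - if $k>N$ and the robot is a recycled one, it goes by ribbon-following through vertices of the ribbon $R$ of $a_k$ to the first vertex $x$ of $R$, on by one ribbon-following rotation to a merging point $m$ of $R$, and then by edge-following to $b_k$; it can localize itself at $a_k$, $x$, $m$ and $b_k$. -/

import Mathlib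

/-! ### The hexagonal lattice -/

/-- The lattice point with coordinates `(a, b)` is the point `d * (a + b * exp (iπ/3))`. -/
abbrev LatticePoint := ℤ × ℤ

/-- The lattice spacing for disk-shaped robots of radius `r`. -/
noncomputable def latticeSpacing (r : ℝ) : ℝ := 2 * r / (√3 - 1)

/-- The position of a lattice point in the plane, identified with `ℂ`. -/
noncomputable def pos (r : ℝ) (x : LatticePoint) : ℂ :=
  (latticeSpacing r : ℂ) * (((x.1 : ℝ) + (x.2 : ℝ) / 2 : ℝ) + ((√3 / 2 * (x.2 : ℝ) : ℝ) : ℂ) * Complex.I)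

/-- The squared distance between two lattice points, in units of the squared spacing. -/
def sqDist (x y : LatticePoint) : ℤ :=
  (x.1 - y.1) ^ 2 + (x.1 - y.1) * (x.2 - y.2) + (x.2 - y.2) ^ 2

theorem dist_pos_sq (r : ℝ) (x y : LatticePoint) :
    dist (pos r x) (pos r y) ^ 2 = latticeSpacing r ^ 2 * (sqDist x y : ℝ) := by
  have h3 : (√3 : ℝ) ^ 2 = 3 := Real.sq_sqrt (by norm_num)
  rw [Complex.dist_eq, Complex.sq_norm, Complex.normSq_apply]
  simp only [pos, sqDist, Complex.sub_re, Complex.sub_im, Complex.mul_re, Complex.mul_im,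
    Complex.add_re, Complex.add_im, Complex.ofReal_re, Complex.ofReal_im, Complex.I_re,
    Complex.I_im]
  push_cast
  linear_combination (latticeSpacing r ^ 2 * ((x.2 : ℝ) - y.2) ^ 2 / 4) * h3

/-- The lattice graph: lattice points at distance `d` are adjacent. -/
def lattice : SimpleGraph LatticePoint where
  Adj x y := sqDist x y = 1
  symm := ⟨by intro x y h; simp only [sqDist] at h ⊢; linarith⟩
  loopless := ⟨by intro x h; simp [sqDist] at h⟩

/-- The lattice point obtained from `p` by a clockwise rotation by `π/3` around `c`. -/
def rotCW (c p : LatticePoint) : LatticePoint :=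
  (c.1 + ((p.1 - c.1) + (p.2 - c.2)), c.2 - (p.1 - c.1))

/-- The point reached from `p` by a clockwise rotation by the angle `θ` around `c`. -/
noncomputable def arcPoint (r : ℝ) (c p : LatticePoint) (θ : ℝ) : ℂ :=
  pos r c + (pos r p - pos r c) * Complex.exp (-(θ : ℂ) * Complex.I)

theorem arcPoint_pi_div_three (r : ℝ) (c p : LatticePoint) :
    arcPoint r c p (Real.pi / 3) = pos r (rotCW c p) := by
  have h3 : (√3 : ℝ) ^ 2 = 3 := Real.sq_sqrt (by norm_num)
  have he : Complex.exp (-((Real.pi / 3 : ℝ) : ℂ) * Complex.I)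
      = ((1 / 2 : ℝ) : ℂ) - ((√3 / 2 : ℝ) : ℂ) * Complex.I := by
    rw [← Complex.ofReal_neg, Complex.exp_mul_I, ← Complex.ofReal_cos, ← Complex.ofReal_sin,
      Real.cos_neg, Real.sin_neg, Real.cos_pi_div_three, Real.sin_pi_div_three]
    push_cast; ring
  rw [arcPoint, he]
  apply Complex.ext
  · simp only [pos, rotCW, Complex.sub_re, Complex.sub_im, Complex.mul_re, Complex.mul_im,
      Complex.add_re, Complex.add_im, Complex.ofReal_re, Complex.ofReal_im, Complex.I_re,
      Complex.I_im]
    push_cast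
    linear_combination (latticeSpacing r * ((p.2 : ℝ) - c.2) / 4) * h3
  · simp only [pos, rotCW, Complex.sub_re, Complex.sub_im, Complex.mul_re, Complex.mul_im,
      Complex.add_re, Complex.add_im, Complex.ofReal_re, Complex.ofReal_im, Complex.I_re,
      Complex.I_im]
    push_cast
    ring

/-- The neighbours of the origin, numbered clockwise; `p₃` is the one to its right. -/
def p₁ : LatticePoint := (-1, 1)
/-- See `p₁`. -/
def p₂ : LatticePoint := (0, 1)
/-- See `p₁`. -/
def p₃ : LatticePoint := (1, 0)
/-- See `p₁`. -/
def p₄ : LatticePoint := (1, -1)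
/-- See `p₁`. -/
def p₅ : LatticePoint := (0, -1)
/-- See `p₁`. -/
def p₆ : LatticePoint := (-1, 0)

/-- The origin together with its six neighbours. -/
def hub : Set LatticePoint := {0, p₁, p₂, p₃, p₄, p₅, p₆}

/-- The positions of the five seed robots. -/
def seeds : Finset LatticePoint := {0, p₁, p₂, p₄, p₅}

/-- The lattice points of the formation half-plane (ordinate at least `√3 d`). -/
def formationHalf : Set LatticePoint := {x | 2 ≤ x.2}

/-- The lattice points of the idle half-plane (ordinate at most `-√3 d`). -/
def idleHalf : Set LatticePoint := {x | x.2 ≤ -2}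

/-! ### Hop counts and ribbons -/

/-- The lattice graph restricted to `P`, the origin and the neighbours of the origin. -/
def regionGraph (P : Set LatticePoint) : SimpleGraph LatticePoint where
  Adj x y := lattice.Adj x y ∧ x ∈ P ∪ hub ∧ y ∈ P ∪ hub
  symm := ⟨fun _ _ h => ⟨h.1.symm, h.2.2, h.2.1⟩⟩
  loopless := ⟨fun _ h => lattice.irrefl h.1⟩

open Classical in
/-- The hop count: the length of a shortest path to the origin inside `P ∪ {p₁, …, p₆}`,
and `-1` if there is none. -/
noncomputable def hop (P : Set LatticePoint) (x : LatticePoint) : ℤ :=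
  if (regionGraph P).Reachable x 0 then ((regionGraph P).dist x 0 : ℤ) else -1

/-- Adjacency of points of `P` with equal hop counts. -/
def layerGraph (P : Set LatticePoint) : SimpleGraph LatticePoint where
  Adj x y := lattice.Adj x y ∧ x ∈ P ∧ y ∈ P ∧ hop P x = hop P y
  symm := ⟨fun _ _ h => ⟨h.1.symm, h.2.2.1, h.2.1, h.2.2.2.symm⟩⟩
  loopless := ⟨fun _ h => lattice.irrefl h.1⟩

/-- The vertex set of the ribbon of `P` through `x`. -/
def ribbonOf (P : Set LatticePoint) (x : LatticePoint) : Set LatticePoint :=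
  {y | y ∈ P ∧ (layerGraph P).Reachable x y}

/-- The ribbonization of `P`: the collection of its ribbons. -/
def ribbons (P : Set LatticePoint) : Set (Set LatticePoint) := ribbonOf P '' P

/-- The ribbon `R` of `P` has gradient `k`. -/
def HasGradient (P R : Set LatticePoint) (k : ℤ) : Prop := ∀ x ∈ R, hop P x = k

/-- The arc from `x` to `y` of the directed ribbon of `P` through `x`: it is directed clockwise
around a neighbour `c` of `x` whose hop count is smaller by one. -/
def RibbonArc (P : Set LatticePoint) (x y : LatticePoint) : Prop :=
  y ∈ ribbonOf P x ∧ ∃ c, lattice.Adj c x ∧ hop P c = hop P x - 1 ∧ y = rotCW c x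

/-- The ribbon order: `x` is smaller than `y` if the ribbon leads from `y` to `x`, that is,
if `x` is in front of `y`. -/
def RibbonLT (P : Set LatticePoint) (x y : LatticePoint) : Prop :=
  Relation.TransGen (RibbonArc P) y x

/-- `x` is the first vertex of `R`. -/
def IsFirstVertex (P R : Set LatticePoint) (x : LatticePoint) : Prop :=
  x ∈ R ∧ ∀ y ∈ R, ¬ RibbonLT P y x

/-- The gradient of `Q` is one less than that of `R`, and each vertex of `R` is adjacent to a
vertex of `Q`. -/
def LiesUnder (P Q R : Set LatticePoint) : Prop :=
  (∃ k, HasGradient P Q k ∧ HasGradient P R (k + 1)) ∧ ∀ x ∈ R, ∃ y ∈ Q, lattice.Adj x y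

/-- The ribbon `Q` of `P` is a parent ribbon of the ribbon `R` of `P`. -/
def IsParentRibbon (P Q R : Set LatticePoint) : Prop :=
  Q ∈ ribbons P ∧ R ∈ ribbons P ∧ LiesUnder P Q R

/-- The tree order on ribbons: `Q` is smaller than `R` if it is an ancestor of `R`. -/
def TreeLT (P Q R : Set LatticePoint) : Prop := Relation.TransGen (IsParentRibbon P) Q R

/-- `lt` is a complete tree order: a strict total order on the ribbons of `P` that extends the
tree order. -/
structure IsCompleteTreeOrder (P : Set LatticePoint)
    (lt : Set LatticePoint → Set LatticePoint → Prop) : Prop where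
  irrefl : ∀ R ∈ ribbons P, ¬ lt R R
  trans : ∀ R₁ ∈ ribbons P, ∀ R₂ ∈ ribbons P, ∀ R₃ ∈ ribbons P, lt R₁ R₂ → lt R₂ R₃ → lt R₁ R₃
  total : ∀ R₁ ∈ ribbons P, ∀ R₂ ∈ ribbons P, R₁ ≠ R₂ → lt R₁ R₂ ∨ lt R₂ R₁
  extends_tree : ∀ R₁ R₂, TreeLT P R₁ R₂ → lt R₁ R₂

/-! ### The shape and the initial configuration -/

/-- The lattice points outside `S` form a connected set. For a finite connected `S` this says that
the hexagonal cells of the points of `S` make up a region homeomorphic to a disk. -/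
def HoleFree (S : Finset LatticePoint) : Prop := (lattice.induce {x | x ∉ S}).Connected

/-- `S` with the holes `D` has a proper ribbonization. -/
structure ProperRibbonization (S D : Finset LatticePoint) : Prop where
  placement : ∀ x ∈ S, x ∈ formationHalf ∧ x ∉ hub
  hop_pos : ∀ x ∈ S, 0 < hop S x
  two_le_length : ∀ R ∈ ribbons (S : Set LatticePoint), 2 ≤ R.ncard
  root : ∃ R₀ ∈ ribbons (S : Set LatticePoint), HasGradient S R₀ 2 ∧ R₀.ncard = 3 ∧
    ∀ R ∈ ribbons (S : Set LatticePoint), HasGradient S R 2 → R = R₀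
  boundary : ∀ x ∈ S, (∃ y, y ∉ S ∧ lattice.Adj x y) → x ∉ D
  smooth_two : ∀ x ∈ S, ∀ y ∈ S, sqDist x y = 4 →
    ∀ z, lattice.Adj x z → lattice.Adj y z → z ∈ S
  smooth_sqrt_three : ∀ x ∈ S, ∀ y ∈ S, sqDist x y = 3 →
    ∃ z, lattice.Adj x z ∧ lattice.Adj y z ∧ z ∈ S

/-- The idle robots occupy the lattice points `J` of the idle half-plane, layer by layer. -/
structure IdlePlacement (J : Finset LatticePoint) : Prop where
  subset : ∀ x ∈ J, x ∈ idleHalf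
  empty_or_filled : ∀ R ∈ ribbons idleHalf, (∀ x ∈ R, x ∉ J) ∨ (∀ x ∈ R, x ∈ J)
  filled_closer : ∀ R ∈ ribbons idleHalf, ∀ R' ∈ ribbons idleHalf, ∀ k k',
    HasGradient idleHalf R k → HasGradient idleHalf R' k' → k' < k →
    (∀ x ∈ R, x ∈ J) → ∀ x ∈ R', x ∈ J

/-- The initial positions of all robots. -/
def initialRobots (J : Finset LatticePoint) : Multiset LatticePoint := seeds.val + J.val

/-! ### The movement sequences -/

/-- Points are compared first by their ribbons, via `lt`, and then by `lt'` within a ribbon. -/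
def RibbonLex (P : Set LatticePoint) (lt : Set LatticePoint → Set LatticePoint → Prop)
    (lt' : LatticePoint → LatticePoint → Prop) (x y : LatticePoint) : Prop :=
  lt (ribbonOf P x) (ribbonOf P y) ∨ (ribbonOf P x = ribbonOf P y ∧ lt' x y)

/-- `x` comes before all other elements of `C` with respect to `lt`. -/
def IsFirstFor (lt : LatticePoint → LatticePoint → Prop) (C : Set LatticePoint)
    (x : LatticePoint) : Prop :=
  x ∈ C ∧ ∀ y ∈ C, y ≠ x → lt x y

/-- The points of `C` that are not among the entries of `u` before the `k`-th one. -/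
def remaining {N : ℕ} (C : Set LatticePoint) (u : Fin N → LatticePoint) (k : Fin N) :
    Set LatticePoint :=
  {x | x ∈ C ∧ ∀ j < k, u j ≠ x}

/-- The four movement sequences. -/
@[ext] structure MovementPlan (N : ℕ) where
  /-- activation sequence -/
  s : Fin N → LatticePoint
  /-- assembly sequence -/
  t : Fin N → LatticePoint
  /-- reactivation sequence -/
  sr : Fin N → LatticePoint
  /-- reassembly sequence -/
  tr : Fin N → LatticePoint

/-- `x` is among the first `c(R)` vertices of its ribbon `R` in `S`, where `c(R)` is the number of
vertices of `R` in `D`. -/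
def IsRecycled (S D : Finset LatticePoint) (x : LatticePoint) : Prop :=
  {y | y ∈ S ∧ RibbonLT S y x}.ncard < (ribbonOf S x ∩ D).ncard

/-- `q` consists of the movement sequences planned by the algorithm for the shape `S \ D`, the
idle robots `J` and the complete tree order `lt`. -/
structure IsAddSubtractPlan (S D J : Finset LatticePoint)
    (lt : Set LatticePoint → Set LatticePoint → Prop) (q : MovementPlan S.card) : Prop where
  /-- the largest remaining idle point on the largest idle ribbon -/
  activation : ∀ k, IsFirstFor
    (RibbonLex idleHalf (fun Q R => TreeLT idleHalf R Q) (fun x y => RibbonLT idleHalf y x))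
    (remaining J q.s k) (q.s k)
  /-- the smallest remaining point of `S` on the smallest ribbon -/
  assembly : ∀ k, IsFirstFor (RibbonLex S lt (RibbonLT S)) (remaining S q.t k) (q.t k)
  /-- the smallest remaining point of `S` on the largest ribbon -/
  reactivation : ∀ k, IsFirstFor (RibbonLex S (fun Q R => lt R Q) (RibbonLT S))
    (remaining S q.sr k) (q.sr k)
  /-- the smallest remaining vacated idle point on the smallest idle ribbon -/
  recycle : ∀ k, IsRecycled S D (q.sr k) → IsFirstFor
    (RibbonLex idleHalf (TreeLT idleHalf) (RibbonLT idleHalf))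
    (remaining (Set.range q.s) q.tr k) (q.tr k)
  /-- the smallest remaining point of `S \ D` on the largest ribbon -/
  rearrange : ∀ k, ¬ IsRecycled S D (q.sr k) → IsFirstFor
    (RibbonLex S (fun Q R => lt R Q) (RibbonLT S))
    (remaining ((S \ D : Finset LatticePoint) : Set LatticePoint) q.tr k) (q.tr k)

/-- The starting positions `a₁, …, a₂ₙ` (indexed from `0`). -/
def MovementPlan.starts {N : ℕ} (q : MovementPlan N) : Fin (N + N) → LatticePoint :=
  Fin.append q.s q.sr

/-- The stopping positions `b₁, …, b₂ₙ` (indexed from `0`). -/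
def MovementPlan.stops {N : ℕ} (q : MovementPlan N) : Fin (N + N) → LatticePoint :=
  Fin.append q.t q.tr

/-! ### Execution: occupied positions, motion, localization

Throughout, `I` is the multiset of initial positions, `a` and `b` are the sequences of starting and
stopping positions, and exactly one robot moves in each epoch. -/

/-- The multiset of the entries of `u` with index less than `n`. -/
def entriesBefore {M : ℕ} (u : Fin M → LatticePoint) (n : ℕ) : Multiset LatticePoint :=
  (Finset.univ.filter (fun i : Fin M => i.val < n)).val.map u

/-- The occupied positions after the first `n` epochs. -/
def config (I : Multiset LatticePoint) {M : ℕ} (a b : Fin M → LatticePoint) (n : ℕ) :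
    Multiset LatticePoint :=
  I + entriesBefore b n - entriesBefore a n

/-- The positions of the robots that are stationary while the robot from `a n` moves. -/
def stationary (I : Multiset LatticePoint) {M : ℕ} (a b : Fin M → LatticePoint) (n : Fin M) :
    Multiset LatticePoint :=
  config I a b n - {a n}

/-- The part of a multiset of positions that lies in the formation half-plane. -/
def formationPart (m : Multiset LatticePoint) : Multiset LatticePoint :=
  m.filter (fun x => 2 ≤ x.2)

/-- On the clockwise arc from `p` around `c` to the next lattice point, the distance to each
robot in `Q` is at least `ρ`. -/
def ArcClear (r ρ : ℝ) (Q : Set LatticePoint) (c p : LatticePoint) : Prop :=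
  ∀ θ ∈ Set.Icc (0 : ℝ) (Real.pi / 3), ∀ w ∈ Q, ρ ≤ dist (arcPoint r c p θ) (pos r w)

/-- A robot at `p` that follows the robots in `G` can rotate clockwise around `c ∈ G` to the next
lattice point: it keeps the distance `d` to the nearest robot of `G`. -/
def CanRotate (r : ℝ) (G : Set LatticePoint) (c p : LatticePoint) : Prop :=
  c ∈ G ∧ lattice.Adj c p ∧ ArcClear r (latticeSpacing r) G c p

/-- One step of clockwise motion, from the lattice point `p` to the lattice point `p'`, of a robot
that follows the robots in `G`, while the stationary robots are those in `Q`. The robot around which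
it rotates is the only possible one, and the step is unobstructed: no disk of radius `r` around a
stationary robot overlaps that of the moving robot. -/
def FollowStep (r : ℝ) (Q G : Set LatticePoint) (p p' : LatticePoint) : Prop :=
  ∃ c, CanRotate r G c p ∧ (∀ c', CanRotate r G c' p → c' = c) ∧ p' = rotCW c p ∧
    ArcClear r (2 * r) Q c p

/-- Edge-following leads from `p` to `p'` along an unobstructed path. -/
def EdgeFollows (r : ℝ) (Q : Set LatticePoint) (p p' : LatticePoint) : Prop :=
  Relation.ReflTransGen (FollowStep r Q Q) p p'

/-- Ribbon-following around the stationary robots on `F` leads from `p` to `p'` along an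
unobstructed path through vertices of `R`. -/
def RibbonFollows (r : ℝ) (Q F R : Set LatticePoint) (p p' : LatticePoint) : Prop :=
  Relation.ReflTransGen (fun x y => FollowStep r Q (Q ∩ F) x y ∧ y ∈ R) p p'

/-- `Localizable r I a b n x`: before epoch `n` the resting robot at `x` is localizable. It is a seed
robot, or was localizable earlier and has not moved since, or can trilaterate by three
noncollinear localizable robots at distance at most `2d`. -/
inductive Localizable (r : ℝ) (I : Multiset LatticePoint) {M : ℕ} (a b : Fin M → LatticePoint) :
    ℕ → LatticePoint → Prop
  | seed (n : ℕ) (x : LatticePoint) (hx : x ∈ seeds) : Localizable r I a b n x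
  | stay (n : Fin M) (x : LatticePoint) (h : Localizable r I a b n.val x)
      (hx : x ∈ stationary I a b n) : Localizable r I a b (n.val + 1) x
  | trilaterate (n : ℕ) (x : LatticePoint) (y : Fin 3 → LatticePoint)
      (hx : x ∈ config I a b n) (hy : ∀ i, y i ∈ config I a b n) (hne : ∀ i, y i ≠ x)
      (h : ∀ i, Localizable r I a b n (y i))
      (hd : ∀ i, dist (pos r (y i)) (pos r x) ≤ 2 * latticeSpacing r)
      (hnc : ¬ Collinear ℝ (Set.range fun i => pos r (y i))) : Localizable r I a b n x

/-- The moving robot of epoch `n`, being at `p`, can determine its coordinates by trilateration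
from stationary robots only. -/
def CanLocalizeAt (r : ℝ) (I : Multiset LatticePoint) {M : ℕ} (a b : Fin M → LatticePoint)
    (n : Fin M) (p : LatticePoint) : Prop :=
  ∃ y : Fin 3 → LatticePoint, (∀ i, y i ∈ stationary I a b n ∧ Localizable r I a b n.val (y i) ∧
      dist (pos r (y i)) (pos r p) ≤ 2 * latticeSpacing r) ∧
    ¬ Collinear ℝ (Set.range fun i => pos r (y i))

/-- The robots around which a robot leaving a vertex of the ribbon `R` of `S` rotates sit on `F`: the
parent ribbon of `R`, or the pair of seed positions `(p₂, p₁)` if `R` is the root ribbon. -/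
def IsGuide (S F R : Set LatticePoint) : Prop :=
  IsParentRibbon S F R ∨ (R ∈ ribbons S ∧ F = {p₂, p₁} ∧ LiesUnder S F R)

/-- `m` is a merging point of the ribbon with first vertex `x` and parent ribbon `F`. -/
def IsMergingPoint (S F : Set LatticePoint) (x m : LatticePoint) : Prop :=
  m ∉ S ∧ lattice.Adj m x ∧ ∃ y ∈ F, lattice.Adj y x ∧ lattice.Adj y m

/-- In the additive epoch `n` the moving robot goes from `a n` to `b n` by edge-following, along an
unobstructed path, and is able to localize itself at both ends. -/
def AdditiveMove (r : ℝ) (I : Multiset LatticePoint) {M : ℕ} (a b : Fin M → LatticePoint)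
    (n : Fin M) : Prop :=
  EdgeFollows r {w | w ∈ stationary I a b n} (a n) (b n) ∧
    CanLocalizeAt r I a b n (a n) ∧ CanLocalizeAt r I a b n (b n)

/-- A rearranged robot goes from `a n` to `b n` by ribbon-following on its ribbon `R`, and is
able to localize itself at both ends. -/
def RearrangedMove (S : Set LatticePoint) (r : ℝ) (I : Multiset LatticePoint) {M : ℕ}
    (a b : Fin M → LatticePoint) (n : Fin M) : Prop :=
  ∃ F, IsGuide S F (ribbonOf S (a n)) ∧
    RibbonFollows r {w | w ∈ stationary I a b n} F (ribbonOf S (a n)) (a n) (b n) ∧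
    CanLocalizeAt r I a b n (a n) ∧ CanLocalizeAt r I a b n (b n)

/-- A recycled robot goes from `a n` by ribbon-following to the first vertex `x` of its ribbon `R`
and on to the merging point `m` of `R`, and then by edge-following to `b n`; it is able to localize
itself at `a n`, `x`, `m` and `b n`. -/
def RecycledMove (S : Set LatticePoint) (r : ℝ) (I : Multiset LatticePoint) {M : ℕ}
    (a b : Fin M → LatticePoint) (n : Fin M) : Prop :=
  ∃ F x m, IsGuide S F (ribbonOf S (a n)) ∧ IsFirstVertex S (ribbonOf S (a n)) x ∧
    IsMergingPoint S F x m ∧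
    RibbonFollows r {w | w ∈ stationary I a b n} F (ribbonOf S (a n)) (a n) x ∧
    FollowStep r {w | w ∈ stationary I a b n} ({w | w ∈ stationary I a b n} ∩ F) x m ∧
    EdgeFollows r {w | w ∈ stationary I a b n} m (b n) ∧
    CanLocalizeAt r I a b n (a n) ∧ CanLocalizeAt r I a b n x ∧
    CanLocalizeAt r I a b n m ∧ CanLocalizeAt r I a b n (b n)

/-! # Correctness of the assembly and recycling of shapes by edge- and ribbon-following

**Boundary walks.** Call a set `A` of lattice points smooth if around each free lattice point the
occupied neighbours are consecutive and at most three (`Smooth`). At a free point next to a smooth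
set there is then exactly one robot around which a clockwise rotation is possible
(`Smooth.exists_pivot`, `Smooth.pivot_unique`), so edge-following is a deterministic and injective
walk on the boundary positions. The spacing `d` is the one for which disks just fit: on the arc around
`c` from `p` to the next lattice point, the only lattice point other than `p`, that next point and
`c` that could come too close is the mirror image of `c` in the chord, at distance
`(√3 - 1) d = 2 r` from the midpoint of the arc (`two_radius_le_dist_mirror`,
`arcClear_spacing_iff`). Hence smoothness makes each step of the walk unobstructed.

Reachability requires no topology of curves. If the boundary of `A` is a single cycle of this walk
(`OneOrbit`), adding a boundary point that preserves smoothness only replaces this point, in the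
cycle, by its free neighbours (`OneOrbit.insert`). The boundary of the seeds is a single cycle, and
all configurations that occur arise from the seeds by such additions (`oneOrbit_join`). So any
boundary position is reached from any other.

**Ribbons.** The absence of holes in `S` enters through a parity argument: a closed lattice walk has
a well-defined winding parity around each point off the walk, and a finite region enclosed by the
walk has a corner with three consecutive neighbours on its border (`exists_pocket_corner`). Applied
to the points of smallest hop counts, this shows by induction on the hop count that the neighbours
of smaller hop count of a point are pairwise adjacent, and that adjacent points of equal hop count
share a neighbour of smaller hop count (`lowerClique_and_sharedLower`). It follows that a ribbon has
a unique parent and that its ribbon order is linear; rotating around the parent sends a directed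
cycle on a ribbon to one on its parent, and the root ribbon has none. The structure `RibbonRegion`
collects what is used of `S` and of the idle half-plane, where hop counts are explicit. A partial
assembly in which ribbons are filled from the front, parents before children, is `FrontClosed`; it
is smooth (`smooth_of_frontClosed`). In a union of complete ribbons that contains parents, each point
has two neighbours, not collinear with it, whose hop counts are not larger (`exists_triple`); this
gives localization.

**Movement sequences.** Each sequence enumerates a finite set in a strict total order, hence exists
and is unique (`existsUnique_greedy`). The set of occupied positions before each epoch is explicit
(`robots_step`). Recycled robots are the first vertices of a ribbon, as many as it has holes; so a
front part of a ribbon contains at least as many recycled robots as holes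
(`RibbonRegion.card_holes_le`), and comparing the positions of `sr k` and `tr k` in the order of the
ribbon, a rearranged robot stays on its ribbon and only moves to the front (`tr_eq_or_lt`).

**Recycled robots.** When a ribbon `R` is being emptied, the larger ribbons have been rearranged and
may have holes, so the configuration need not be smooth. Nevertheless the boundary walk around the
complete set `S`, the seeds and the idle robots leads from the merging point of `R` to the target
without rotating around `R` or a descendant of `R` (`exists_detour`): the walk around the
configuration without `R` and its descendants is a single cycle, and whenever it enters `S`, it
leaves `S` again at the merging point, from where it can be started afresh. The points of `S` around which the remaining walk
rotates are on the boundary of `S`; they are not holes, so they are occupied by robots at rest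
(`beside_stationary`).
-/


/-! ### Directions in the hexagonal lattice -/

/-- Counterclockwise rotation of a lattice vector by `π/3`. The six unit vectors are, in
counterclockwise order, `u`, `rot u`, `rot u - u`, `-u`, `-rot u`, `u - rot u`. -/
def rot (u : LatticePoint) : LatticePoint := (-u.2, u.1 + u.2)

/-- `u` is one of the six unit vectors of the lattice. -/
def IsDir (u : LatticePoint) : Prop := u.1 ^ 2 + u.1 * u.2 + u.2 ^ 2 = 1

theorem rot_neg (u : LatticePoint) : rot (-u) = -rot u := by
  ext
  · simp [rot]
  · simp only [rot, Prod.fst_neg, Prod.snd_neg]; ring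

theorem rot_sub (u v : LatticePoint) : rot (u - v) = rot u - rot v := by
  ext <;> simp [rot] <;> ring

theorem rot_rot (u : LatticePoint) : rot (rot u) = rot u - u := by
  ext
  · simp only [rot, Prod.fst_sub]; ring
  · simp [rot]

theorem rotCW_eq (c p : LatticePoint) : rotCW c p = p + rot (c - p) := by
  ext <;> simp [rot, rotCW] <;> ring

theorem isDir_iff (u : LatticePoint) :
    IsDir u ↔ u = (1, 0) ∨ u = (0, 1) ∨ u = (-1, 1) ∨ u = (-1, 0) ∨ u = (0, -1) ∨ u = (1, -1) := by
  obtain ⟨a, b⟩ := u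
  constructor
  · intro h
    simp only [IsDir] at h
    have h1 : a ≤ 1 := by nlinarith [sq_nonneg (a + 2 * b)]
    have h2 : -1 ≤ a := by nlinarith [sq_nonneg (a + 2 * b)]
    have h3 : b ≤ 1 := by nlinarith [sq_nonneg (2 * a + b)]
    have h4 : -1 ≤ b := by nlinarith [sq_nonneg (2 * a + b)]
    interval_cases a <;> interval_cases b <;> simp_all
  · rintro (h | h | h | h | h | h) <;> rw [h] <;> simp [IsDir]

theorem IsDir.rot {u : LatticePoint} (h : IsDir u) : IsDir (rot u) := by
  simp only [IsDir, _root_.rot] at *; linarith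

theorem IsDir.neg {u : LatticePoint} (h : IsDir u) : IsDir (-u) := by
  simp only [IsDir, Prod.fst_neg, Prod.snd_neg] at *; linarith

theorem IsDir.rot_sub {u : LatticePoint} (h : IsDir u) : IsDir (_root_.rot u - u) := by
  rw [← rot_rot]; exact h.rot.rot

theorem IsDir.sub_rot {u : LatticePoint} (h : IsDir u) : IsDir (u - _root_.rot u) := by
  rw [← neg_sub]; exact h.rot_sub.neg

theorem IsDir.ne_zero {u : LatticePoint} (h : IsDir u) : u ≠ 0 := by
  rintro rfl; simp [IsDir] at h

/-- Every unit vector is one of the six rotations of a given one. -/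
theorem IsDir.cases {u w : LatticePoint} (hu : IsDir u) (hw : IsDir w) :
    w = u ∨ w = _root_.rot u ∨ w = _root_.rot u - u ∨ w = -u ∨ w = -_root_.rot u ∨
      w = u - _root_.rot u := by
  rw [isDir_iff] at hu hw
  rcases hu with rfl | rfl | rfl | rfl | rfl | rfl <;>
  rcases hw with rfl | rfl | rfl | rfl | rfl | rfl <;> decide

theorem adj_iff (x y : LatticePoint) : lattice.Adj x y ↔ IsDir (y - x) := by
  simp only [lattice, sqDist, IsDir, Prod.fst_sub, Prod.snd_sub]
  constructor <;> intro h <;> linarith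

theorem adj_add {x u : LatticePoint} (h : IsDir u) : lattice.Adj x (x + u) := by
  rw [adj_iff, add_sub_cancel_left]; exact h

theorem exists_dir_of_adj {x y : LatticePoint} (h : lattice.Adj x y) :
    ∃ u, IsDir u ∧ y = x + u := ⟨y - x, (adj_iff x y).1 h, by abel⟩

theorem adj_add_iff {x u : LatticePoint} : lattice.Adj x (x + u) ↔ IsDir u := by
  rw [adj_iff, add_sub_cancel_left]

/-! ### The boundary walk around a smooth set -/

/-- Around each lattice point outside a smooth set, the neighbours in the set are consecutive and
number at most three: no two of them are opposite, and there is no gap of length one. -/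
def Smooth (A : Set LatticePoint) : Prop :=
  ∀ p ∉ A, ∀ u, IsDir u → p + u ∈ A →
    p - u ∉ A ∧ (p + (rot u - u) ∈ A → p + rot u ∈ A)

/-- At the free position `p`, one can rotate clockwise around the occupied neighbour `p + u`. -/
def Pivot (A : Set LatticePoint) (p u : LatticePoint) : Prop :=
  IsDir u ∧ p ∉ A ∧ p + u ∈ A ∧ p + rot u ∉ A ∧ p + (rot u - u) ∉ A

/-- One step of the clockwise boundary walk around `A`. -/
def Step (A : Set LatticePoint) (p q : LatticePoint) : Prop :=
  ∃ u, Pivot A p u ∧ q = p + rot u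

/-- `p` is a position on the boundary of `A`: it is free and has a neighbour in `A`. -/
def Touches (A : Set LatticePoint) (p : LatticePoint) : Prop :=
  p ∉ A ∧ ∃ u, IsDir u ∧ p + u ∈ A

/-- The boundary of `A` is a single cycle of the boundary walk. -/
def OneOrbit (A : Set LatticePoint) : Prop :=
  ∀ p q, Touches A p → Touches A q → Relation.ReflTransGen (Step A) p q

theorem Smooth.exists_pivot {A : Set LatticePoint} (hA : Smooth A) {p : LatticePoint}
    (hp : Touches A p) : ∃ u, Pivot A p u := by
  obtain ⟨hp, u, hu, hpu⟩ := hp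
  have h1 := hA p hp u hu hpu
  by_cases h2 : p + rot u ∈ A
  · have h3 := hA p hp _ hu.rot h2
    rw [rot_rot] at h3
    by_cases h4 : p + (rot u - u) ∈ A
    · refine ⟨rot u - u, hu.rot_sub, hp, h4, ?_, ?_⟩
      · rw [rot_sub, rot_rot, sub_sub_cancel_left, ← sub_eq_add_neg]; exact h1.1
      · rw [rot_sub, rot_rot]
        rw [show p + (rot u - u - rot u - (rot u - u)) = p - rot u by abel]; exact h3.1
    · refine ⟨rot u, hu.rot, hp, h2, by rwa [rot_rot], ?_⟩
      rw [rot_rot, show p + (rot u - u - rot u) = p - u by abel]; exact h1.1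
  · exact ⟨u, hu, hp, hpu, h2, fun h => h2 (h1.2 h)⟩

theorem Smooth.pivot_unique {A : Set LatticePoint} (hA : Smooth A) {p u v : LatticePoint}
    (hu : Pivot A p u) (hv : Pivot A p v) : v = u := by
  obtain ⟨hu, hp, h1, h2, h3⟩ := hu
  obtain ⟨hv, -, h4, h5, h6⟩ := hv
  rcases hu.cases hv with h | h | h | h | h | h
  · exact h
  · exact absurd (h ▸ h4) h2
  · exact absurd (h ▸ h4) h3
  · rw [h, ← sub_eq_add_neg] at h4; exact absurd h4 (hA p hp u hu h1).1
  · rw [h, rot_neg, rot_rot, show p + (-(rot u - u) - -rot u) = p + u by abel] at h6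
    exact absurd h1 h6
  · rw [h, rot_sub, rot_rot, show p + (rot u - (rot u - u)) = p + u by abel] at h5
    exact absurd h1 h5

theorem Smooth.step_unique {A : Set LatticePoint} (hA : Smooth A) {p q q' : LatticePoint}
    (h : Step A p q) (h' : Step A p q') : q' = q := by
  obtain ⟨u, hu, rfl⟩ := h
  obtain ⟨v, hv, rfl⟩ := h'
  rw [hA.pivot_unique hu hv]

theorem Smooth.step_pred_unique {A : Set LatticePoint} (hA : Smooth A) {p p' q : LatticePoint}
    (h : Step A p q) (h' : Step A p' q) : p' = p := by
  obtain ⟨u, ⟨hu, hp, h1, h2, h3⟩, rfl⟩ := h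
  obtain ⟨v, ⟨hv, hp', h4, h5, h6⟩, hq⟩ := h'
  obtain rfl : p' = p + rot u - rot v := by rw [hq]; abel
  rcases hu.cases hv with h | h | h | h | h | h
  · rw [h]; abel
  · rw [h, rot_rot, show p + rot u - (rot u - u) = p + u by abel] at hp'
    exact absurd h1 hp'
  · rw [h] at h6
    simp only [rot_sub, rot_rot] at h6
    rw [show p + rot u - (rot u - u - rot u) + (rot u - u - rot u - (rot u - u)) = p + u by abel]
      at h6
    exact absurd h1 h6
  · have := (hA _ h2 (u - rot u) hu.sub_rot
      (by rwa [show p + rot u + (u - rot u) = p + u by abel])).1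
    rw [h, rot_neg] at h4
    rw [show p + rot u - -rot u + -u = p + rot u - (u - rot u) by abel] at h4
    exact absurd h4 this
  · rw [h, rot_neg, rot_rot] at h4
    rw [show p + rot u - -(rot u - u) + -rot u = p + (rot u - u) by abel] at h4
    exact absurd h4 h3
  · rw [h, rot_sub, rot_rot] at h4
    rw [show p + rot u - (rot u - (rot u - u)) + (u - rot u) = p by abel] at h4
    exact absurd h4 hp

/-- The step of the boundary walk that leads to `x`. -/
theorem step_to {A : Set LatticePoint} {x w : LatticePoint} (hw : IsDir w) (hx : x ∉ A)
    (h0 : x + w ∉ A) (h1 : x + rot w ∉ A) (h2 : x + (rot w - w) ∈ A) : Step A (x + rot w) x := by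
  refine ⟨-w, ⟨hw.neg, h1, ?_, ?_, ?_⟩, ?_⟩
  · convert h2 using 1; abel
  · rwa [rot_neg, show x + rot w + -rot w = x by abel]
  · rwa [rot_neg, show x + rot w + (-rot w - -w) = x + w by abel]
  · rw [rot_neg]; abel

theorem Step.touches_left {A : Set LatticePoint} {p q : LatticePoint} (h : Step A p q) :
    Touches A p := by
  obtain ⟨u, ⟨hu, hp, h1, -⟩, -⟩ := h
  exact ⟨hp, u, hu, h1⟩

theorem Step.touches_right {A : Set LatticePoint} {p q : LatticePoint} (h : Step A p q) :
    Touches A q := by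
  obtain ⟨u, ⟨hu, hp, h1, h2, h3⟩, rfl⟩ := h
  refine ⟨h2, u - rot u, hu.sub_rot, ?_⟩
  convert h1 using 1; abel

/-- A step of the boundary walk around `A` is also one around a larger smooth set, provided that
its endpoints remain free. -/
theorem Step.mono {A B : Set LatticePoint} (hB : Smooth B) (hAB : A ⊆ B) {p q : LatticePoint}
    (h : Step A p q) (hp : p ∉ B) (hq : q ∉ B) : Step B p q := by
  obtain ⟨u, ⟨hu, -, h1, -, -⟩, rfl⟩ := h
  exact ⟨u, ⟨hu, hp, hAB h1, hq, fun h4 => hq ((hB p hp u hu (hAB h1)).2 h4)⟩, rfl⟩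

/-- Around a newly added point `x`, the walk runs clockwise through the free neighbours of `x`. -/
theorem step_around_insert {A : Set LatticePoint} {x w : LatticePoint}
    (hA' : Smooth (insert x A)) (hw : IsDir w) (h0 : x + w ∉ A) (h1 : x + rot w ∉ A) :
    Step (insert x A) (x + rot w) (x + w) := by
  have e1 : x + rot w ∉ insert x A := by
    rw [Set.mem_insert_iff, add_eq_left]; exact fun h => h.elim hw.rot.ne_zero h1
  have e0 : x + w ∉ insert x A := by
    rw [Set.mem_insert_iff, add_eq_left]; exact fun h => h.elim hw.ne_zero h0
  have hx : x + rot w + -rot w ∈ insert x A := by simp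
  have e2 : x + rot w + rot (-rot w) = x + w := by rw [rot_neg, rot_rot]; abel
  refine ⟨-rot w, ⟨hw.rot.neg, e1, hx, by rwa [e2], fun h => ?_⟩, e2.symm⟩
  have := (hA' _ e1 _ hw.rot.neg hx).2 h
  rw [e2] at this
  exact e0 this

/-- Adding a boundary point `x` to a smooth set replaces `x`, in the boundary cycle, by the free
neighbours of `x`; so the boundary remains a single cycle. -/
theorem OneOrbit.insert {A : Set LatticePoint} {x : LatticePoint} (hO : OneOrbit A)
    (hA : Smooth A) (hx : Touches A x) (hA' : Smooth (insert x A)) : OneOrbit (insert x A) := by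
  obtain ⟨u, hu⟩ := hA.exists_pivot hx
  have hnext : Step A x (x + rot u) := ⟨u, hu, rfl⟩
  obtain ⟨hu, hxA, h0, h1, h2⟩ := hu
  have h3 := (hA x hxA u hu h0).1
  have lift : ∀ {p q}, Step A p q → p ≠ x → q ≠ x → Step (Insert.insert x A) p q := by
    intro p q h hp hq
    refine h.mono hA' (Set.subset_insert _ _) ?_ ?_
    · exact fun h' => h'.elim hp h.touches_left.1
    · exact fun h' => h'.elim hq h.touches_right.1
  have s21 : Step (Insert.insert x A) (x + (rot u - u)) (x + rot u) := by
    have := step_around_insert hA' hu.rot h1 (by rwa [rot_rot])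
    rwa [rot_rot] at this
  have s32 : Step (Insert.insert x A) (x - u) (x + (rot u - u)) := by
    have e : rot (rot u - u) = -u := by rw [rot_sub, rot_rot]; abel
    have := step_around_insert hA' hu.rot_sub h2 (by rwa [e, ← sub_eq_add_neg])
    rwa [e, ← sub_eq_add_neg] at this
  -- the free neighbours of `x` lie between its predecessor `g` and its successor `x + rot u`
  obtain ⟨g, hg, hgap⟩ : ∃ g, Step A g x ∧ ∀ w, IsDir w → x + w ∉ A →
      Relation.ReflTransGen (Step (Insert.insert x A)) g (x + w) ∧
      Relation.ReflTransGen (Step (Insert.insert x A)) (x + w) (x + rot u) := by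
    have r1 := Relation.ReflTransGen.refl (r := Step (Insert.insert x A)) (a := x + rot u)
    have r2 := Relation.ReflTransGen.head s21 r1
    have r3 := Relation.ReflTransGen.head s32 r2
    -- `x + u` lies in `A`, and the next three neighbours of `x` do not; by smoothness the
    -- neighbours of `x` in `A` are `x + u` alone or together with one or two of those after it
    by_cases h4 : x - rot u ∈ A
    · have h5 : x + (u - rot u) ∈ A := by
        have := (hA x hxA (-rot u) hu.rot.neg (by rwa [← sub_eq_add_neg])).2
        rw [rot_neg, rot_rot, show x + (-(rot u - u) - -rot u) = x + u by abel,
          show -(rot u - u) = u - rot u by abel] at this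
        exact this h0
      refine ⟨x - u, ?_, ?_⟩
      · have := step_to (A := A) (x := x) hu.rot_sub hxA h2
        rw [rot_sub, rot_rot, show x + (rot u - u - rot u) = x - u by abel,
          show x + (rot u - u - rot u - (rot u - u)) = x - rot u by abel] at this
        exact this h3 h4
      · intro w hw hxw
        have q1 := Relation.ReflTransGen.refl (r := Step (Insert.insert x A)) (a := x - u)
        have q2 := q1.tail s32
        have q3 := q2.tail s21
        rcases hu.cases hw with h | h | h | h | h | h <;> subst h
        · exact absurd h0 hxw
        · exact ⟨q3, r1⟩
        · exact ⟨q2, r2⟩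
        · exact ⟨q1, r3⟩
        · rw [← sub_eq_add_neg] at hxw; exact absurd h4 hxw
        · exact absurd h5 hxw
    · have s43 : Step (Insert.insert x A) (x - rot u) (x - u) := by
        have := step_around_insert hA' hu.neg (by rwa [← sub_eq_add_neg])
          (by rwa [rot_neg, ← sub_eq_add_neg])
        rwa [rot_neg, ← sub_eq_add_neg, ← sub_eq_add_neg] at this
      have r4 := Relation.ReflTransGen.head s43 r3
      by_cases h5 : x + (u - rot u) ∈ A
      · refine ⟨x - rot u, ?_, ?_⟩
        · have := step_to (A := A) (x := x) hu.neg hxA (by rwa [← sub_eq_add_neg])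
          rw [rot_neg, ← sub_eq_add_neg, show -rot u - -u = u - rot u by abel] at this
          exact this h4 h5
        · intro w hw hxw
          have q1 := Relation.ReflTransGen.refl (r := Step (Insert.insert x A)) (a := x - rot u)
          have q2 := q1.tail s43
          have q3 := q2.tail s32
          have q4 := q3.tail s21
          rcases hu.cases hw with h | h | h | h | h | h <;> subst h
          · exact absurd h0 hxw
          · exact ⟨q4, r1⟩
          · exact ⟨q3, r2⟩
          · exact ⟨q2, r3⟩
          · exact ⟨q1, r4⟩
          · exact absurd h5 hxw
      · have s54 : Step (Insert.insert x A) (x + (u - rot u)) (x - rot u) := by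
          have e : rot (-rot u) = u - rot u := by rw [rot_neg, rot_rot]; abel
          have := step_around_insert hA' hu.rot.neg (by rwa [← sub_eq_add_neg]) (by rwa [e])
          rwa [e, ← sub_eq_add_neg] at this
        have r5 := Relation.ReflTransGen.head s54 r4
        refine ⟨x + (u - rot u), ?_, ?_⟩
        · have := step_to (A := A) (x := x) hu.rot.neg hxA (by rwa [← sub_eq_add_neg])
          rw [rot_neg, rot_rot, show -(rot u - u) = u - rot u by abel,
            show u - rot u - -rot u = u by abel] at this
          exact this h5 h0
        · intro w hw hxw
          have q1 := Relation.ReflTransGen.refl (r := Step (Insert.insert x A))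
            (a := x + (u - rot u))
          have q2 := q1.tail s54
          have q3 := q2.tail s43
          have q4 := q3.tail s32
          have q5 := q4.tail s21
          rcases hu.cases hw with h | h | h | h | h | h <;> subst h
          · exact absurd h0 hxw
          · exact ⟨q5, r1⟩
          · exact ⟨q4, r2⟩
          · exact ⟨q3, r3⟩
          · exact ⟨q2, r4⟩
          · exact ⟨q1, r5⟩
  -- a new boundary position is a free neighbour of `x`
  have hneighbour : ∀ {p}, Touches (Insert.insert x A) p → ¬ Touches A p →
      ∃ w, IsDir w ∧ x + w ∉ A ∧ p = x + w := by
    rintro p ⟨hp, v, hv, hpv⟩ hnt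
    rw [Set.mem_insert_iff, not_or] at hp
    rcases hpv with h | h
    · refine ⟨-v, hv.neg, ?_, ?_⟩
      · rw [← h]; simpa using hp.2
      · rw [← h]; simp
    · exact absurd ⟨hp.2, v, hv, h⟩ hnt
  -- a walk around `A` to `x` is cut off at the predecessor `g` of `x`
  have htox : ∀ p, Relation.ReflTransGen (Step A) p x → p ≠ x →
      Relation.ReflTransGen (Step (Insert.insert x A)) p g := by
    intro p hp
    induction hp using Relation.ReflTransGen.head_induction_on with
    | refl => exact fun h => absurd rfl h
    | head hs _ ih =>
      intro ha
      rename_i b _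
      by_cases hb : b = x
      · rw [hb] at hs
        rw [hA.step_pred_unique hg hs]
      · exact (ih hb).head (lift hs ha hb)
  -- a walk around `A` from `x` is begun at the successor `x + rot u` of `x`
  have hfromx : ∀ q, Relation.ReflTransGen (Step A) x q → q ≠ x →
      Relation.ReflTransGen (Step (Insert.insert x A)) (x + rot u) q := by
    intro q hq
    induction hq with
    | refl => exact fun h => absurd rfl h
    | tail _ hs ih =>
      intro hb
      rename_i a _ _
      by_cases ha : a = x
      · rw [ha] at hs
        rw [hA.step_unique hnext hs]
      · exact (ih ha).tail (lift hs ha hb)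
  have hg1 : Touches A (x + rot u) := hnext.touches_right
  have hxr : x + rot u ≠ x := by rw [Ne, add_eq_left]; exact hu.rot.ne_zero
  have hround : Relation.ReflTransGen (Step (Insert.insert x A)) (x + rot u) g :=
    htox _ (hO _ _ hg1 hx) hxr
  have hglast : Relation.ReflTransGen (Step (Insert.insert x A)) g (x + rot u) :=
    (hgap (rot u) hu.rot h1).1
  intro p q hp hq
  have hp1 : Relation.ReflTransGen (Step (Insert.insert x A)) p (x + rot u) := by
    by_cases ht : Touches A p
    · exact (htox p (hO _ _ ht hx) (fun h => hp.1 (Or.inl h))).trans hglast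
    · obtain ⟨w, hw, hxw, rfl⟩ := hneighbour hp ht
      exact (hgap w hw hxw).2
  refine hp1.trans ?_
  by_cases ht : Touches A q
  · exact hfromx q (hO _ _ hx ht) (fun h => hq.1 (Or.inl h))
  · obtain ⟨w, hw, hxw, rfl⟩ := hneighbour hq ht
    exact hround.trans (hgap w hw hxw).1

/-! ### Distances along an arc -/

theorem latticeSpacing_pos {r : ℝ} (hr : 0 < r) : 0 < latticeSpacing r := by
  have : (1 : ℝ) < √3 := by rw [Real.lt_sqrt] <;> norm_num
  exact div_pos (by linarith) (by linarith)

theorem two_mul_radius (r : ℝ) : 2 * r = latticeSpacing r * (√3 - 1) := by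
  have : (1 : ℝ) < √3 := by rw [Real.lt_sqrt] <;> norm_num
  rw [latticeSpacing, div_mul_cancel₀]; linarith

/-- First coordinate of `w` in the frame with origin `c` and basis `p - c`, `rotCW c p - c`. -/
def frameFst (c p w : LatticePoint) : ℤ :=
  (p.1 - c.1) * (w.1 - c.1) + (p.1 - c.1 + (p.2 - c.2)) * (w.2 - c.2)

/-- Second coordinate of `w` in the frame with origin `c` and basis `p - c`, `rotCW c p - c`. -/
def frameSnd (c p w : LatticePoint) : ℤ :=
  (p.2 - c.2) * (w.1 - c.1) - (p.1 - c.1) * (w.2 - c.2)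

theorem eq_of_frame {c p w w' : LatticePoint} (h : lattice.Adj c p)
    (h1 : frameFst c p w = frameFst c p w') (h2 : frameSnd c p w = frameSnd c p w') : w = w' := by
  rw [adj_iff, IsDir, Prod.fst_sub, Prod.snd_sub] at h
  simp only [frameFst, frameSnd] at h1 h2
  ext
  · linear_combination (p.1 - c.1) * h1 + (p.1 - c.1 + (p.2 - c.2)) * h2 - (w.1 - w'.1) * h
  · linear_combination (p.2 - c.2) * h1 - (p.1 - c.1) * h2 - (w.2 - w'.2) * h

/-- The law of cosines. In the frame of the arc, the point with angle `θ` is the unit vector whose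
inner products with the two basis vectors are `cos θ` and `cos (π / 3 - θ)`. -/
theorem dist_arcPoint_sq (r : ℝ) {c p : LatticePoint} (w : LatticePoint) (θ : ℝ)
    (h : lattice.Adj c p) :
    dist (arcPoint r c p θ) (pos r w) ^ 2 = latticeSpacing r ^ 2 *
      (1 + ((frameFst c p w : ℝ) ^ 2 + frameFst c p w * frameSnd c p w + frameSnd c p w ^ 2)
        - 2 * (frameFst c p w * Real.cos θ
            + frameSnd c p w * (Real.cos θ / 2 + √3 / 2 * Real.sin θ))) := by
  have h3 : (√3 : ℝ) ^ 2 = 3 := Real.sq_sqrt (by norm_num)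
  have hcs := Real.sin_sq_add_cos_sq θ
  rw [adj_iff, IsDir, Prod.fst_sub, Prod.snd_sub] at h
  have hv : ((p.1 : ℝ) - c.1) ^ 2 + (p.1 - c.1) * (p.2 - c.2) + (p.2 - c.2) ^ 2 = 1 := by
    exact_mod_cast h
  have he : Complex.exp (-(θ : ℂ) * Complex.I)
      = (Real.cos θ : ℂ) - (Real.sin θ : ℂ) * Complex.I := by
    rw [← Complex.ofReal_neg, Complex.exp_mul_I, ← Complex.ofReal_cos, ← Complex.ofReal_sin,
      Real.cos_neg, Real.sin_neg]
    push_cast; ring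
  rw [Complex.dist_eq, Complex.sq_norm, Complex.normSq_apply, arcPoint, he]
  simp only [pos, frameFst, frameSnd, Complex.sub_re, Complex.sub_im, Complex.mul_re,
    Complex.mul_im, Complex.add_re, Complex.add_im, Complex.ofReal_re, Complex.ofReal_im,
    Complex.I_re, Complex.I_im]
  push_cast
  generalize latticeSpacing r = d
  generalize Real.cos θ = C at *
  generalize Real.sin θ = S at *
  generalize (√3 : ℝ) = q at *
  obtain ⟨v1, hv1⟩ : ∃ v1, v1 = (p.1 : ℝ) - c.1 := ⟨_, rfl⟩
  obtain ⟨v2, hv2⟩ : ∃ v1, v1 = (p.2 : ℝ) - c.2 := ⟨_, rfl⟩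
  obtain ⟨z1, hz1⟩ : ∃ v1, v1 = (w.1 : ℝ) - c.1 := ⟨_, rfl⟩
  obtain ⟨z2, hz2⟩ : ∃ v1, v1 = (w.2 : ℝ) - c.2 := ⟨_, rfl⟩
  rw [← hv1, ← hv2] at hv
  rw [← hv1, ← hv2, ← hz1, ← hz2]
  have e1 : (p.1 : ℝ) = v1 + c.1 := by linarith
  have e2 : (p.2 : ℝ) = v2 + c.2 := by linarith
  have e3 : (w.1 : ℝ) = z1 + c.1 := by linarith
  have e4 : (w.2 : ℝ) = z2 + c.2 := by linarith
  rw [e1, e2, e3, e4]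
  linear_combination
    (d ^ 2 * ((v2 * C - z2) ^ 2 / 4 + v2 ^ 2 * S ^ 2 / 4)) * h3
      + d ^ 2 * hcs + d ^ 2 * (S ^ 2 + C ^ 2 - (z1 ^ 2 + z1 * z2 + z2 ^ 2)) * hv

theorem frame_self {c p : LatticePoint} (h : lattice.Adj c p) :
    frameFst c p p = 1 ∧ frameSnd c p p = 0 := by
  rw [adj_iff, IsDir, Prod.fst_sub, Prod.snd_sub] at h
  constructor
  · simp only [frameFst]; linear_combination h
  · simp only [frameSnd]; ring

theorem frame_rotCW {c p : LatticePoint} (h : lattice.Adj c p) :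
    frameFst c p (rotCW c p) = 0 ∧ frameSnd c p (rotCW c p) = 1 := by
  rw [adj_iff, IsDir, Prod.fst_sub, Prod.snd_sub] at h
  constructor
  · simp only [frameFst, rotCW]; ring
  · simp only [frameSnd, rotCW]; linear_combination h

theorem frame_mirror {c p : LatticePoint} (h : lattice.Adj c p) :
    frameFst c p (p + rotCW c p - c) = 1 ∧ frameSnd c p (p + rotCW c p - c) = 1 := by
  rw [adj_iff, IsDir, Prod.fst_sub, Prod.snd_sub] at h
  constructor
  · simp only [frameFst, rotCW, Prod.fst_add, Prod.snd_add, Prod.fst_sub, Prod.snd_sub]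
    linear_combination h
  · simp only [frameSnd, rotCW, Prod.fst_add, Prod.snd_add, Prod.fst_sub, Prod.snd_sub]
    linear_combination h

theorem cos_frame {θ : ℝ} (hθ : θ ∈ Set.Icc (0 : ℝ) (Real.pi / 3)) :
    (1 / 2 ≤ Real.cos θ ∧ Real.cos θ ≤ 1) ∧
    (1 / 2 ≤ Real.cos θ / 2 + √3 / 2 * Real.sin θ ∧
      Real.cos θ / 2 + √3 / 2 * Real.sin θ ≤ 1) := by
  have hpi := Real.pi_pos
  have key : ∀ t ∈ Set.Icc (0 : ℝ) (Real.pi / 3), 1 / 2 ≤ Real.cos t ∧ Real.cos t ≤ 1 := by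
    intro t ht
    refine ⟨?_, Real.cos_le_one t⟩
    rw [← Real.cos_pi_div_three]
    exact Real.cos_le_cos_of_nonneg_of_le_pi ht.1 (by linarith) ht.2
  have e : Real.cos θ / 2 + √3 / 2 * Real.sin θ = Real.cos (Real.pi / 3 - θ) := by
    rw [Real.cos_sub, Real.cos_pi_div_three, Real.sin_pi_div_three]; ring
  rw [e]
  exact ⟨key θ hθ, key _ ⟨by linarith [hθ.2], by linarith [hθ.1]⟩⟩

/-- Lattice points other than the two ends of the arc and the mirror image of its centre are at
least one spacing away from the arc. -/
theorem frame_bound {C E : ℝ} (hC : 1 / 2 ≤ C ∧ C ≤ 1) (hE : 1 / 2 ≤ E ∧ E ≤ 1) (s t : ℤ)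
    (h1 : ¬ (s = 1 ∧ t = 0)) (h2 : ¬ (s = 0 ∧ t = 1)) (h3 : ¬ (s = 1 ∧ t = 1)) :
    0 ≤ ((s : ℝ) ^ 2 + s * t + t ^ 2) - 2 * (s * C + t * E) := by
  have mixed : ∀ (C E : ℝ), C ≤ 1 → 1 / 2 ≤ E → ∀ s t : ℤ, 1 ≤ s → t ≤ -1 →
      0 ≤ ((s : ℝ) ^ 2 + s * t + t ^ 2) - 2 * (s * C + t * E) := by
    intro C E hC hE s t hs ht
    have hs' : (1 : ℝ) ≤ s := by exact_mod_cast hs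
    have ht' : (t : ℝ) ≤ -1 := by exact_mod_cast ht
    have hz : 0 ≤ s ^ 2 + s * t + t ^ 2 - 2 * s - t := by
      by_contra hneg
      have : s ^ 2 + s * t + t ^ 2 - 2 * s - t ≤ -1 := by omega
      nlinarith [sq_nonneg (2 * s + t - 2)]
    have hz' : (0 : ℝ) ≤ (s : ℝ) ^ 2 + s * t + t ^ 2 - 2 * s - t := by exact_mod_cast hz
    nlinarith
  have axis : ∀ C : ℝ, C ≤ 1 → ∀ s : ℤ, 2 ≤ s → 0 ≤ (s : ℝ) ^ 2 - 2 * (s * C) := by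
    intro C hC s hs
    have hs' : (2 : ℝ) ≤ s := by exact_mod_cast hs
    nlinarith
  have neg : ∀ s : ℤ, s ≤ 0 → (s : ℝ) ≤ 0 := fun s hs => by exact_mod_cast hs
  rcases le_or_gt s 0 with hs | hs
  · rcases le_or_gt t 0 with ht | ht
    · have := neg s hs; have := neg t ht
      nlinarith [sq_nonneg ((s : ℝ) + t), sq_nonneg (s : ℝ), sq_nonneg (t : ℝ)]
    · rcases eq_or_lt_of_le hs with hs0 | hs0
      · have := axis E hE.2 t (by omega)
        rw [hs0]; push_cast; linarith
      · have := mixed E C hE.2 hC.1 t s (by omega) (by omega)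
        linarith
  · rcases lt_trichotomy t 0 with ht | ht | ht
    · exact mixed C E hC.2 hE.1 s t (by omega) (by omega)
    · have := axis C hC.2 s (by omega)
      rw [ht]; push_cast; linarith
    · have hs' : (1 : ℝ) ≤ s := by exact_mod_cast hs
      have ht' : (1 : ℝ) ≤ t := by exact_mod_cast ht
      have hst : (3 : ℝ) ≤ s + t := by
        have : 3 ≤ s + t := by omega
        exact_mod_cast this
      nlinarith [mul_nonneg (sub_nonneg.2 hs') (sub_nonneg.2 ht')]

theorem le_dist_arcPoint {r : ℝ} (hr : 0 < r) {c p w : LatticePoint} (h : lattice.Adj c p) {θ : ℝ}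
    (hθ : θ ∈ Set.Icc (0 : ℝ) (Real.pi / 3)) (h1 : w ≠ p) (h2 : w ≠ rotCW c p)
    (h3 : w ≠ p + rotCW c p - c) :
    latticeSpacing r ≤ dist (arcPoint r c p θ) (pos r w) := by
  obtain ⟨hC, hE⟩ := cos_frame hθ
  have hd := latticeSpacing_pos hr
  refine (sq_le_sq₀ hd.le dist_nonneg).1 ?_
  rw [dist_arcPoint_sq r w θ h]
  have := frame_bound hC hE (frameFst c p w) (frameSnd c p w)
    (fun e => h1 (eq_of_frame h (e.1.trans (frame_self h).1.symm) (e.2.trans (frame_self h).2.symm)))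
    (fun e => h2 (eq_of_frame h (e.1.trans (frame_rotCW h).1.symm)
      (e.2.trans (frame_rotCW h).2.symm)))
    (fun e => h3 (eq_of_frame h (e.1.trans (frame_mirror h).1.symm)
      (e.2.trans (frame_mirror h).2.symm)))
  nlinarith [sq_nonneg (latticeSpacing r)]

/-- The arc passes the mirror image of its centre at a distance of at least `(√3 - 1) d = 2r`. This
is the reason for the choice of the lattice spacing. -/
theorem two_radius_le_dist_mirror {r : ℝ} (hr : 0 < r) {c p : LatticePoint}
    (h : lattice.Adj c p) {θ : ℝ} :
    2 * r ≤ dist (arcPoint r c p θ) (pos r (p + rotCW c p - c)) := by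
  have h3 : (√3 : ℝ) ^ 2 = 3 := Real.sq_sqrt (by norm_num)
  have h3' : (0 : ℝ) ≤ √3 := Real.sqrt_nonneg 3
  have hcs := Real.sin_sq_add_cos_sq θ
  refine (sq_le_sq₀ (by positivity) dist_nonneg).1 ?_
  rw [dist_arcPoint_sq r _ θ h, (frame_mirror h).1, (frame_mirror h).2, two_mul_radius, mul_pow]
  refine mul_le_mul_of_nonneg_left ?_ (sq_nonneg _)
  push_cast
  have key : √3 * Real.cos θ + Real.sin θ ≤ 2 := by
    nlinarith [sq_nonneg (Real.cos θ - √3 / 2), sq_nonneg (Real.sin θ - 1 / 2)]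
  have e : √3 * (√3 * Real.cos θ + Real.sin θ) = 3 * Real.cos θ + √3 * Real.sin θ := by
    linear_combination Real.cos θ * h3
  linarith [mul_le_mul_of_nonneg_left key h3']

/-- A robot follows the robots in `G` around `c` if and only if it starts, ends and passes by free
lattice points. -/
theorem arcClear_spacing_iff {r : ℝ} (hr : 0 < r) {G : Set LatticePoint} {c p : LatticePoint}
    (h : lattice.Adj c p) :
    ArcClear r (latticeSpacing r) G c p ↔ p ∉ G ∧ rotCW c p ∉ G ∧ p + rotCW c p - c ∉ G := by
  have hd := latticeSpacing_pos hr
  have hpi := Real.pi_pos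
  constructor
  · intro hG
    refine ⟨fun hp => ?_, fun hp => ?_, fun hp => ?_⟩
    · have := hG 0 ⟨le_rfl, by positivity⟩ p hp
      simp [arcPoint] at this
      linarith
    · have := hG (Real.pi / 3) ⟨by positivity, le_rfl⟩ _ hp
      rw [arcPoint_pi_div_three, dist_self] at this
      linarith
    -- halfway, the distance to the mirror image of the centre is `(√3 - 1) d < d`
    · have h6 := hG (Real.pi / 6) ⟨by positivity, by linarith⟩ _ hp
      have h7 := pow_le_pow_left₀ hd.le h6 2
      rw [dist_arcPoint_sq r _ _ h, (frame_mirror h).1, (frame_mirror h).2, Real.cos_pi_div_six,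
        Real.sin_pi_div_six] at h7
      have : (3 / 2 : ℝ) < √3 := by rw [Real.lt_sqrt] <;> norm_num
      push_cast at h7
      nlinarith [pow_pos hd 2]
  · rintro ⟨h1, h2, h3⟩ θ hθ w hw
    exact le_dist_arcPoint hr h hθ (fun e => h1 (e ▸ hw)) (fun e => h2 (e ▸ hw))
      (fun e => h3 (e ▸ hw))

theorem arcClear_two_radius {r : ℝ} (hr : 0 < r) {Q : Set LatticePoint} {c p : LatticePoint}
    (h : lattice.Adj c p) (h1 : p ∉ Q) (h2 : rotCW c p ∉ Q) : ArcClear r (2 * r) Q c p := by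
  intro θ hθ w hw
  by_cases h3 : w = p + rotCW c p - c
  · rw [h3]; exact two_radius_le_dist_mirror hr h
  · refine le_trans ?_ (le_dist_arcPoint hr h hθ (fun e => h1 (e ▸ hw)) (fun e => h2 (e ▸ hw)) h3)
    have : (√3 : ℝ) ≤ 2 := by rw [Real.sqrt_le_left] <;> norm_num
    rw [two_mul_radius]
    nlinarith [latticeSpacing_pos hr]

theorem canRotate_iff {r : ℝ} (hr : 0 < r) {G : Set LatticePoint} {p u : LatticePoint} :
    CanRotate r G (p + u) p ↔ Pivot G p u := by
  have e1 : rotCW (p + u) p = p + rot u := by rw [rotCW_eq, add_sub_cancel_left]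
  have e2 : p + (p + rot u) - (p + u) = p + (rot u - u) := by abel
  constructor
  · rintro ⟨hc, ha, hG⟩
    rw [arcClear_spacing_iff hr ha, e1, e2] at hG
    exact ⟨adj_add_iff.1 ha.symm, hG.1, hc, hG.2.1, hG.2.2⟩
  · rintro ⟨hu, h0, h1, h2, h3⟩
    refine ⟨h1, (adj_add hu).symm, ?_⟩
    rw [arcClear_spacing_iff hr (adj_add hu).symm, e1, e2]
    exact ⟨h0, h2, h3⟩

/-- A robot that follows `G` at `p` moves to the next boundary position, if there is only one
robot in `G` around which it can rotate. -/
theorem followStep_of_pivot {r : ℝ} (hr : 0 < r) {Q G : Set LatticePoint} {p u : LatticePoint}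
    (hu : Pivot G p u) (huniq : ∀ v, Pivot G p v → v = u) (hp : p ∉ Q) (hp' : p + rot u ∉ Q) :
    FollowStep r Q G p (p + rot u) := by
  have e1 : rotCW (p + u) p = p + rot u := by rw [rotCW_eq, add_sub_cancel_left]
  refine ⟨p + u, (canRotate_iff hr).2 hu, fun c' hc' => ?_, e1.symm, ?_⟩
  · have : p + (c' - p) = c' := by abel
    rw [← this] at hc' ⊢
    rw [huniq _ ((canRotate_iff hr).1 hc')]
  · exact arcClear_two_radius hr (adj_add hu.1).symm hp (by rwa [e1])

/-- The boundary walk around a smooth set `A` is edge-following for every subset of `A` that still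
contains the centres of the rotations. -/
theorem followStep_of_subset {r : ℝ} (hr : 0 < r) {A Q : Set LatticePoint} (hA : Smooth A)
    (hQ : Q ⊆ A) {p u : LatticePoint} (hu : Pivot A p u) (hc : p + u ∈ Q) :
    FollowStep r Q Q p (p + rot u) := by
  have hpA := hu.2.1
  have hp : p ∉ Q := fun h => hu.2.1 (hQ h)
  have hp' : p + rot u ∉ Q := fun h => hu.2.2.2.1 (hQ h)
  refine followStep_of_pivot hr ⟨hu.1, hp, hc, hp', fun h => hu.2.2.2.2 (hQ h)⟩ ?_ hp hp'
  rintro v ⟨hv, -, h1, h2, h3⟩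
  have h4 := hA p hpA u hu.1 hu.2.2.1
  rcases hu.1.cases hv with h | h | h | h | h | h
  · exact h
  · exact absurd (h ▸ hQ h1) hu.2.2.2.1
  · exact absurd (h ▸ hQ h1) hu.2.2.2.2
  · rw [h, ← sub_eq_add_neg] at h1; exact absurd (hQ h1) h4.1
  · rw [h, rot_neg, rot_rot, show p + (-(rot u - u) - -rot u) = p + u by abel] at h3
    exact absurd hc h3
  · rw [h, rot_sub, rot_rot, show p + (rot u - (rot u - u)) = p + u by abel] at h2
    exact absurd hc h2

theorem Smooth.edgeFollows {r : ℝ} (hr : 0 < r) {A : Set LatticePoint} (hA : Smooth A)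
    (hO : OneOrbit A) {p q : LatticePoint} (hp : Touches A p) (hq : Touches A q) :
    EdgeFollows r A p q := by
  refine Relation.ReflTransGen.mono ?_ _ _ (hO p q hp hq)
  rintro x y ⟨u, hu, rfl⟩
  exact followStep_of_subset hr hA subset_rfl hu hu.2.2.1

/-! ### Trilateration -/

theorem dist_pos_le_iff {r : ℝ} (hr : 0 < r) (x y : LatticePoint) :
    dist (pos r x) (pos r y) ≤ 2 * latticeSpacing r ↔ sqDist x y ≤ 4 := by
  have hd := latticeSpacing_pos hr
  rw [← sq_le_sq₀ dist_nonneg (by positivity), dist_pos_sq, mul_pow, mul_comm ((2 : ℝ) ^ 2),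
    mul_le_mul_iff_right₀ (by positivity)]
  norm_num
  exact_mod_cast Iff.rfl

/-- Three lattice points are not collinear if their coordinate differences have a nonzero
determinant. -/
theorem not_collinear_of_det {r : ℝ} (hr : 0 < r) (y : Fin 3 → LatticePoint)
    (h : ((y 1).1 - (y 0).1) * ((y 2).2 - (y 0).2) - ((y 1).2 - (y 0).2) * ((y 2).1 - (y 0).1)
      ≠ 0) : ¬ Collinear ℝ (Set.range fun i => pos r (y i)) := by
  have hd := latticeSpacing_pos hr
  intro hc
  rw [collinear_iff_of_mem (Set.mem_range_self (0 : Fin 3))] at hc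
  obtain ⟨v, hv⟩ := hc
  obtain ⟨s, hs⟩ := hv _ (Set.mem_range_self (1 : Fin 3))
  obtain ⟨t, ht⟩ := hv _ (Set.mem_range_self (2 : Fin 3))
  have h3 : (0 : ℝ) < √3 := by positivity
  have s1 := congrArg Complex.re hs
  have s2 := congrArg Complex.im hs
  have t1 := congrArg Complex.re ht
  have t2 := congrArg Complex.im ht
  simp [pos] at s1 s2 t1 t2
  apply h
  have key : latticeSpacing r ^ 2 * (√3 / 2) * ((((y 1).1 : ℝ) - (y 0).1) * ((y 2).2 - (y 0).2)
      - ((y 1).2 - (y 0).2) * ((y 2).1 - (y 0).1)) = 0 := by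
    have a1 : latticeSpacing r * (((y 1).1 - (y 0).1) + ((y 1).2 - (y 0).2) / 2) = s * v.re := by
      linarith
    have a2 : latticeSpacing r * (√3 / 2 * ((y 1).2 - (y 0).2)) = s * v.im := by linarith
    have a3 : latticeSpacing r * (((y 2).1 - (y 0).1) + ((y 2).2 - (y 0).2) / 2) = t * v.re := by
      linarith
    have a4 : latticeSpacing r * (√3 / 2 * ((y 2).2 - (y 0).2)) = t * v.im := by linarith
    calc _ = latticeSpacing r * (((y 1).1 - (y 0).1) + ((y 1).2 - (y 0).2) / 2) *
          (latticeSpacing r * (√3 / 2 * ((y 2).2 - (y 0).2)))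
        - latticeSpacing r * (√3 / 2 * ((y 1).2 - (y 0).2)) *
          (latticeSpacing r * (((y 2).1 - (y 0).1) + ((y 2).2 - (y 0).2) / 2)) := by ring
      _ = 0 := by rw [a1, a2, a3, a4]; ring
  have key2 := (mul_eq_zero.1 key).resolve_left (by positivity)
  exact_mod_cast key2

/-- Two neighbours of `c`, not opposite to each other, form with `c` a noncollinear triple within
distance `2d` of all neighbours of `c`. -/
theorem trilateration_triple {r : ℝ} (hr : 0 < r) {p c u v : LatticePoint}
    (hp : lattice.Adj p c) (hu : IsDir u) (hv : IsDir v) (h1 : v ≠ u) (h2 : v ≠ -u) :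
    (∀ i, dist (pos r (![c, c + u, c + v] i)) (pos r p) ≤ 2 * latticeSpacing r) ∧
    ¬ Collinear ℝ (Set.range fun i => pos r (![c, c + u, c + v] i)) := by
  obtain ⟨w, hw, rfl⟩ := exists_dir_of_adj hp.symm
  constructor
  · have key : ∀ z, IsDir z → sqDist (c + z) (c + w) ≤ 4 := by
      intro z hz
      rw [isDir_iff] at hw hz
      rcases hw with rfl | rfl | rfl | rfl | rfl | rfl <;>
      rcases hz with rfl | rfl | rfl | rfl | rfl | rfl <;> simp [sqDist]
    intro i
    rw [dist_pos_le_iff hr]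
    fin_cases i
    · have : lattice.Adj c (c + w) := hp.symm
      exact le_trans (le_of_eq this) (by norm_num)
    · exact key u hu
    · exact key v hv
  · apply not_collinear_of_det hr
    rw [isDir_iff] at hu hv
    rcases hu with rfl | rfl | rfl | rfl | rfl | rfl <;>
    rcases hv with rfl | rfl | rfl | rfl | rfl | rfl <;> simp_all

/-! ### Hop counts -/

theorem mem_hub_iff (x : LatticePoint) : x ∈ hub ↔ x = 0 ∨ lattice.Adj 0 x := by
  rw [adj_iff, sub_zero, isDir_iff]
  simp only [hub, p₁, p₂, p₃, p₄, p₅, p₆, Set.mem_insert_iff, Set.mem_singleton_iff]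
  tauto

theorem hop_zero (P : Set LatticePoint) : hop P 0 = 0 := by
  rw [hop, if_pos (SimpleGraph.Reachable.refl 0), SimpleGraph.dist_self]; rfl

theorem reachable_of_hop_nonneg {P : Set LatticePoint} {x : LatticePoint} (h : 0 ≤ hop P x) :
    (regionGraph P).Reachable x 0 := by
  by_contra hn
  rw [hop, if_neg hn] at h
  omega

theorem hop_of_reachable {P : Set LatticePoint} {x : LatticePoint}
    (h : (regionGraph P).Reachable x 0) : hop P x = (regionGraph P).dist x 0 := by
  rw [hop, if_pos h]

theorem eq_zero_of_hop_eq_zero {P : Set LatticePoint} {x : LatticePoint} (h : hop P x = 0) :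
    x = 0 := by
  have hr := reachable_of_hop_nonneg h.ge
  rw [hop_of_reachable hr] at h
  exact hr.dist_eq_zero_iff.1 (by exact_mod_cast h)

theorem hop_adj {P : Set LatticePoint} {x y : LatticePoint} (hx : 0 ≤ hop P x)
    (hxP : x ∈ P ∪ hub) (hy : y ∈ P ∪ hub) (h : lattice.Adj x y) :
    0 ≤ hop P y ∧ hop P y ≤ hop P x + 1 := by
  have hr := reachable_of_hop_nonneg hx
  have ha : (regionGraph P).Adj y x := ⟨h.symm, hy, hxP⟩
  have hr' : (regionGraph P).Reachable y 0 := ha.reachable.trans hr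
  rw [hop_of_reachable hr, hop_of_reachable hr']
  refine ⟨by positivity, ?_⟩
  obtain ⟨w, hw⟩ := hr.exists_walk_length_eq_dist
  have := SimpleGraph.dist_le (SimpleGraph.Walk.cons ha w)
  rw [SimpleGraph.Walk.length_cons, hw] at this
  exact_mod_cast this

theorem exists_hop_pred {P : Set LatticePoint} {x : LatticePoint} (hx : 0 < hop P x) :
    x ∈ P ∪ hub ∧ ∃ y ∈ P ∪ hub, lattice.Adj x y ∧ hop P y = hop P x - 1 := by
  have hr := reachable_of_hop_nonneg hx.le
  obtain ⟨w, hw⟩ := hr.exists_walk_length_eq_dist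
  cases w with
  | nil => rw [hop_zero] at hx; omega
  | cons ha w' =>
    rename_i y
    refine ⟨ha.2.1, y, ha.2.2, ha.1, ?_⟩
    have hy : (regionGraph P).Reachable y 0 := w'.reachable
    have h1 := hop_adj (P := P) (x := y) (y := x)
      (by rw [hop_of_reachable hy]; positivity) ha.2.2 ha.2.1 ha.1.symm
    have h2 := SimpleGraph.dist_le w'
    rw [SimpleGraph.Walk.length_cons] at hw
    rw [hop_of_reachable hr, hop_of_reachable hy] at *
    omega

theorem mem_of_hop_nonneg {P : Set LatticePoint} {x : LatticePoint} (hx : 0 ≤ hop P x) :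
    x ∈ P ∪ hub := by
  rcases hx.eq_or_lt with h | h
  · rw [eq_zero_of_hop_eq_zero h.symm]; exact Or.inr ((mem_hub_iff 0).2 (Or.inl rfl))
  · exact (exists_hop_pred h).1

theorem hop_eq_one_iff {P : Set LatticePoint} {x : LatticePoint} :
    hop P x = 1 ↔ lattice.Adj 0 x := by
  constructor
  · intro h
    obtain ⟨-, y, -, hy, hy'⟩ := exists_hop_pred (P := P) (x := x) (by omega)
    rw [h] at hy'
    rw [eq_zero_of_hop_eq_zero hy'] at hy
    exact hy.symm
  · intro h
    have h1 := hop_adj (P := P) (x := 0) (y := x) (by rw [hop_zero])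
      (Or.inr ((mem_hub_iff 0).2 (Or.inl rfl))) (Or.inr ((mem_hub_iff x).2 (Or.inr h))) h
    rw [hop_zero] at h1
    have h2 : hop P x ≠ 0 := fun h0 => lattice.irrefl (eq_zero_of_hop_eq_zero h0 ▸ h)
    omega

theorem hop_adj_le {P : Set LatticePoint} {x y : LatticePoint} (hx : 0 ≤ hop P x)
    (hy : 0 ≤ hop P y) (h : lattice.Adj x y) : hop P y ≤ hop P x + 1 :=
  (hop_adj hx (mem_of_hop_nonneg hx) (mem_of_hop_nonneg hy) h).2

/-! ### Parity of a closed walk around a lattice triangle -/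

/-- The sum of `f` over the steps of a walk, modulo two. -/
def walkSum (f : LatticePoint → LatticePoint → ZMod 2) :
    ∀ {u v : LatticePoint}, lattice.Walk u v → ZMod 2
  | _, _, SimpleGraph.Walk.nil => 0
  | _, _, SimpleGraph.Walk.cons (u := u) (v := v) _ w => f u v + walkSum f w

theorem walkSum_append (f : LatticePoint → LatticePoint → ZMod 2) {u v w : LatticePoint}
    (p : lattice.Walk u v) (q : lattice.Walk v w) :
    walkSum f (p.append q) = walkSum f p + walkSum f q := by
  induction p with
  | nil => simp [walkSum]
  | cons h p ih => simp [walkSum, ih, add_assoc]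

theorem walkSum_congr {f g : LatticePoint → LatticePoint → ZMod 2} {u v : LatticePoint}
    (w : lattice.Walk u v)
    (h : ∀ p q, p ∈ w.support → q ∈ w.support → lattice.Adj p q → f p q = g p q) :
    walkSum f w = walkSum g w := by
  induction w with
  | nil => rfl
  | cons ha p ih =>
    simp only [walkSum]
    rw [h _ _ (by simp) (by simp) ha, ih]
    intro p q hp hq
    exact h p q (by simp [hp]) (by simp [hq])

theorem walkSum_zero {u v : LatticePoint} (w : lattice.Walk u v) :
    walkSum (fun _ _ => 0) w = 0 := by
  induction w with
  | nil => rfl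
  | cons ha p ih => simp [walkSum, ih]

theorem walkSum_add (f g : LatticePoint → LatticePoint → ZMod 2) {u v : LatticePoint}
    (w : lattice.Walk u v) :
    walkSum (fun p q => f p q + g p q) w = walkSum f w + walkSum g w := by
  induction w with
  | nil => simp [walkSum]
  | cons ha p ih => simp only [walkSum, ih]; ring

theorem walkSum_telescope (f : LatticePoint → ZMod 2) {u v : LatticePoint}
    (w : lattice.Walk u v) : walkSum (fun p q => f p + f q) w = f u + f v := by
  induction w with
  | nil => simp only [walkSum]; exact (CharTwo.add_self_eq_zero _).symm
  | cons ha p ih =>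
    rename_i b _
    simp only [walkSum, ih]
    linear_combination CharTwo.add_self_eq_zero (f b)

/-- The edge between `p` and `q` lies to the right of the upward triangle `(a, b)`, `(a + 1, b)`,
`(a, b + 1)`, in the strip between the rows `b` and `b + 1`. -/
def RightOfUp (a b : ℤ) (p q : LatticePoint) : Prop :=
  (p.2 = b ∧ q.2 = b + 1 ∧ a < p.1) ∨ (q.2 = b ∧ p.2 = b + 1 ∧ a < q.1)

/-- The edge between `p` and `q` lies to the right of the downward triangle `(a + 1, b)`,
`(a, b + 1)`, `(a + 1, b + 1)`, in the strip between the rows `b` and `b + 1`. -/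
def RightOfDown (a b : ℤ) (p q : LatticePoint) : Prop :=
  (p.2 = b ∧ q.2 = b + 1 ∧ a < q.1) ∨ (q.2 = b ∧ p.2 = b + 1 ∧ a < p.1)

/-- `p` and `q` are `a` and `b`, in some order. -/
def SameEdge (a b p q : LatticePoint) : Prop := (p = a ∧ q = b) ∨ (p = b ∧ q = a)

open Classical in
/-- The indicator of a proposition, modulo two. -/
noncomputable def ind (A : Prop) : ZMod 2 := if A then 1 else 0

theorem ind_true {A : Prop} (h : A) : ind A = 1 := if_pos h

theorem ind_false {A : Prop} (h : ¬ A) : ind A = 0 := if_neg h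

theorem ind_congr {A B : Prop} (h : A ↔ B) : ind A = ind B := by rw [propext h]

theorem ind_add_of_disjoint {A B C : Prop} (h : C ↔ A ∨ B) (h' : ¬ (A ∧ B)) :
    ind C = ind A + ind B := by
  by_cases hA : A <;> by_cases hB : B <;> simp_all [ind]

theorem RightOfUp.comm (a b : ℤ) (p q : LatticePoint) : RightOfUp a b p q ↔ RightOfUp a b q p :=
  or_comm

theorem RightOfDown.comm (a b : ℤ) (p q : LatticePoint) :
    RightOfDown a b p q ↔ RightOfDown a b q p :=
  or_comm

theorem SameEdge.comm (a b p q : LatticePoint) : SameEdge a b p q ↔ SameEdge a b q p := by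
  simp only [SameEdge]; tauto

theorem SameEdge.comm_ends (a b p q : LatticePoint) : SameEdge a b p q ↔ SameEdge b a p q :=
  or_comm

/-- A symmetric statement about edges only has to be checked for three directions. -/
theorem forall_edge {F : LatticePoint → LatticePoint → Prop} (hsymm : ∀ p q, F p q → F q p)
    (h1 : ∀ p1 p2 : ℤ, F (p1, p2) (p1 + 1, p2))
    (h2 : ∀ p1 p2 e : ℤ, (e = 0 ∨ e = -1) → F (p1, p2) (p1 + e, p2 + 1))
    {p q : LatticePoint} (h : lattice.Adj p q) : F p q := by
  obtain ⟨w, hw, rfl⟩ := exists_dir_of_adj h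
  obtain ⟨p1, p2⟩ := p
  rw [isDir_iff] at hw
  rcases hw with rfl | rfl | rfl | rfl | rfl | rfl <;> rw [Prod.mk_add_mk]
  · simpa using h1 p1 p2
  · simpa using h2 p1 p2 0 (Or.inl rfl)
  · simpa using h2 p1 p2 (-1) (Or.inr rfl)
  · apply hsymm; simpa [← sub_eq_add_neg] using h1 (p1 - 1) p2
  · apply hsymm; simpa [← sub_eq_add_neg] using h2 p1 (p2 - 1) 0 (Or.inl rfl)
  · apply hsymm; simpa [← sub_eq_add_neg] using h2 (p1 + 1) (p2 - 1) (-1) (Or.inr rfl)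

/-- Two triangles that share the edge from `(a + 1, b)` to `(a, b + 1)` see the same edges to their
right, except for the shared one. -/
theorem ind_up_eq (a b : ℤ) {p q : LatticePoint} (h : lattice.Adj p q) :
    ind (RightOfUp a b p q) =
      ind (RightOfDown a b p q) + ind (SameEdge (a + 1, b) (a, b + 1) p q) := by
  refine forall_edge (F := fun p q => ind (RightOfUp a b p q) =
      ind (RightOfDown a b p q) + ind (SameEdge (a + 1, b) (a, b + 1) p q)) ?_ ?_ ?_ h
  · intro p q
    rw [ind_congr (RightOfUp.comm a b p q), ind_congr (RightOfDown.comm a b p q),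
      ind_congr (SameEdge.comm _ _ p q)]
    exact id
  all_goals
    intros
    apply ind_add_of_disjoint <;>
    · simp only [RightOfUp, RightOfDown, SameEdge, Prod.mk.injEq]
      omega

/-- The analogue of `ind_up_eq` for triangles that share the edge from `(a + 1, b)` to
`(a + 1, b + 1)`. -/
theorem ind_down_eq (a b : ℤ) {p q : LatticePoint} (h : lattice.Adj p q) :
    ind (RightOfDown a b p q) =
      ind (RightOfUp (a + 1) b p q) + ind (SameEdge (a + 1, b) (a + 1, b + 1) p q) := by
  refine forall_edge (F := fun p q => ind (RightOfDown a b p q) =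
      ind (RightOfUp (a + 1) b p q) + ind (SameEdge (a + 1, b) (a + 1, b + 1) p q)) ?_ ?_ ?_ h
  · intro p q
    rw [ind_congr (RightOfUp.comm _ b p q), ind_congr (RightOfDown.comm a b p q),
      ind_congr (SameEdge.comm _ _ p q)]
    exact id
  all_goals
    intros
    apply ind_add_of_disjoint <;>
    · simp only [RightOfUp, RightOfDown, SameEdge, Prod.mk.injEq]
      omega

/-- Two triangles in neighbouring strips that share a horizontal edge: an edge of the lattice is to
the right of exactly one of them if and only if one of its ends, but not the other, is on the
common row to the right of the shared edge. The last two terms cancel along a closed walk. -/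
theorem ind_up_add_ind_down (a b : ℤ) {p q : LatticePoint} (h : lattice.Adj p q) :
    ind (RightOfUp a (b + 1) p q) + ind (RightOfDown a b p q) =
      ind (SameEdge (a, b + 1) (a + 1, b + 1) p q) +
        (ind (p.2 = b + 1 ∧ a < p.1) + ind (q.2 = b + 1 ∧ a < q.1)) := by
  refine forall_edge (F := fun p q => ind (RightOfUp a (b + 1) p q) + ind (RightOfDown a b p q) =
      ind (SameEdge (a, b + 1) (a + 1, b + 1) p q) +
        (ind (p.2 = b + 1 ∧ a < p.1) + ind (q.2 = b + 1 ∧ a < q.1))) ?_ ?_ ?_ h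
  · intro p q h
    rw [ind_congr (RightOfUp.comm _ _ q p), ind_congr (RightOfDown.comm a b q p),
      ind_congr (SameEdge.comm _ _ q p), h]
    ring
  · intro p1 p2
    have e0 : (1 : ZMod 2) + 1 = 0 := rfl
    rw [ind_false (A := RightOfUp _ _ _ _) (by simp only [RightOfUp]; omega),
      ind_false (A := RightOfDown _ _ _ _) (by simp only [RightOfDown]; omega),
      ind_add_of_disjoint (A := SameEdge (a, b + 1) (a + 1, b + 1) (p1, p2) (p1 + 1, p2))
        (B := p2 = b + 1 ∧ a < p1) (C := p2 = b + 1 ∧ a < p1 + 1)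
        (by simp only [SameEdge, Prod.mk.injEq]; omega)
        (by simp only [SameEdge, Prod.mk.injEq]; omega)]
    linear_combination (-ind (SameEdge (a, b + 1) (a + 1, b + 1) (p1, p2) (p1 + 1, p2))
      - ind (p2 = b + 1 ∧ a < p1)) * e0
  · intro p1 p2 e he
    rw [ind_false (A := SameEdge _ _ _ _) (by simp only [SameEdge, Prod.mk.injEq]; omega),
      zero_add]
    congr 1
    · apply ind_congr; simp only [RightOfUp]; omega
    · apply ind_congr; simp only [RightOfDown]; omega

open Classical in
/-- The edges to the right of the triangle `x`, `x + u`, `x + rot u`, in its strip. -/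
noncomputable def sectorInd (x u p q : LatticePoint) : ZMod 2 :=
  if u = (1, 0) then ind (RightOfUp x.1 x.2 p q)
  else if u = (0, 1) then ind (RightOfDown (x.1 - 1) x.2 p q)
  else if u = (-1, 1) then ind (RightOfUp (x.1 - 1) x.2 p q)
  else if u = (-1, 0) then ind (RightOfDown (x.1 - 1) (x.2 - 1) p q)
  else if u = (0, -1) then ind (RightOfUp x.1 (x.2 - 1) p q)
  else ind (RightOfDown x.1 (x.2 - 1) p q)

/-- The parity of the number of crossings of a closed walk with a horizontal ray that starts in the
triangle `x`, `x + u`, `x + rot u`. -/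
noncomputable def sector {a : LatticePoint} (w : lattice.Walk a a) (x u : LatticePoint) : ZMod 2 :=
  walkSum (sectorInd x u) w

/-- The number of times that a walk uses the edge between `a` and `b`, modulo two. -/
noncomputable def edgeParity {u v : LatticePoint} (w : lattice.Walk u v) (a b : LatticePoint) :
    ZMod 2 :=
  walkSum (fun p q => ind (SameEdge a b p q)) w

/-- Crossing the edge between `x` and `x + rot u` changes the parity by the number of times that the
walk uses this edge. -/
theorem sector_add_sector {a : LatticePoint} (w : lattice.Walk a a) (x : LatticePoint)
    {u : LatticePoint} (hu : IsDir u) :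
    sector w x u + sector w x (rot u) = edgeParity w x (x + rot u) := by
  -- up to a sum that telescopes along the closed walk, the identity holds edge by edge
  suffices h : ∃ f : LatticePoint → ZMod 2, ∀ p q, lattice.Adj p q →
      sectorInd x u p q + sectorInd x (rot u) p q =
        ind (SameEdge x (x + rot u) p q) + (f p + f q) by
    obtain ⟨f, hf⟩ := h
    rw [sector, sector, edgeParity, ← walkSum_add,
      walkSum_congr w (fun p q _ _ hpq => hf p q hpq), walkSum_add, walkSum_telescope,
      CharTwo.add_self_eq_zero, add_zero]
  obtain ⟨a, b⟩ := x
  have two : ∀ z : ZMod 2, z + z = 0 := CharTwo.add_self_eq_zero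
  rw [isDir_iff] at hu
  rcases hu with rfl | rfl | rfl | rfl | rfl | rfl
  · refine ⟨fun _ => 0, fun p q h => ?_⟩
    have := ind_down_eq (a - 1) b h
    have h2 := two (ind (RightOfUp a b p q))
    simp only [sub_add_cancel] at this
    simp [sectorInd, rot, this]
    linear_combination h2
  · refine ⟨fun _ => 0, fun p q h => ?_⟩
    have := ind_up_eq (a - 1) b h
    have h2 := two (ind (RightOfDown (a - 1) b p q))
    simp only [sub_add_cancel] at this
    simp [sectorInd, rot, this, ← sub_eq_add_neg]
    linear_combination h2
  · refine ⟨fun v => ind (v.2 = b ∧ a - 1 < v.1), fun p q h => ?_⟩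
    have := ind_up_add_ind_down (a - 1) (b - 1) h
    simp only [sub_add_cancel] at this
    rw [ind_congr (SameEdge.comm_ends _ _ p q)] at this
    simp only [Int.sub_one_lt_iff] at this
    simp [sectorInd, rot, ← sub_eq_add_neg]
    linear_combination this
  · refine ⟨fun _ => 0, fun p q h => ?_⟩
    have := ind_down_eq (a - 1) (b - 1) h
    have h2 := two (ind (RightOfUp a (b - 1) p q))
    simp only [sub_add_cancel] at this
    rw [ind_congr (SameEdge.comm_ends _ _ p q)] at this
    simp [sectorInd, rot, this, ← sub_eq_add_neg]
    linear_combination h2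
  · refine ⟨fun _ => 0, fun p q h => ?_⟩
    have := ind_up_eq a (b - 1) h
    have h2 := two (ind (RightOfDown a (b - 1) p q))
    simp only [sub_add_cancel] at this
    rw [ind_congr (SameEdge.comm_ends _ _ p q)] at this
    simp [sectorInd, rot, this, ← sub_eq_add_neg]
    linear_combination h2
  · refine ⟨fun v => ind (v.2 = b ∧ a < v.1), fun p q h => ?_⟩
    have := ind_up_add_ind_down a (b - 1) h
    simp only [sub_add_cancel] at this
    simp [sectorInd, rot]
    linear_combination this

/-- A triangle has the same parity from the viewpoint of each of its vertices. -/
theorem sector_shift {a : LatticePoint} (w : lattice.Walk a a) (x : LatticePoint)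
    {u : LatticePoint} (hu : IsDir u) : sector w (x + u) (rot u - u) = sector w x u := by
  have : sectorInd (x + u) (rot u - u) = sectorInd x u := by
    obtain ⟨a, b⟩ := x
    rw [isDir_iff] at hu
    rcases hu with rfl | rfl | rfl | rfl | rfl | rfl <;>
    · funext p q
      simp [sectorInd, rot, ← sub_eq_add_neg]
  rw [sector, this, sector]

theorem edgeParity_of_notMem_left {u v : LatticePoint} (w : lattice.Walk u v)
    {x y : LatticePoint} (hx : x ∉ w.support) : edgeParity w x y = 0 := by
  rw [edgeParity, walkSum_congr w (g := fun _ _ => 0), walkSum_zero]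
  intro p q hp hq _
  apply ind_false
  rintro (⟨rfl, rfl⟩ | ⟨rfl, rfl⟩)
  · exact hx hp
  · exact hx hq

theorem edgeParity_cons {u v w x y : LatticePoint} (h : lattice.Adj u v) (p : lattice.Walk v w) :
    edgeParity (SimpleGraph.Walk.cons h p) x y = ind (SameEdge x y u v) + edgeParity p x y := rfl

theorem edgeParity_append {u v w x y : LatticePoint} (p : lattice.Walk u v)
    (q : lattice.Walk v w) :
    edgeParity (p.append q) x y = edgeParity p x y + edgeParity q x y := walkSum_append _ _ _

/-- Around a vertex that the walk avoids, all six triangles have the same parity. -/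
theorem sector_eq_of_notMem {a : LatticePoint} (w : lattice.Walk a a) {z u v : LatticePoint}
    (hz : z ∉ w.support) (hu : IsDir u) (hv : IsDir v) : sector w z u = sector w z v := by
  have step : ∀ {u}, IsDir u → sector w z u = sector w z (rot u) := by
    intro u hu
    have := sector_add_sector w z hu
    rw [edgeParity_of_notMem_left w hz] at this
    exact CharTwo.add_eq_zero.1 this
  have e1 : rot (rot u) = rot u - u := rot_rot u
  have e2 : rot (rot u - u) = -u := by rw [rot_sub, rot_rot]; abel
  have e3 : rot (-u) = -rot u := rot_neg u
  have e4 : rot (-rot u) = u - rot u := by rw [rot_neg, rot_rot]; abel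
  have s1 := step hu
  have s2 := step hu.rot
  have s3 := step hu.rot_sub
  have s4 := step hu.neg
  have s5 := step hu.rot.neg
  rw [e1] at s2
  rw [e2] at s3
  rw [e3] at s4
  rw [e4] at s5
  rcases hu.cases hv with rfl | rfl | rfl | rfl | rfl | rfl
  · rfl
  · exact s1
  · exact s1.trans s2
  · exact s1.trans (s2.trans s3)
  · exact s1.trans (s2.trans (s3.trans s4))
  · exact s1.trans (s2.trans (s3.trans (s4.trans s5)))

/-- The winding parity of a closed walk around a point off the walk. -/
noncomputable def winding {a : LatticePoint} (w : lattice.Walk a a) (z : LatticePoint) : ZMod 2 :=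
  sector w z (1, 0)

theorem isDir_one : IsDir (1, 0) := by simp [IsDir]

/-- The winding parity around a free vertex of a triangle is the parity of the triangle. -/
theorem winding_eq_sector {a : LatticePoint} (w : lattice.Walk a a) {x u : LatticePoint}
    (hu : IsDir u) (h : x + u ∉ w.support) : winding w (x + u) = sector w x u := by
  rw [winding, sector_eq_of_notMem w h isDir_one hu.rot_sub, sector_shift w x hu]

/-- The winding parity does not change between adjacent points off the walk. -/
theorem winding_adj {a : LatticePoint} (w : lattice.Walk a a) {z z' : LatticePoint}
    (h : lattice.Adj z z') (hz : z ∉ w.support) (hz' : z' ∉ w.support) :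
    winding w z = winding w z' := by
  obtain ⟨u, hu, rfl⟩ := exists_dir_of_adj h
  rw [winding_eq_sector w hu hz', winding, sector_eq_of_notMem w hz isDir_one hu]

theorem winding_eq_zero_of_lt_abs {a : LatticePoint} (w : lattice.Walk a a) {M : ℤ}
    (hM : ∀ p ∈ w.support, |p.2| < M) {z : LatticePoint} (hz : M ≤ |z.2|) : winding w z = 0 := by
  rw [winding, sector, walkSum_congr w (g := fun _ _ => 0), walkSum_zero]
  intro p q hp hq _
  have h1 := hM p hp
  have h2 := hM q hq
  simp only [sectorInd, if_true]
  apply ind_false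
  simp only [RightOfUp]
  rintro (⟨h, -⟩ | ⟨h, -⟩)
  · rw [h] at h1; omega
  · rw [h] at h2; omega

/-- A walk does not wind around a point outside a box that contains it. -/
theorem winding_eq_zero_of_outside {a : LatticePoint} (w : lattice.Walk a a) {M : ℤ}
    (hM : ∀ p ∈ w.support, |p.1| < M ∧ |p.2| < M) {z : LatticePoint}
    (hz : M ≤ |z.1| ∨ M ≤ |z.2|) : winding w z = 0 := by
  rcases hz with hz | hz
  · have hoff : ∀ b, (z.1, b) ∉ w.support := fun b hb => by
      have := (hM _ hb).1
      simp only at this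
      omega
    -- such a point can be moved upwards until it is above the box
    have up : ∀ n : ℕ, winding w z = winding w (z.1, z.2 + n) := by
      intro n
      induction n with
      | zero => simp
      | succ n ih =>
        rw [ih]
        refine winding_adj w ?_ (hoff _) (hoff _)
        simp [lattice, sqDist]
    rw [up (|z.2| + |M|).toNat]
    refine winding_eq_zero_of_lt_abs w (fun p hp => (hM p hp).2) ?_
    simp only
    rw [Int.toNat_of_nonneg (by positivity)]
    have h1 := neg_abs_le z.2
    have h2 := le_abs_self M
    exact le_trans (by linarith) (le_abs_self _)
  · exact winding_eq_zero_of_lt_abs w (fun p hp => (hM p hp).2) hz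

/-! ### Pockets -/

/-- From every point outside `T` one can get arbitrarily far away without meeting `T`. -/
def OpenOutside (T : Set LatticePoint) : Prop :=
  ∀ z ∉ T, ∀ M : ℤ, ∃ z', Relation.ReflTransGen
    (fun a b => lattice.Adj a b ∧ a ∉ T ∧ b ∉ T) z z' ∧ M ≤ |z'.2|

/-- A nonempty finite set `H` of lattice points has at least four corners, at the ends of its top
and bottom rows, from which three consecutive neighbours lie outside `H`. They cannot all be next to
a given point or to one of two given adjacent points. -/
theorem exists_corner_avoiding (H : Finset LatticePoint) (hne : H.Nonempty) {x y : LatticePoint}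
    (hxy : x = y ∨ lattice.Adj x y) :
    ∃ p ∈ H, ∃ u, IsDir u ∧ ∀ v, v = u ∨ v = rot u ∨ v = rot u - u →
      p + v ∉ H ∧ p + v ≠ x ∧ p + v ≠ y := by
  by_contra! hcon
  -- `σ = 1` for the top row, `σ = -1` for the bottom row; `τ` likewise for its right or left end
  have extreme : ∀ σ τ : ℤ, ∃ p ∈ H, (∀ z ∈ H, σ * z.2 ≤ σ * p.2) ∧
      ∀ z ∈ H, z.2 = p.2 → τ * z.1 ≤ τ * p.1 := by
    intro σ τ
    obtain ⟨q, hq, hqmax⟩ := H.exists_max_image (fun z => σ * z.2) hne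
    obtain ⟨p, hp, hpmax⟩ := (H.filter (fun z => z.2 = q.2)).exists_max_image
      (fun z => τ * z.1) ⟨q, by simp [hq]⟩
    rw [Finset.mem_filter] at hp
    refine ⟨p, hp.1, fun z hz => ?_, fun z hz hzp => hpmax z ?_⟩
    · rw [hp.2]; exact hqmax z hz
    · rw [Finset.mem_filter]; exact ⟨hz, hzp.trans hp.2⟩
  have hx : (x.1 = y.1 ∧ x.2 = y.2) ∨ (y.1 = x.1 + 1 ∧ y.2 = x.2) ∨ (y.1 = x.1 ∧ y.2 = x.2 + 1) ∨
      (y.1 = x.1 - 1 ∧ y.2 = x.2 + 1) ∨ (y.1 = x.1 - 1 ∧ y.2 = x.2) ∨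
      (y.1 = x.1 ∧ y.2 = x.2 - 1) ∨ (y.1 = x.1 + 1 ∧ y.2 = x.2 - 1) := by
    rcases hxy with rfl | h
    · exact Or.inl ⟨rfl, rfl⟩
    · obtain ⟨u, hu, rfl⟩ := exists_dir_of_adj h
      rw [isDir_iff] at hu
      obtain ⟨x1, x2⟩ := x
      rcases hu with rfl | rfl | rfl | rfl | rfl | rfl <;> simp [← sub_eq_add_neg]
  have conv : ∀ {p v z : LatticePoint}, p + v = z → z.1 = p.1 + v.1 ∧ z.2 = p.2 + v.2 := by
    rintro p v z rfl; exact ⟨rfl, rfl⟩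
  -- three consecutive directions lead from an end of the top row to points not in `H`, so `x` or
  -- `y` is next to it, in the row above or on the outer side in the same row
  have top : ∀ τ, (τ = 1 ∨ τ = -1) → ∃ p ∈ H, (∀ z ∈ H, z.2 ≤ p.2) ∧
      (∀ z ∈ H, z.2 = p.2 → τ * z.1 ≤ τ * p.1) ∧
      ((x.2 = p.2 + 1 ∨ x.2 = p.2 ∧ x.1 = p.1 + τ) ∨
        (y.2 = p.2 + 1 ∨ y.2 = p.2 ∧ y.1 = p.1 + τ)) := by
    intro τ hτ
    obtain ⟨p, hp, h1, h2⟩ := extreme 1 τ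
    refine ⟨p, hp, fun z hz => by have := h1 z hz; omega, h2, ?_⟩
    obtain ⟨u, hu, hv⟩ : ∃ u, IsDir u ∧ ∀ v, v = u ∨ v = rot u ∨ v = rot u - u →
        v.2 = 1 ∨ (v.2 = 0 ∧ v.1 = τ) := by
      rcases hτ with rfl | rfl
      · refine ⟨(1, 0), by simp [IsDir], ?_⟩
        rintro v (rfl | rfl | rfl) <;> simp [rot]
      · refine ⟨(0, 1), by simp [IsDir], ?_⟩
        rintro v (rfl | rfl | rfl) <;> simp [rot]
    obtain ⟨v, hv', hcase⟩ := hcon p hp u hu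
    have h3 := hv v hv'
    by_cases hin : p + v ∈ H
    · have e1 := h1 _ hin
      have e2 := h2 _ hin
      rw [Prod.snd_add] at e1 e2
      rw [Prod.fst_add] at e2
      rcases hτ with rfl | rfl <;> omega
    · by_cases hxv : p + v = x
      · have := conv hxv; omega
      · have := conv (hcase hin hxv); omega
  -- likewise for the ends of the bottom row
  have bot : ∀ τ, (τ = 1 ∨ τ = -1) → ∃ p ∈ H, (∀ z ∈ H, p.2 ≤ z.2) ∧
      (∀ z ∈ H, z.2 = p.2 → τ * z.1 ≤ τ * p.1) ∧
      ((x.2 = p.2 - 1 ∨ x.2 = p.2 ∧ x.1 = p.1 + τ) ∨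
        (y.2 = p.2 - 1 ∨ y.2 = p.2 ∧ y.1 = p.1 + τ)) := by
    intro τ hτ
    obtain ⟨p, hp, h1, h2⟩ := extreme (-1) τ
    refine ⟨p, hp, fun z hz => by have := h1 z hz; omega, h2, ?_⟩
    obtain ⟨u, hu, hv⟩ : ∃ u, IsDir u ∧ ∀ v, v = u ∨ v = rot u ∨ v = rot u - u →
        v.2 = -1 ∨ (v.2 = 0 ∧ v.1 = τ) := by
      rcases hτ with rfl | rfl
      · refine ⟨(0, -1), by simp [IsDir], ?_⟩
        rintro v (rfl | rfl | rfl) <;> simp [rot]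
      · refine ⟨(-1, 0), by simp [IsDir], ?_⟩
        rintro v (rfl | rfl | rfl) <;> simp [rot]
    obtain ⟨v, hv', hcase⟩ := hcon p hp u hu
    have h3 := hv v hv'
    by_cases hin : p + v ∈ H
    · have e1 := h1 _ hin
      have e2 := h2 _ hin
      rw [Prod.snd_add] at e1 e2
      rw [Prod.fst_add] at e2
      rcases hτ with rfl | rfl <;> omega
    · by_cases hxv : p + v = x
      · have := conv hxv; omega
      · have := conv (hcase hin hxv); omega
  -- `x` and `y` cannot be next to all four corners
  obtain ⟨a, ha, ha1, ha2, ha3⟩ := top 1 (Or.inl rfl)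
  obtain ⟨b, hb, hb1, hb2, hb3⟩ := top (-1) (Or.inr rfl)
  obtain ⟨c, hc, hc1, hc2, hc3⟩ := bot 1 (Or.inl rfl)
  obtain ⟨e, he, he1, he2, he3⟩ := bot (-1) (Or.inr rfl)
  have eab : a.2 = b.2 := le_antisymm (hb1 a ha) (ha1 b hb)
  have ece : c.2 = e.2 := le_antisymm (hc1 e he) (he1 c hc)
  have eca : c.2 ≤ a.2 := ha1 c hc
  have l1 : b.1 ≤ a.1 := by have := ha2 b hb eab.symm; omega
  have l2 : e.1 ≤ c.1 := by have := hc2 e he ece.symm; omega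
  have l3 : a.2 = c.2 → a.1 = c.1 ∧ b.1 = e.1 := by
    intro h
    have := ha2 c hc h.symm
    have := hc2 a ha h
    have := hb2 e he (by omega)
    have := he2 b hb (by omega)
    omega
  rcases hx with hx | hx | hx | hx | hx | hx | hx <;> omega

theorem exists_support_bound {a b : LatticePoint} (w : lattice.Walk a b) :
    ∃ M : ℤ, ∀ p ∈ w.support, |p.1| < M ∧ |p.2| < M := by
  induction w with
  | nil =>
    rename_i u
    refine ⟨|u.1| + |u.2| + 1, fun p hp => ?_⟩
    rw [SimpleGraph.Walk.support_nil, List.mem_singleton] at hp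
    subst hp
    have h1 := abs_nonneg p.1
    have h2 := abs_nonneg p.2
    omega
  | cons h p ih =>
    rename_i u _ _
    obtain ⟨M, hM⟩ := ih
    refine ⟨|u.1| + |u.2| + 1 + |M|, fun p hp => ?_⟩
    have h1 := abs_nonneg u.1
    have h2 := abs_nonneg u.2
    have h3 := abs_nonneg M
    have h4 := le_abs_self M
    rw [SimpleGraph.Walk.support_cons, List.mem_cons] at hp
    rcases hp with rfl | hp
    · omega
    · have := hM p hp
      omega

/-- Let a closed walk in `A ∪ {x, y}`, with `x` and `y` equal or adjacent, separate two other
points. The region that it encloses is a finite part of `T`, and one of the corners of this region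
has three consecutive neighbours in `A`. -/
theorem exists_pocket_corner {T A : Set LatticePoint} {x y : LatticePoint} (hT : OpenOutside T)
    (hA : A ⊆ T) (hx : x ∈ T) (hy : y ∈ T) (hxy : x = y ∨ lattice.Adj x y) {a : LatticePoint}
    (w : lattice.Walk a a) (hw : ∀ p ∈ w.support, p ∈ A ∨ p = x ∨ p = y) {z₁ z₂ : LatticePoint}
    (h₁ : z₁ ∉ A ∧ z₁ ≠ x ∧ z₁ ≠ y) (h₂ : z₂ ∉ A ∧ z₂ ≠ x ∧ z₂ ≠ y)
    (hne : winding w z₁ ≠ winding w z₂) :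
    ∃ p ∈ T, p ∉ A ∧ p ≠ x ∧ p ≠ y ∧
      ∃ u, IsDir u ∧ p + u ∈ A ∧ p + rot u ∈ A ∧ p + (rot u - u) ∈ A := by
  obtain ⟨M, hM⟩ := exists_support_bound w
  set H : Set LatticePoint := {z | (z ∉ A ∧ z ≠ x ∧ z ≠ y) ∧ winding w z = 1} with hH
  have off : ∀ {z}, z ∉ A ∧ z ≠ x ∧ z ≠ y → z ∉ w.support := by
    intro z hz hzw
    rcases hw z hzw with h | h | h
    · exact hz.1 h
    · exact hz.2.1 h
    · exact hz.2.2 h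
  have hfin : H.Finite := by
    refine ((Set.finite_Icc (-M) M).prod (Set.finite_Icc (-M) M)).subset ?_
    intro z hz
    by_contra hbox
    have : winding w z = 0 := by
      apply winding_eq_zero_of_outside w hM
      by_contra! hlt
      rw [abs_lt, abs_lt] at hlt
      exact hbox ⟨⟨by omega, by omega⟩, ⟨by omega, by omega⟩⟩
    rw [hz.2] at this
    exact one_ne_zero this
  -- from a point outside `T` one escapes without meeting the walk
  have hHT : H ⊆ T := by
    intro z hz
    by_contra hzT
    obtain ⟨z', hzz', hz'⟩ := hT z hzT M
    have hoff : ∀ {q}, q ∉ T → q ∉ w.support := by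
      intro q hq hqw
      rcases hw q hqw with h | h | h
      · exact hq (hA h)
      · exact hq (h ▸ hx)
      · exact hq (h ▸ hy)
    have hconst : winding w z = winding w z' := by
      clear hz'
      induction hzz' with
      | refl => rfl
      | tail _ hs ih => exact ih.trans (winding_adj w hs.1 (hoff hs.2.1) (hoff hs.2.2))
    rw [hz.2, winding_eq_zero_of_outside w hM (Or.inr hz')] at hconst
    exact one_ne_zero hconst
  -- of the two separated points, one is enclosed
  have hnonempty : hfin.toFinset.Nonempty := by
    have two : ∀ s : ZMod 2, s = 0 ∨ s = 1 := by decide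
    rcases two (winding w z₁) with e1 | e1
    · rcases two (winding w z₂) with e2 | e2
      · exact absurd (e1.trans e2.symm) hne
      · exact ⟨z₂, hfin.mem_toFinset.2 ⟨h₂, e2⟩⟩
    · exact ⟨z₁, hfin.mem_toFinset.2 ⟨h₁, e1⟩⟩
  obtain ⟨p, hp, u, hu, hcorner⟩ := exists_corner_avoiding hfin.toFinset hnonempty hxy
  rw [hfin.mem_toFinset] at hp
  -- a neighbour of `p` that is not enclosed lies on the walk or in `A`
  have key : ∀ v, IsDir v → v = u ∨ v = rot u ∨ v = rot u - u → p + v ∈ A := by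
    intro v hv hvu
    obtain ⟨h3, h4, h5⟩ := hcorner v hvu
    rw [hfin.mem_toFinset] at h3
    by_contra h6
    refine h3 ⟨⟨h6, h4, h5⟩, ?_⟩
    rw [← winding_adj w (adj_add hv) (off hp.1) (off ⟨h6, h4, h5⟩)]
    exact hp.2
  exact ⟨p, hHT hp, hp.1.1, hp.1.2.1, hp.1.2.2, u, hu, key u hu (Or.inl rfl),
    key _ hu.rot (Or.inr (Or.inl rfl)), key _ hu.rot_sub (Or.inr (Or.inr rfl))⟩

/-! ### Lower neighbours -/

theorem dir_distinct {u : LatticePoint} (hu : IsDir u) :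
    rot u ≠ u ∧ rot u - u ≠ u ∧ rot u - u ≠ rot u ∧ -u ≠ u ∧ -u ≠ rot u ∧ -u ≠ rot u - u ∧
    -rot u ≠ u ∧ -rot u ≠ rot u ∧ -rot u ≠ rot u - u ∧ -rot u ≠ -u ∧
    u - rot u ≠ u ∧ u - rot u ≠ rot u ∧ u - rot u ≠ rot u - u ∧ u - rot u ≠ -u ∧
    u - rot u ≠ -rot u := by
  rw [isDir_iff] at hu
  rcases hu with rfl | rfl | rfl | rfl | rfl | rfl <;> simp [rot]

/-- The neighbours with hop count `k - 1` of a point with hop count `k` are pairwise adjacent. -/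
def LowerClique (P : Set LatticePoint) (k : ℤ) : Prop :=
  ∀ x u v, IsDir u → IsDir v → hop P x = k → hop P (x + u) = k - 1 → hop P (x + v) = k - 1 →
    v = u ∨ v = rot u ∨ u = rot v

/-- Adjacent points `x` and `x + rot u` with hop count `k` have a common neighbour with hop count
`k - 1`. -/
def SharedLower (P : Set LatticePoint) (k : ℤ) : Prop :=
  ∀ x u, IsDir u → hop P x = k → hop P (x + rot u) = k →
    hop P (x + u) = k - 1 ∨ hop P (x + (rot u - u)) = k - 1

/-- A point cannot have three consecutive lower neighbours: the middle one would have two lower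
neighbours that are opposite or two apart. -/
theorem no_lower_triple {P : Set LatticePoint} {k : ℤ} (h1 : LowerClique P k)
    (h2 : SharedLower P k) {p u : LatticePoint} (hu : IsDir u) (hp : hop P p = k + 1)
    (ha : hop P (p + u) = k) (hb : hop P (p + rot u) = k) (hc : hop P (p + (rot u - u)) = k) :
    False := by
  have ea := h2 (p + rot u) (-rot u) hu.rot.neg hb (by
    rw [rot_neg, rot_rot, show p + rot u + -(rot u - u) = p + u by abel]; exact ha)
  have ec := h2 (p + rot u) (rot u - u) hu.rot_sub hb (by
    rw [rot_sub, rot_rot, show p + rot u + (rot u - u - rot u) = p + (rot u - u) by abel]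
    exact hc)
  rw [rot_neg, rot_rot, show p + rot u + -rot u = p by abel,
    show p + rot u + (-(rot u - u) - -rot u) = p + rot u + u by abel] at ea
  rw [rot_sub, rot_rot,
    show p + rot u + (rot u - u - rot u - (rot u - u)) = p by abel] at ec
  have ea' := ea.resolve_left (by omega)
  have ec' := ec.resolve_right (by omega)
  obtain ⟨n1, n2, n3, n4, -⟩ := dir_distinct hu
  rcases h1 _ _ _ hu hu.rot_sub hb ea' ec' with h | h | h
  · exact n2 h
  · exact n3 h
  · rw [rot_sub, rot_rot] at h
    exact n4 (by rw [show -u = rot u - u - rot u by abel]; exact h.symm)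

/-- A shortest path to the origin stays among points with smaller hop counts. -/
theorem exists_lower_walk {P : Set LatticePoint} (n : ℕ) : ∀ c, hop P c = n →
    ∃ w : lattice.Walk c 0, ∀ p ∈ w.support, 0 ≤ hop P p ∧ hop P p ≤ n := by
  induction n with
  | zero =>
    intro c hc
    have : c = 0 := eq_zero_of_hop_eq_zero hc
    subst this
    refine ⟨SimpleGraph.Walk.nil, fun p hp => ?_⟩
    rw [SimpleGraph.Walk.support_nil, List.mem_singleton] at hp
    rw [hp, hc]; simp
  | succ n ih =>
    intro c hc
    obtain ⟨-, y, -, hcy, hy⟩ := exists_hop_pred (P := P) (x := c) (by rw [hc]; positivity)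
    obtain ⟨w, hw⟩ := ih y (by rw [hy, hc]; push_cast; ring)
    refine ⟨SimpleGraph.Walk.cons hcy w, fun p hp => ?_⟩
    rw [SimpleGraph.Walk.support_cons, List.mem_cons] at hp
    rcases hp with rfl | hp
    · rw [hc]; exact ⟨by positivity, le_rfl⟩
    · have := hw p hp; push_cast; omega

/-- Two points with hop count at most `k` are joined by a walk among such points. -/
theorem exists_ball_walk {P : Set LatticePoint} {k : ℤ} {c c' : LatticePoint}
    (hc : 0 ≤ hop P c ∧ hop P c ≤ k) (hc' : 0 ≤ hop P c' ∧ hop P c' ≤ k) :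
    ∃ w : lattice.Walk c c', ∀ p ∈ w.support, 0 ≤ hop P p ∧ hop P p ≤ k := by
  obtain ⟨w, hw⟩ := exists_lower_walk (P := P) (hop P c).toNat c (Int.toNat_of_nonneg hc.1).symm
  obtain ⟨w', hw'⟩ := exists_lower_walk (P := P) (hop P c').toNat c' (Int.toNat_of_nonneg hc'.1).symm
  refine ⟨w.append w'.reverse, fun p hp => ?_⟩
  rw [SimpleGraph.Walk.mem_support_append_iff, SimpleGraph.Walk.support_reverse,
    List.mem_reverse] at hp
  rcases hp with hp | hp
  · have := hw p hp; omega
  · have := hw' p hp; omega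

/-- A walk among points with hop count less than `k`, closed up through one or two adjacent points
with hop count `k`, separates no two other points: the corner of a pocket would have three
consecutive lower neighbours. -/
theorem winding_eq_of_ball {P : Set LatticePoint} {k : ℤ} (hT : OpenOutside (P ∪ hub))
    (h1 : LowerClique P (k - 1)) (h2 : SharedLower P (k - 1)) {x y : LatticePoint}
    (hx : x ∈ P ∪ hub) (hy : y ∈ P ∪ hub) (hxy : x = y ∨ lattice.Adj x y) {a : LatticePoint}
    (w : lattice.Walk a a)
    (hw : ∀ p ∈ w.support, (0 ≤ hop P p ∧ hop P p ≤ k - 1) ∨ p = x ∨ p = y) {z₁ z₂ : LatticePoint}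
    (h₁ : ¬ (0 ≤ hop P z₁ ∧ hop P z₁ ≤ k - 1) ∧ z₁ ≠ x ∧ z₁ ≠ y)
    (h₂ : ¬ (0 ≤ hop P z₂ ∧ hop P z₂ ≤ k - 1) ∧ z₂ ≠ x ∧ z₂ ≠ y) :
    winding w z₁ = winding w z₂ := by
  by_contra hne
  obtain ⟨p, hpT, hp, -, -, u, hu, ha, hb, hc⟩ := exists_pocket_corner
    (A := {z | 0 ≤ hop P z ∧ hop P z ≤ k - 1}) hT (fun z hz => mem_of_hop_nonneg hz.1) hx hy hxy
    w hw h₁ h₂ hne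
  have level : ∀ v, IsDir v → (0 ≤ hop P (p + v) ∧ hop P (p + v) ≤ k - 1) →
      hop P p = k ∧ hop P (p + v) = k - 1 := by
    intro v hv hpv
    have e1 := hop_adj hpv.1 (mem_of_hop_nonneg hpv.1) hpT (adj_add hv).symm
    have e2 := hop_adj_le e1.1 hpv.1 (adj_add hv)
    simp only [Set.mem_ofPred_eq, not_and, not_le] at hp
    have e3 := hp e1.1
    omega
  exact no_lower_triple h1 h2 hu (by rw [(level u hu ha).1]; ring) (level u hu ha).2
    (level _ hu.rot hb).2 (level _ hu.rot_sub hc).2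

/-- A walk `x, c, …, c'` through lower points, of which `x c` is the only edge at `x`. -/
theorem exists_closed_walk {P : Set LatticePoint} {k : ℤ} {x c c' : LatticePoint}
    (hx : hop P x = k) (hc : 0 ≤ hop P c ∧ hop P c ≤ k - 1)
    (hc' : 0 ≤ hop P c' ∧ hop P c' ≤ k - 1) (hxc : lattice.Adj x c) :
    ∃ w : lattice.Walk x c', (∀ p ∈ w.support, (0 ≤ hop P p ∧ hop P p ≤ k - 1) ∨ p = x) ∧
      ∀ z, edgeParity w x z = ind (SameEdge x z x c) := by
  obtain ⟨w, hw⟩ := exists_ball_walk hc hc'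
  refine ⟨SimpleGraph.Walk.cons hxc w, fun p hp => ?_, fun z => ?_⟩
  · rw [SimpleGraph.Walk.support_cons, List.mem_cons] at hp
    rcases hp with rfl | hp
    · exact Or.inr rfl
    · exact Or.inl (hw p hp)
  · rw [edgeParity_cons, edgeParity_of_notMem_left w, add_zero]
    intro h
    have := hw x h
    omega

theorem sameEdge_iff {x s u : LatticePoint} (hu : IsDir u) :
    SameEdge x (x + s) x (x + u) ↔ s = u := by
  simp only [SameEdge, true_and, add_right_inj, eq_comm (a := u), add_eq_left]
  exact or_iff_left (fun h => hu.ne_zero h.2.symm)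

/-- Two lower neighbours `x + u` and `x + v` of `x` are joined by a walk through lower points, which
closes up to a cycle through `x`. If they were not adjacent, the cycle would separate two
neighbours of `x` that are not lower. -/
theorem lowerClique_succ {P : Set LatticePoint} {k : ℤ} (hk : 2 ≤ k)
    (hT : OpenOutside (P ∪ hub)) (h1 : LowerClique P (k - 1)) (h2 : SharedLower P (k - 1)) :
    LowerClique P k := by
  -- two lower neighbours `x + u` and `x + v` give a closed walk that passes `x` once
  have main : ∀ x u v, IsDir u → IsDir v → hop P x = k → hop P (x + u) = k - 1 →
      hop P (x + v) = k - 1 → ∃ w : lattice.Walk x x,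
      (∀ s, IsDir s → rot s ≠ u → rot s ≠ v → sector w x s = sector w x (rot s)) ∧
      (∀ s, IsDir s → rot s ≠ u → rot s = v → sector w x s ≠ sector w x (rot s)) ∧
      (∀ s t, IsDir s → IsDir t → hop P (x + s) ≠ k - 1 → hop P (x + t) ≠ k - 1 →
        sector w x s = sector w x t) := by
    intro x u v hu hv hx hxu hxv
    obtain ⟨w, hw, hwz⟩ := exists_closed_walk (P := P) (c := x + u) (c' := x + v) hx (by omega)
      (by omega) (adj_add hu)
    have hpar : ∀ s, IsDir s → sector (w.append (SimpleGraph.Walk.cons (adj_add hv).symm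
        SimpleGraph.Walk.nil)) x s + sector (w.append (SimpleGraph.Walk.cons (adj_add hv).symm
        SimpleGraph.Walk.nil)) x (rot s) = ind (rot s = u) + ind (rot s = v) := by
      intro s hs
      rw [sector_add_sector _ _ hs, edgeParity_append, hwz, edgeParity_cons,
        ind_congr (sameEdge_iff hu), ind_congr (SameEdge.comm _ _ _ _),
        ind_congr (sameEdge_iff hv)]
      simp [edgeParity, walkSum]
    refine ⟨w.append (SimpleGraph.Walk.cons (adj_add hv).symm SimpleGraph.Walk.nil), ?_, ?_, ?_⟩
    · intro s hs e1 e2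
      have := hpar s hs
      rw [ind_false e1, ind_false e2, add_zero] at this
      exact CharTwo.add_eq_zero.1 this
    · intro s hs e1 e2 e3
      have := hpar s hs
      rw [ind_false e1, ind_true e2, e3, CharTwo.add_self_eq_zero] at this
      simp at this
    · intro s t hs ht e1 e2
      have hxT : x ∈ P ∪ hub := mem_of_hop_nonneg (by omega)
      have hsup : ∀ p ∈ (w.append (SimpleGraph.Walk.cons (adj_add hv).symm
          SimpleGraph.Walk.nil)).support, (0 ≤ hop P p ∧ hop P p ≤ k - 1) ∨ p = x ∨ p = x := by
        intro p hp
        rw [SimpleGraph.Walk.mem_support_append_iff] at hp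
        rcases hp with hp | hp
        · exact (hw p hp).imp_right Or.inl
        · simp only [SimpleGraph.Walk.support_cons, SimpleGraph.Walk.support_nil, List.mem_cons,
            List.not_mem_nil, or_false] at hp
          rcases hp with rfl | rfl
          · left; omega
          · exact Or.inr (Or.inl rfl)
      have out : ∀ s, IsDir s → hop P (x + s) ≠ k - 1 →
          ¬ (0 ≤ hop P (x + s) ∧ hop P (x + s) ≤ k - 1) ∧ x + s ≠ x ∧ x + s ≠ x := by
        intro s hs he
        have hne : x + s ≠ x := by rw [Ne, add_eq_left]; exact hs.ne_zero
        refine ⟨fun h => ?_, hne, hne⟩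
        have := hop_adj_le h.1 (by omega) (adj_add hs).symm
        omega
      have off : ∀ s, IsDir s → hop P (x + s) ≠ k - 1 → x + s ∉ (w.append
          (SimpleGraph.Walk.cons (adj_add hv).symm SimpleGraph.Walk.nil)).support := by
        intro s hs he hin
        obtain ⟨o1, o2, -⟩ := out s hs he
        rcases hsup _ hin with h | h | h
        · exact o1 h
        · exact o2 h
        · exact o2 h
      rw [← winding_eq_sector _ hs (off s hs e1), ← winding_eq_sector _ ht (off t ht e2)]
      exact winding_eq_of_ball hT h1 h2 hxT hxT (Or.inl rfl) _ hsup (out s hs e1) (out t ht e2)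
  -- the lower neighbours of `x` are not three consecutive ones, so if `x + u` and `x + (rot u - u)`
  -- are lower, then `x + rot u` is not
  have triple : ∀ x u, IsDir u → hop P x = k → hop P (x + u) = k - 1 → hop P (x + rot u) = k - 1 →
      hop P (x + (rot u - u)) = k - 1 → False := fun x u hu hx e1 e2 e3 =>
    no_lower_triple h1 h2 hu (by rw [hx]; ring) e1 e2 e3
  -- in `case2` and `case3` the closed walk leaves `x` by two directions that are two or three steps
  -- apart; on each side of it there is a neighbour of `x` that is not lower
  have case2 : ∀ x u, IsDir u → hop P x = k → hop P (x + u) = k - 1 →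
      hop P (x + (rot u - u)) = k - 1 → False := by
    intro x u hu hx hxu hxv
    obtain ⟨w, s0, s1, sc⟩ := main x u _ hu hu.rot_sub hx hxu hxv
    obtain ⟨n1, n2, n3, n4, n5, n6, n7, n8, n9, n10, n11, n12, n13, n14, n15⟩ := dir_distinct hu
    have d1 : hop P (x + rot u) ≠ k - 1 := fun h => triple x u hu hx hxu h hxv
    have e12 := s1 (rot u) hu.rot (by rwa [rot_rot]) (rot_rot u)
    have e23 := s0 (rot u - u) hu.rot_sub (by rw [rot_sub, rot_rot]; convert n4 using 1; abel)
      (by rw [rot_sub, rot_rot]; convert n6 using 1; abel)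
    have e34 := s0 (-u) hu.neg (by rwa [rot_neg]) (by rwa [rot_neg])
    have e45 := s0 (-rot u) hu.rot.neg (by rw [rot_neg, rot_rot, neg_sub]; exact n11)
      (by rw [rot_neg, rot_rot, neg_sub]; exact n13)
    rw [rot_rot] at e12
    rw [rot_sub, rot_rot, show rot u - u - rot u = -u by abel] at e23
    rw [rot_neg] at e34
    rw [rot_neg, rot_rot, neg_sub] at e45
    by_cases f3 : hop P (x + -u) = k - 1
    · by_cases f4 : hop P (x + -rot u) = k - 1
      · by_cases f5 : hop P (x + (u - rot u)) = k - 1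
        · exact triple x (-u) hu.neg hx f3 (by rwa [rot_neg])
            (by rwa [rot_neg, show -rot u - -u = u - rot u by abel])
        · exact e12 ((sc _ _ hu.rot hu.sub_rot d1 f5).trans
            (e23.trans (e34.trans e45)).symm)
      · exact e12 ((sc _ _ hu.rot hu.rot.neg d1 f4).trans (e23.trans e34).symm)
    · exact e12 ((sc _ _ hu.rot hu.neg d1 f3).trans e23.symm)
  have case3 : ∀ x u, IsDir u → hop P x = k → hop P (x + u) = k - 1 →
      hop P (x + -u) = k - 1 → False := by
    intro x u hu hx hxu hxv
    obtain ⟨w, s0, s1, sc⟩ := main x u _ hu hu.neg hx hxu hxv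
    obtain ⟨n1, n2, n3, n4, n5, n6, n7, n8, n9, n10, n11, n12, n13, n14, n15⟩ := dir_distinct hu
    have e12 := s0 (rot u) hu.rot (by rwa [rot_rot]) (by rw [rot_rot]; exact n6.symm)
    have e23 := s1 (rot u - u) hu.rot_sub (by rw [rot_sub, rot_rot]; convert n4 using 1; abel)
      (by rw [rot_sub, rot_rot]; abel)
    have e34 := s0 (-u) hu.neg (by rwa [rot_neg]) (by rwa [rot_neg])
    have e45 := s0 (-rot u) hu.rot.neg (by rw [rot_neg, rot_rot, neg_sub]; exact n11)
      (by rw [rot_neg, rot_rot, neg_sub]; exact n14)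
    rw [rot_rot] at e12
    rw [rot_sub, rot_rot, show rot u - u - rot u = -u by abel] at e23
    rw [rot_neg] at e34
    rw [rot_neg, rot_rot, neg_sub] at e45
    obtain ⟨s, hs, hsk, hse⟩ : ∃ s, IsDir s ∧ hop P (x + s) ≠ k - 1 ∧
        sector w x s = sector w x (rot u - u) := by
      by_cases f1 : hop P (x + rot u) = k - 1
      · refine ⟨rot u - u, hu.rot_sub, fun f2 => triple x u hu hx hxu f1 f2, rfl⟩
      · exact ⟨rot u, hu.rot, f1, e12⟩
    obtain ⟨t, ht, htk, hte⟩ : ∃ t, IsDir t ∧ hop P (x + t) ≠ k - 1 ∧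
        sector w x t = sector w x (-u) := by
      by_cases f1 : hop P (x + -rot u) = k - 1
      · refine ⟨u - rot u, hu.sub_rot, fun f2 => triple x (-u) hu.neg hx hxv
          (by rwa [rot_neg]) (by rwa [rot_neg, show -rot u - -u = u - rot u by abel]),
          (e34.trans e45).symm⟩
      · exact ⟨-rot u, hu.rot.neg, f1, e34.symm⟩
    exact e23 (hse.symm.trans ((sc s t hs ht hsk htk).trans hte))
  intro x u v hu hv hx hxu hxv
  rcases hu.cases hv with rfl | rfl | rfl | rfl | rfl | rfl
  · exact Or.inl rfl
  · exact Or.inr (Or.inl rfl)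
  · exact (case2 x u hu hx hxu hxv).elim
  · exact (case3 x u hu hx hxu hxv).elim
  · refine (case2 x (-rot u) hu.rot.neg hx hxv ?_).elim
    rw [rot_neg, rot_rot, show -(rot u - u) - -rot u = u by abel]
    exact hxu
  · refine Or.inr (Or.inr ?_)
    rw [rot_sub, rot_rot]; abel

/-- Walks from `x` and from its neighbour `y = x + rot u` through lower points close up to a cycle
that uses the edge `x y` once. If neither common neighbour were lower, the cycle would separate
them. -/
theorem sharedLower_succ {P : Set LatticePoint} {k : ℤ} (hk : 2 ≤ k)
    (hT : OpenOutside (P ∪ hub)) (h1 : LowerClique P (k - 1)) (h2 : SharedLower P (k - 1)) :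
    SharedLower P k := by
  intro x u hu hx hy
  by_contra! hcon
  obtain ⟨n1, n2, -⟩ := dir_distinct hu
  obtain ⟨-, c, -, hxc, hc⟩ := exists_hop_pred (P := P) (x := x) (by omega)
  obtain ⟨-, c', -, hyc, hc'⟩ := exists_hop_pred (P := P) (x := x + rot u) (by omega)
  obtain ⟨w, hw, hwz⟩ := exists_closed_walk (P := P) (c := c) (c' := c') hx (by omega)
    (by omega) hxc
  have hyx : lattice.Adj (x + rot u) x := (adj_add hu.rot).symm
  obtain ⟨W, hW⟩ : ∃ W : lattice.Walk x x, W = w.append (SimpleGraph.Walk.cons hyc.symm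
      (SimpleGraph.Walk.cons hyx SimpleGraph.Walk.nil)) := ⟨_, rfl⟩
  have hxT : x ∈ P ∪ hub := mem_of_hop_nonneg (by omega)
  have hyT : x + rot u ∈ P ∪ hub := mem_of_hop_nonneg (by omega)
  have hsup : ∀ p ∈ W.support, (0 ≤ hop P p ∧ hop P p ≤ k - 1) ∨ p = x ∨ p = x + rot u := by
    intro p hp
    rw [hW, SimpleGraph.Walk.mem_support_append_iff] at hp
    rcases hp with hp | hp
    · exact (hw p hp).imp_right Or.inl
    · simp only [SimpleGraph.Walk.support_cons, SimpleGraph.Walk.support_nil, List.mem_cons,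
        List.not_mem_nil, or_false] at hp
      rcases hp with rfl | rfl | rfl
      · left; omega
      · exact Or.inr (Or.inr rfl)
      · exact Or.inr (Or.inl rfl)
  have out : ∀ s, IsDir s → s ≠ rot u → hop P (x + s) ≠ k - 1 →
      ¬ (0 ≤ hop P (x + s) ∧ hop P (x + s) ≤ k - 1) ∧ x + s ≠ x ∧ x + s ≠ x + rot u := by
    intro s hs hsu he
    refine ⟨fun h => ?_, by rw [Ne, add_eq_left]; exact hs.ne_zero, by rwa [Ne, add_right_inj]⟩
    have := hop_adj_le h.1 (by omega) (adj_add hs).symm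
    omega
  have off : ∀ s, IsDir s → s ≠ rot u → hop P (x + s) ≠ k - 1 → x + s ∉ W.support := by
    intro s hs hsu he hin
    obtain ⟨o1, o2, o3⟩ := out s hs hsu he
    rcases hsup _ hin with h | h | h
    · exact o1 h
    · exact o2 h
    · exact o3 h
  have n3 : rot u - u ≠ rot u := by rw [Ne, sub_eq_self]; exact hu.ne_zero
  have e1 : winding W (x + u) = winding W (x + (rot u - u)) :=
    winding_eq_of_ball hT h1 h2 hxT hyT (Or.inr hyx.symm) W hsup (out u hu n1.symm hcon.1)
      (out _ hu.rot_sub n3 hcon.2)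
  rw [winding_eq_sector W hu (off u hu n1.symm hcon.1),
    winding_eq_sector W hu.rot_sub (off _ hu.rot_sub n3 hcon.2)] at e1
  have e2 := sector_add_sector W x hu.rot
  rw [rot_rot, edgeParity, walkSum_congr W (g := fun _ _ => 0), walkSum_zero] at e2
  · have e3 := sector_add_sector W x hu
    rw [hW, edgeParity_append, hwz, edgeParity_cons, edgeParity_cons, ind_false, ind_false,
      ind_true, ← hW, e1, add_comm, e2] at e3
    · simp [edgeParity, walkSum] at e3
    · exact Or.inr ⟨rfl, rfl⟩
    · rintro (⟨h, -⟩ | ⟨h, -⟩) <;> rw [h] at hc' <;> omega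
    · rintro (⟨-, h⟩ | ⟨-, h⟩) <;> rw [h] at hc <;> omega
  · intro p q hp hq _
    apply ind_false
    rintro (⟨-, rfl⟩ | ⟨rfl, -⟩)
    · exact off _ hu.rot_sub n3 hcon.2 hq
    · exact off _ hu.rot_sub n3 hcon.2 hp

/-- In a region without holes, lower neighbours form cliques, and adjacent points of equal hop count
have a common lower neighbour. -/
theorem lowerClique_and_sharedLower {P : Set LatticePoint} (hT : OpenOutside (P ∪ hub)) (n : ℕ) :
    LowerClique P (n + 1) ∧ SharedLower P (n + 1) := by
  induction n with
  | zero =>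
    have one : ∀ x, hop P x = ((0 : ℕ) : ℤ) + 1 → IsDir (-x) := by
      intro x hx
      rw [Nat.cast_zero, zero_add, hop_eq_one_iff, adj_iff, sub_zero] at hx
      exact hx.neg
    refine ⟨fun x u v _ _ hx hu hv => Or.inl ?_, fun x u hu hx hy => ?_⟩
    · have e1 := eq_zero_of_hop_eq_zero (hu.trans (by simp))
      have e2 := eq_zero_of_hop_eq_zero (hv.trans (by simp))
      exact add_left_cancel (e2.trans e1.symm)
    · -- the origin is one of the two common neighbours
      have hx' := one _ hx
      have hy' := one _ hy
      have h0 : ∀ s, s = -x → hop P (x + s) = ((0 : ℕ) : ℤ) + 1 - 1 := by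
        rintro s rfl; simp [hop_zero]
      rcases hu.cases hx' with h | h | h | h | h | h
      · exact Or.inl (h0 u h.symm)
      · rw [neg_add, h] at hy'; simp [IsDir] at hy'
      · exact Or.inr (h0 _ h.symm)
      all_goals
        exfalso
        rw [neg_add, h] at hy'
        rw [isDir_iff] at hu
        revert hy'
        rcases hu with rfl | rfl | rfl | rfl | rfl | rfl <;> simp [IsDir, rot]
  | succ n ih =>
    have e : ((n + 1 : ℕ) : ℤ) + 1 - 1 = (n : ℤ) + 1 := by push_cast; ring
    have hk : (2 : ℤ) ≤ ((n + 1 : ℕ) : ℤ) + 1 := by push_cast; omega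
    exact ⟨lowerClique_succ hk hT (by rw [e]; exact ih.1) (by rw [e]; exact ih.2),
      sharedLower_succ hk hT (by rw [e]; exact ih.1) (by rw [e]; exact ih.2)⟩

/-! ### Ribbons of a region without holes -/

/-- The properties of the region `P`, and of the pair of seeds through which it is attached to the
origin, on which the geometry of its ribbons rests. -/
structure RibbonRegion (P pair : Set LatticePoint) : Prop where
  two_le_hop : ∀ x ∈ P, 2 ≤ hop P x
  clique : ∀ k, 1 ≤ k → LowerClique P k
  shared : ∀ k, 1 ≤ k → SharedLower P k
  low : ∀ x ∈ P, ∀ c, lattice.Adj x c → hop P c = 1 → c ∈ pair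
  pair_eq : pair = {p₁, p₂} ∨ pair = {p₄, p₅}
  smooth : Smooth (P ∪ pair)
  wide : ∀ x ∈ P, ∃ y ∈ P, lattice.Adj x y ∧ hop P y = hop P x
  root_acyclic : ∀ x, hop P x = 2 → ¬ Relation.TransGen (RibbonArc P) x x

/-- `c` is a neighbour of `x` whose hop count is smaller by one. -/
def LowerNbr (P : Set LatticePoint) (x c : LatticePoint) : Prop :=
  lattice.Adj x c ∧ hop P c = hop P x - 1

/-- `x + u` is the lower neighbour of `x` around which a robot at `x` rotates clockwise. -/
def LowerPivot (P : Set LatticePoint) (x u : LatticePoint) : Prop :=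
  IsDir u ∧ hop P (x + u) = hop P x - 1 ∧ hop P (x + rot u) ≠ hop P x - 1

/-- Membership in a ribbon, expressed without reference to `P`. -/
def SameRibbon (P : Set LatticePoint) (x y : LatticePoint) : Prop := (layerGraph P).Reachable x y

theorem SameRibbon.symm {P : Set LatticePoint} {x y : LatticePoint} (h : SameRibbon P x y) :
    SameRibbon P y x := SimpleGraph.Reachable.symm h

theorem SameRibbon.trans {P : Set LatticePoint} {x y z : LatticePoint} (h : SameRibbon P x y)
    (h' : SameRibbon P y z) : SameRibbon P x z := SimpleGraph.Reachable.trans h h'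

theorem sameRibbon_of_adj {P : Set LatticePoint} {x y : LatticePoint} (h : lattice.Adj x y)
    (hx : x ∈ P) (hy : y ∈ P) (hxy : hop P x = hop P y) : SameRibbon P x y :=
  SimpleGraph.Adj.reachable (G := layerGraph P) ⟨h, hx, hy, hxy⟩

theorem sameRibbon_induction {P : Set LatticePoint} {F : LatticePoint → Prop} {x y : LatticePoint}
    (h : SameRibbon P x y) (hx : F x)
    (hs : ∀ a b, F a → lattice.Adj a b → a ∈ P → b ∈ P → hop P a = hop P b → F b) : F y := by
  obtain ⟨w⟩ := h
  induction w with
  | nil => exact hx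
  | cons ha p ih => exact ih (hs _ _ hx ha.1 ha.2.1 ha.2.2.1 ha.2.2.2)

theorem SameRibbon.hop_eq {P : Set LatticePoint} {x y : LatticePoint} (h : SameRibbon P x y) :
    hop P y = hop P x :=
  sameRibbon_induction (F := fun z => hop P z = hop P x) h rfl
    (fun _ _ ha _ _ _ hab => hab.symm.trans ha)

theorem SameRibbon.mem {P : Set LatticePoint} {x y : LatticePoint} (h : SameRibbon P x y)
    (hx : x ∈ P) : y ∈ P :=
  sameRibbon_induction (F := fun z => z ∈ P) h hx (fun _ _ _ _ _ hb _ => hb)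

theorem ribbonOf_eq_iff {P : Set LatticePoint} {x y : LatticePoint} (hy : y ∈ P) :
    ribbonOf P x = ribbonOf P y ↔ SameRibbon P x y := by
  constructor
  · intro h
    have : y ∈ ribbonOf P y := ⟨hy, SimpleGraph.Reachable.refl _⟩
    rw [← h] at this
    exact this.2
  · intro h
    ext z
    exact ⟨fun hz => ⟨hz.1, h.symm.trans hz.2⟩, fun hz => ⟨hz.1, h.trans hz.2⟩⟩

theorem mem_ribbonOf_self {P : Set LatticePoint} {x : LatticePoint} (hx : x ∈ P) :
    x ∈ ribbonOf P x := ⟨hx, SimpleGraph.Reachable.refl _⟩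

theorem ribbonOf_mem_ribbons {P : Set LatticePoint} {x : LatticePoint} (hx : x ∈ P) :
    ribbonOf P x ∈ ribbons P := ⟨x, hx, rfl⟩

theorem eq_ribbonOf {P R : Set LatticePoint} (hR : R ∈ ribbons P) {x : LatticePoint} (hx : x ∈ R) :
    x ∈ P ∧ R = ribbonOf P x := by
  obtain ⟨y, hy, rfl⟩ := hR
  exact ⟨hx.1, (ribbonOf_eq_iff hx.1).2 hx.2⟩

theorem ribbonArc_iff {P : Set LatticePoint} {x y : LatticePoint} :
    RibbonArc P x y ↔ x ∈ P ∧ y ∈ P ∧ hop P y = hop P x ∧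
      ∃ u, IsDir u ∧ hop P (x + u) = hop P x - 1 ∧ y = x + rot u := by
  constructor
  · rintro ⟨⟨hy, hr⟩, c, hc, hcx, rfl⟩
    obtain ⟨u, hu, rfl⟩ := exists_dir_of_adj hc.symm
    rw [rotCW_eq, add_sub_cancel_left] at *
    refine ⟨?_, hy, SameRibbon.hop_eq hr, u, hu, hcx, rfl⟩
    exact SameRibbon.mem (SameRibbon.symm hr) hy
  · rintro ⟨hx, hy, hxy, u, hu, hux, rfl⟩
    refine ⟨⟨hy, sameRibbon_of_adj (adj_add hu.rot) hx hy hxy.symm⟩, x + u, (adj_add hu).symm,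
      hux, ?_⟩
    rw [rotCW_eq, add_sub_cancel_left]

theorem RibbonArc.sameRibbon {P : Set LatticePoint} {x y : LatticePoint} (h : RibbonArc P x y) :
    SameRibbon P x y := h.1.2

theorem sameRibbon_of_arcs {P : Set LatticePoint} {x y : LatticePoint}
    (h : Relation.ReflTransGen (RibbonArc P) x y) : SameRibbon P x y := by
  induction h with
  | refl => exact SimpleGraph.Reachable.refl _
  | tail _ hs ih => exact ih.trans hs.sameRibbon

theorem RibbonLT.sameRibbon {P : Set LatticePoint} {x y : LatticePoint} (h : RibbonLT P x y) :
    SameRibbon P x y := (sameRibbon_of_arcs h.to_reflTransGen).symm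

theorem RibbonLT.trans {P : Set LatticePoint} {x y z : LatticePoint} (h : RibbonLT P x y)
    (h' : RibbonLT P y z) : RibbonLT P x z := Relation.TransGen.trans h' h

theorem IsParentRibbon.exists_lowerNbr {P : Set LatticePoint} {x : LatticePoint} (hx : x ∈ P)
    {Q : Set LatticePoint} (h : IsParentRibbon P Q (ribbonOf P x)) :
    ∃ c ∈ P, LowerNbr P x c ∧ Q = ribbonOf P c := by
  obtain ⟨hQ, -, ⟨k, h1, h2⟩, h3⟩ := h
  obtain ⟨c, hc, hxc⟩ := h3 x (mem_ribbonOf_self hx)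
  obtain ⟨hcP, hQc⟩ := eq_ribbonOf hQ hc
  refine ⟨c, hcP, ⟨hxc, ?_⟩, hQc⟩
  rw [h1 c hc, h2 x (mem_ribbonOf_self hx)]; ring

theorem mem_of_two_le_hop {P : Set LatticePoint} {x : LatticePoint} (hx : 2 ≤ hop P x) : x ∈ P := by
  rcases mem_of_hop_nonneg (P := P) (x := x) (by omega) with h | h
  · exact h
  · rw [mem_hub_iff] at h
    rcases h with rfl | h
    · rw [hop_zero] at hx; omega
    · rw [hop_eq_one_iff.2 h] at hx; omega

theorem ribbonArc_iff_pivot {P : Set LatticePoint} {x y : LatticePoint} :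
    RibbonArc P x y ↔ x ∈ P ∧ y ∈ P ∧ hop P y = hop P x ∧
      ∃ u, LowerPivot P x u ∧ y = x + rot u := by
  rw [ribbonArc_iff]
  constructor
  · rintro ⟨hx, hy, hxy, u, hu, hux, rfl⟩
    exact ⟨hx, hy, hxy, u, ⟨hu, hux, by omega⟩, rfl⟩
  · rintro ⟨hx, hy, hxy, u, hu, rfl⟩
    exact ⟨hx, hy, hxy, u, hu.1, hu.2.1, rfl⟩

namespace RibbonRegion

variable {P pair : Set LatticePoint}

theorem exists_lower (hR : RibbonRegion P pair) {x : LatticePoint} (hx : x ∈ P) :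
    ∃ c, LowerNbr P x c := by
  obtain ⟨-, c, -, h1, h2⟩ := exists_hop_pred (P := P) (x := x) (by have := hR.two_le_hop x hx; omega)
  exact ⟨c, h1, h2⟩

/-- A lower neighbour lies in the region or is one of the two attaching seeds. -/
theorem lower_mem (hR : RibbonRegion P pair) {x c : LatticePoint} (hx : x ∈ P)
    (h : LowerNbr P x c) : c ∈ P ∨ c ∈ pair := by
  have := hR.two_le_hop x hx
  rcases eq_or_lt_of_le this with h2 | h2
  · exact Or.inr (hR.low x hx c h.1 (by rw [h.2]; omega))
  · exact Or.inl (mem_of_two_le_hop (by rw [h.2]; omega))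

theorem clique' (hR : RibbonRegion P pair) {x u v : LatticePoint} (hx : x ∈ P) (hu : IsDir u)
    (hv : IsDir v) (h1 : hop P (x + u) = hop P x - 1) (h2 : hop P (x + v) = hop P x - 1) :
    v = u ∨ v = rot u ∨ u = rot v :=
  hR.clique (hop P x) (by have := hR.two_le_hop x hx; omega) x u v hu hv rfl h1 h2

theorem exists_lowerPivot (hR : RibbonRegion P pair) {x : LatticePoint} (hx : x ∈ P) :
    ∃ u, LowerPivot P x u := by
  obtain ⟨c, hc, hcx⟩ := hR.exists_lower hx
  obtain ⟨u, hu, rfl⟩ := exists_dir_of_adj hc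
  by_cases h : hop P (x + rot u) = hop P x - 1
  · refine ⟨rot u, hu.rot, h, fun h' => ?_⟩
    obtain ⟨n1, n2, n3, n4, -⟩ := dir_distinct hu
    rcases hR.clique' hx hu hu.rot.rot hcx h' with e | e | e
    · rw [rot_rot] at e; exact n2 e
    · rw [rot_rot] at e; exact n3 e
    · rw [rot_rot, rot_rot] at e
      exact n4 (by rw [show -u = rot u - u - rot u by abel]; exact e.symm)
  · exact ⟨u, hu, hcx, h⟩

theorem lowerPivot_unique (hR : RibbonRegion P pair) {x u v : LatticePoint} (hx : x ∈ P)
    (hu : LowerPivot P x u) (hv : LowerPivot P x v) : v = u := by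
  rcases hR.clique' hx hu.1 hv.1 hu.2.1 hv.2.1 with h | h | h
  · exact h
  · exact absurd (h ▸ hv.2.1) hu.2.2
  · exact absurd (h ▸ hu.2.1) hv.2.2

theorem arc_unique (hR : RibbonRegion P pair) {x y z : LatticePoint} (h : RibbonArc P x y)
    (h' : RibbonArc P x z) : z = y := by
  rw [ribbonArc_iff_pivot] at h h'
  obtain ⟨hx, -, -, u, hu, rfl⟩ := h
  obtain ⟨-, -, -, v, hv, rfl⟩ := h'
  rw [hR.lowerPivot_unique hx hu hv]

/-- If two arcs ended at `y`, then `y` would have two lower neighbours that are adjacent, and the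
start of one of the arcs would be the centre of the other. -/
theorem arc_pred_unique (hR : RibbonRegion P pair) {x x' y : LatticePoint} (h : RibbonArc P x y)
    (h' : RibbonArc P x' y) : x' = x := by
  rw [ribbonArc_iff] at h h'
  obtain ⟨hx, hy, hxy, u, hu, hux, rfl⟩ := h
  obtain ⟨hx', -, hxy', v, hv, hvx, hq⟩ := h'
  obtain rfl : x' = x + rot u - rot v := by rw [hq]; abel
  have inj : ∀ a b : LatticePoint, rot a = rot b → a = b := by
    intro a b h
    simp only [rot, Prod.mk.injEq] at h
    ext <;> omega
  have e1 : x + rot u + (u - rot u) = x + u := by abel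
  have e2 : x + rot u + (v - rot v) = x + rot u - rot v + v := by abel
  rcases hR.clique' hy hu.sub_rot hv.sub_rot (by rw [e1]; omega) (by rw [e2]; omega) with h | h | h
  · have := congrArg rot h
    simp only [rot_sub, rot_rot, sub_sub_cancel] at this
    rw [this]; abel
  · rw [rot_sub, rot_rot, sub_sub_cancel] at h
    rw [show x + rot u - rot v = x + rot u + (v - rot v) - v by abel, h] at hxy'
    have : v = rot u := by
      have := congrArg rot h
      rwa [rot_sub, rot_rot, sub_sub_cancel] at this
    rw [this, show x + rot u + u - rot u = x + u by abel] at hxy'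
    omega
  · rw [rot_sub, rot_rot, sub_sub_cancel] at h
    have : u = rot v := by
      have := congrArg rot h
      rwa [rot_sub, rot_rot, sub_sub_cancel] at this
    rw [this, show x + rot (rot v) - rot v + v = x by rw [rot_rot]; abel] at hvx
    rw [this] at hxy hxy'
    omega

/-- Adjacent points of a ribbon are joined by an arc, one way or the other. -/
theorem arc_or_arc (hR : RibbonRegion P pair) {x y : LatticePoint} (h : lattice.Adj x y)
    (hx : x ∈ P) (hy : y ∈ P) (hxy : hop P x = hop P y) : RibbonArc P x y ∨ RibbonArc P y x := by
  obtain ⟨v, hv, rfl⟩ := exists_dir_of_adj h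
  obtain ⟨u, hu, rfl⟩ : ∃ u, IsDir u ∧ v = rot u :=
    ⟨v - rot v, hv.sub_rot, by rw [rot_sub, rot_rot]; abel⟩
  have := hR.two_le_hop x hx
  rcases hR.shared (hop P x) (by omega) x u hu rfl hxy.symm with h | h
  · exact Or.inl (ribbonArc_iff.2 ⟨hx, hy, hxy.symm, u, hu, h, rfl⟩)
  · refine Or.inr (ribbonArc_iff.2 ⟨hy, hx, hxy, -u, hu.neg, ?_, ?_⟩)
    · rw [show x + rot u + -u = x + (rot u - u) by abel]; omega
    · rw [rot_neg]; abel

/-- Ribbons are linearly ordered: in a connected set in which arcs are determined by either end,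
walking along arcs reaches everything. -/
theorem ribbonLT_total (hR : RibbonRegion P pair) {x y : LatticePoint} (h : SameRibbon P x y) :
    x = y ∨ RibbonLT P x y ∨ RibbonLT P y x := by
  refine sameRibbon_induction (F := fun z => x = z ∨ RibbonLT P x z ∨ RibbonLT P z x) h
    (Or.inl rfl) ?_
  intro a b ha hab haP hbP hh
  rcases hR.arc_or_arc hab haP hbP hh with arc | arc
  · rcases ha with rfl | ha | ha
    · exact Or.inr (Or.inr (Relation.TransGen.single arc))
    · rcases Relation.TransGen.head'_iff.1 ha with ⟨c, hc, hcx⟩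
      rw [hR.arc_unique arc hc] at hcx
      rcases Relation.reflTransGen_iff_eq_or_transGen.1 hcx with e | e
      · exact Or.inl e
      · exact Or.inr (Or.inl e)
    · exact Or.inr (Or.inr (Relation.TransGen.tail ha arc))
  · rcases ha with rfl | ha | ha
    · exact Or.inr (Or.inl (Relation.TransGen.single arc))
    · exact Or.inr (Or.inl (Relation.TransGen.head arc ha))
    · rcases Relation.TransGen.tail'_iff.1 ha with ⟨c, hxc, hc⟩
      rw [hR.arc_pred_unique arc hc] at hxc
      rcases Relation.reflTransGen_iff_eq_or_transGen.1 hxc with e | e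
      · exact Or.inl e.symm
      · exact Or.inr (Or.inr e)

/-- The lower neighbours of adjacent points of a ribbon lie on a common ribbon. -/
theorem lower_sameRibbon_of_adj (hR : RibbonRegion P pair) {x y c c' : LatticePoint}
    (hx : x ∈ P) (hy : y ∈ P) (h : x = y ∨ lattice.Adj x y) (hxy : hop P x = hop P y)
    (hc : LowerNbr P x c) (hc' : LowerNbr P y c') (hcP : c ∈ P) (hcP' : c' ∈ P) :
    SameRibbon P c c' := by
  have same : ∀ {z a b}, z ∈ P → LowerNbr P z a → LowerNbr P z b → a ∈ P → b ∈ P →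
      SameRibbon P a b := by
    intro z a b hz ha hb haP hbP
    obtain ⟨ha1, ha2⟩ := ha
    obtain ⟨hb1, hb2⟩ := hb
    obtain ⟨u, hu, rfl⟩ := exists_dir_of_adj ha1
    obtain ⟨v, hv, rfl⟩ := exists_dir_of_adj hb1
    rcases hR.clique' hz hu hv ha2 hb2 with rfl | rfl | rfl
    · exact SimpleGraph.Reachable.refl _
    · refine sameRibbon_of_adj ?_ haP hbP (by rw [ha2, hb2])
      rw [adj_iff, show z + rot u - (z + u) = rot u - u by abel]
      exact hu.rot_sub
    · refine sameRibbon_of_adj ?_ haP hbP (by rw [ha2, hb2])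
      rw [adj_iff, show z + v - (z + rot v) = v - rot v by abel]
      exact hv.sub_rot
  rcases h with rfl | h
  · exact same hx hc hc' hcP hcP'
  · have e1 := hR.two_le_hop c hcP
    have e2 := hc.2
    obtain ⟨e, he, he'⟩ : ∃ e, LowerNbr P x e ∧ LowerNbr P y e := by
      obtain ⟨v, hv, rfl⟩ := exists_dir_of_adj h
      obtain ⟨u, hu, rfl⟩ : ∃ u, IsDir u ∧ v = rot u :=
        ⟨v - rot v, hv.sub_rot, by rw [rot_sub, rot_rot]; abel⟩
      rcases hR.shared (hop P x) (by omega) x u hu rfl hxy.symm with h | h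
      · refine ⟨_, ⟨adj_add hu, h⟩, ?_, by omega⟩
        rw [adj_iff, show x + u - (x + rot u) = u - rot u by abel]
        exact hu.sub_rot
      · refine ⟨_, ⟨adj_add hu.rot_sub, h⟩, ?_, by omega⟩
        rw [adj_iff, show x + (rot u - u) - (x + rot u) = -u by abel]
        exact hu.neg
    have heP : e ∈ P := mem_of_two_le_hop (by have := he.2; omega)
    exact (same hx hc he hcP heP).trans (same hy he' hc' heP hcP')

/-- The lower neighbours of all points of a ribbon lie on a common ribbon. -/
theorem lower_sameRibbon (hR : RibbonRegion P pair) {x y c c' : LatticePoint}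
    (hx : x ∈ P) (h : SameRibbon P x y) (hc : LowerNbr P x c) (hc' : LowerNbr P y c')
    (hcP : c ∈ P) : c' ∈ P ∧ SameRibbon P c c' := by
  have h2 := hR.two_le_hop c hcP
  have key : ∀ {z d}, hop P z = hop P x → LowerNbr P z d → d ∈ P := by
    intro z d hz hd
    exact mem_of_two_le_hop (by rw [hd.2, hz, ← hc.2]; exact h2)
  refine ⟨key h.hop_eq hc', ?_⟩
  revert c'
  suffices hs : (y ∈ P ∧ hop P y = hop P x) ∧ ∀ {c'}, LowerNbr P y c' → SameRibbon P c c' from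
    fun {c'} h => hs.2 h
  refine sameRibbon_induction (F := fun y => (y ∈ P ∧ hop P y = hop P x) ∧
    ∀ {c'}, LowerNbr P y c' → SameRibbon P c c') h ⟨⟨hx, rfl⟩, fun {c'} hc' => ?_⟩ ?_
  · exact hR.lower_sameRibbon_of_adj hx hx (Or.inl rfl) rfl hc hc' hcP (key rfl hc')
  · rintro a b ⟨⟨-, ha⟩, ha'⟩ hab haP hbP hh
    refine ⟨⟨hbP, hh.symm.trans ha⟩, fun {c'} hc' => ?_⟩
    obtain ⟨d, hd⟩ := hR.exists_lower haP
    exact (ha' hd).trans (hR.lower_sameRibbon_of_adj haP hbP (Or.inr hab) hh hd hc'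
      (key ha hd) (key (hh.symm.trans ha) hc'))

/-- The ribbon through the lower neighbours of `x` is the parent of the ribbon through `x`. -/
theorem isParentRibbon (hR : RibbonRegion P pair) {x c : LatticePoint} (hx : x ∈ P) (hc : c ∈ P)
    (h : LowerNbr P x c) : IsParentRibbon P (ribbonOf P c) (ribbonOf P x) := by
  refine ⟨ribbonOf_mem_ribbons hc, ribbonOf_mem_ribbons hx, ⟨hop P c, ?_, ?_⟩, ?_⟩
  · exact fun y hy => SameRibbon.hop_eq hy.2
  · intro y hy
    rw [SameRibbon.hop_eq hy.2, h.2]; ring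
  · intro y hy
    obtain ⟨d, hd⟩ := hR.exists_lower hy.1
    obtain ⟨hdP, hcd⟩ := hR.lower_sameRibbon hx hy.2 h hd hc
    exact ⟨d, ⟨hdP, hcd⟩, hd.1⟩

/-! ### Ribbons are not cyclic -/

/-- When a robot follows its ribbon by one arc, the centre of its rotation stays or advances by one
arc. -/
theorem pivot_arc (hR : RibbonRegion P pair) {x y u v : LatticePoint} (h : RibbonArc P x y)
    (hx3 : 3 ≤ hop P x) (hu : LowerPivot P x u) (hv : LowerPivot P y v) :
    Relation.ReflTransGen (RibbonArc P) (x + u) (y + v) := by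
  obtain ⟨hx, hy, hxy, u', hu', rfl⟩ := ribbonArc_iff_pivot.1 h
  obtain rfl := hR.lowerPivot_unique hx hu hu'
  obtain ⟨hud, hux, -⟩ := hu
  obtain ⟨hvd, hvy, hvy'⟩ := hv
  have e1 : x + rot u' + (u' - rot u') = x + u' := by abel
  rcases hR.clique' hy hud.sub_rot hvd (by rw [e1]; omega) hvy with h | h | h
  · rw [h, e1]
  · rw [rot_sub, rot_rot, sub_sub_cancel] at h
    subst h
    have e2 : x + rot v + v = x + v + rot v := by abel
    rw [e2] at hvy ⊢
    refine Relation.ReflTransGen.single (ribbonArc_iff.2 ⟨mem_of_two_le_hop (by omega),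
      mem_of_two_le_hop (by omega), by omega, v, hud, ?_, rfl⟩)
    refine (hR.shared (hop P (x + v)) (by omega) (x + v) v hud rfl (by omega)).resolve_right ?_
    rw [show x + v + (rot v - v) = x + rot v by abel]
    omega
  · rw [← h, e1] at hvy'
    omega

/-- The centres of rotation along a cyclic ribbon would form a cyclic ribbon of smaller gradient, or
a single point. In the latter case the ribbon would contain all six neighbours of that point,
including its lower neighbour. -/
theorem acyclic (hR : RibbonRegion P pair) (x : LatticePoint) :
    ¬ Relation.TransGen (RibbonArc P) x x := by
  obtain ⟨n, hn⟩ : ∃ n : ℕ, hop P x ≤ n := ⟨(hop P x).toNat, Int.self_le_toNat _⟩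
  induction n generalizing x with
  | zero =>
    intro h
    obtain ⟨y, hy, -⟩ := Relation.TransGen.head'_iff.1 h
    have := hR.two_le_hop x (ribbonArc_iff.1 hy).1
    push_cast at hn
    omega
  | succ n ih =>
    intro h
    have hxP : x ∈ P := by
      obtain ⟨y, hy, -⟩ := Relation.TransGen.head'_iff.1 h
      exact (ribbonArc_iff.1 hy).1
    have hx2 := hR.two_le_hop x hxP
    rcases eq_or_lt_of_le hx2 with e | hx3
    · exact hR.root_acyclic x e.symm h
    -- every point reached from `x` leads back to `x`
    have back : ∀ y, Relation.ReflTransGen (RibbonArc P) x y →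
        Relation.TransGen (RibbonArc P) y x := by
      intro y hy
      induction hy with
      | refl => exact h
      | tail _ hs ih2 =>
        obtain ⟨z', hz', hz'x⟩ := Relation.TransGen.head'_iff.1 ih2
        rw [hR.arc_unique hs hz'] at hz'x
        exact Relation.TransGen.trans_right hz'x h
    have hop_const : ∀ y, Relation.ReflTransGen (RibbonArc P) x y → y ∈ P ∧ hop P y = hop P x :=
      fun y hy => ⟨(sameRibbon_of_arcs hy).mem hxP, (sameRibbon_of_arcs hy).hop_eq⟩
    -- the centres of rotation advance along their own ribbon
    have mono : ∀ y z, Relation.ReflTransGen (RibbonArc P) x y →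
        Relation.ReflTransGen (RibbonArc P) y z → ∀ u v, LowerPivot P y u → LowerPivot P z v →
        Relation.ReflTransGen (RibbonArc P) (y + u) (z + v) := by
      intro y z hy hyz
      induction hyz with
      | refl =>
        intro u v hu hv
        rw [hR.lowerPivot_unique (hop_const y hy).1 hu hv]
      | tail hyb hs ih2 =>
        rename_i b c
        intro u v hu hv
        have hb := hop_const b (hy.trans hyb)
        obtain ⟨w, hw⟩ := hR.exists_lowerPivot hb.1
        exact (ih2 u w hu hw).trans (hR.pivot_arc hs (by rw [hb.2]; omega) hw hv)
    obtain ⟨u, hu⟩ := hR.exists_lowerPivot hxP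
    -- hence the centre of rotation does not change, and the ribbon surrounds it
    have const : ∀ y v, Relation.ReflTransGen (RibbonArc P) x y → LowerPivot P y v →
        y + v = x + u := by
      intro y v hy hv
      have m1 := mono x y .refl hy u v hu hv
      have m2 := mono y x hy (back y hy).to_reflTransGen v u hv hu
      rcases Relation.reflTransGen_iff_eq_or_transGen.1 m1 with e | e
      · exact e
      · refine absurd (e.trans_left m2) (ih (x + u) ?_)
        rw [hu.2.1]; push_cast at hn; omega
    -- so the ribbon turns around `x + u` by `π / 3` at a time
    have turn : ∀ v, IsDir v → Relation.ReflTransGen (RibbonArc P) x (x + u + v) →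
        Relation.ReflTransGen (RibbonArc P) x (x + u + (v - rot v)) := by
      intro v hv hr
      obtain ⟨z, hz, -⟩ := Relation.TransGen.head'_iff.1 (back _ hr)
      obtain ⟨-, -, -, w, hw, rfl⟩ := ribbonArc_iff_pivot.1 hz
      have e := const _ w hr hw
      have hwv : w = -v := by
        have e2 : w = x + u + v + w - (x + u) - v := by abel
        rw [e2, e]; abel
      have e3 := hr.tail hz
      rwa [hwv, rot_neg, show x + u + v + -rot v = x + u + (v - rot v) by abel] at e3
    have t0 : Relation.ReflTransGen (RibbonArc P) x (x + u + -u) := by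
      rw [add_neg_cancel_right]
    have hud := hu.1
    have t1 := turn _ hud.neg t0
    rw [rot_neg, show -u - -rot u = rot u - u by abel] at t1
    have t2 := turn _ hud.rot_sub t1
    rw [rot_sub, rot_rot, show rot u - u - (rot u - u - rot u) = rot u by abel] at t2
    have t3 := turn _ hud.rot t2
    rw [rot_rot, sub_sub_cancel] at t3
    have t4 := turn _ hud t3
    have t5 := turn _ hud.sub_rot t4
    rw [rot_sub, rot_rot, show u - rot u - (rot u - (rot u - u)) = -rot u by abel] at t5
    have hcP : x + u ∈ P := mem_of_two_le_hop (by rw [hu.2.1]; omega)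
    obtain ⟨e, he1, he2⟩ := hR.exists_lower hcP
    obtain ⟨s, hs, rfl⟩ := exists_dir_of_adj he1
    have h1 := hu.2.1
    have : Relation.ReflTransGen (RibbonArc P) x (x + u + s) := by
      rcases hud.cases hs with rfl | rfl | rfl | rfl | rfl | rfl
      · exact t3
      · exact t2
      · exact t1
      · exact t0
      · exact t5
      · exact t4
    have := (hop_const _ this).2
    omega

end RibbonRegion

/-! ### Partially built regions -/

/-- The partial assembly `B` of the region `P` in which ribbons are filled from the front, and no
ribbon is begun before its parent. -/
structure FrontClosed (P B : Set LatticePoint) : Prop where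
  subset : B ⊆ P
  lower : ∀ y ∈ B, ∀ z ∈ P, LowerNbr P y z → z ∈ B
  front : ∀ y ∈ B, ∀ z, RibbonArc P y z → z ∈ B
  base : ∀ y ∈ B, ∀ p, RibbonArc P p y → ∀ z ∈ P, LowerNbr P p z → z ∈ B

namespace RibbonRegion

variable {P pair : Set LatticePoint}

theorem pair_hop (hR : RibbonRegion P pair) {c : LatticePoint} (hc : c ∈ pair) : hop P c = 1 := by
  rw [hop_eq_one_iff, adj_iff, isDir_iff]
  rcases hR.pair_eq with h | h <;> rw [h] at hc <;> rcases hc with rfl | rfl <;> decide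

/-- The neighbours in a partial assembly of a free point of the region. -/
theorem contact (hR : RibbonRegion P pair) {B : Set LatticePoint} (hB : FrontClosed P B)
    {p w s : LatticePoint} (hp : p ∈ P) (hpB : p ∉ B) (hs : LowerPivot P p s) (hw : IsDir w)
    (hpw : p + w ∈ B ∪ pair) :
    w = s ∨ w = s - rot s ∨ (w = rot s ∧ p + s ∈ B ∪ pair) := by
  have hk := hR.two_le_hop p hp
  have hlow : hop P (p + w) = hop P p - 1 → w = s ∨ w = s - rot s := by
    intro h
    rcases hR.clique' hp hs.1 hw hs.2.1 h with h' | h' | h'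
    · exact Or.inl h'
    · exact absurd (h' ▸ h) hs.2.2
    · right
      have e : w = rot w - rot (rot w) := by rw [rot_rot]; abel
      rw [h']; exact e
  rcases hpw with hpw | hpw
  · have h1 := hR.two_le_hop _ (hB.subset hpw)
    have hadj := adj_add (x := p) hw
    have hle := hop_adj_le (P := P) (by omega) (by omega) hadj
    have hle' := hop_adj_le (P := P) (by omega) (by omega) hadj.symm
    have hcases : hop P (p + w) = hop P p - 1 ∨ hop P (p + w) = hop P p ∨
        hop P (p + w) = hop P p + 1 := by omega
    rcases hcases with h | h | h
    · exact (hlow h).elim Or.inl (fun h => Or.inr (Or.inl h))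
    · rcases hR.arc_or_arc hadj hp (hB.subset hpw) h.symm with arc | arc
      · obtain ⟨-, -, -, s', hs', e⟩ := ribbonArc_iff_pivot.1 arc
        rw [hR.lowerPivot_unique hp hs hs'] at e
        refine Or.inr (Or.inr ⟨add_left_cancel e, ?_⟩)
        have hl : LowerNbr P p (p + s) := ⟨adj_add hs.1, hs.2.1⟩
        rcases hR.lower_mem hp hl with h' | h'
        · exact Or.inl (hB.base _ hpw _ arc _ h' hl)
        · exact Or.inr h'
      · exact absurd (hB.front _ hpw _ arc) hpB
    · exact absurd (hB.lower _ hpw _ hp ⟨hadj.symm, by omega⟩) hpB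
  · have h1 := hR.pair_hop hpw
    have hadj := adj_add (x := p) hw
    have hle' := hop_adj_le (P := P) (by omega) (by omega) hadj.symm
    exact (hlow (by omega)).elim Or.inl (fun h => Or.inr (Or.inl h))

/-- By `contact`, the neighbours in a partial assembly of a free point of the region are consecutive
and number at most three. -/
theorem smooth_at_free (hR : RibbonRegion P pair) {B : Set LatticePoint} (hB : FrontClosed P B)
    {p u : LatticePoint} (hp : p ∈ P) (hpB : p ∉ B) (hu : IsDir u) (hpu : p + u ∈ B ∪ pair) :
    p - u ∉ B ∪ pair ∧ (p + (rot u - u) ∈ B ∪ pair → p + rot u ∈ B ∪ pair) := by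
  obtain ⟨s, hs⟩ := hR.exists_lowerPivot hp
  have hc := fun w hw => hR.contact hB (w := w) hp hpB hs hw
  have hd := dir_distinct hs.1
  have c1 := hc u hu hpu
  refine ⟨fun h => ?_, fun h => ?_⟩
  · have c2 := hc (-u) hu.neg (by rwa [← sub_eq_add_neg])
    have hsd := hs.1
    rw [isDir_iff] at hsd
    rcases c1 with rfl | rfl | ⟨rfl, -⟩ <;>
      rcases hsd with rfl | rfl | rfl | rfl | rfl | rfl <;> simp [rot] at c2
  · have c2 := hc _ hu.rot_sub h
    have e : rot (s - rot s) = s := by rw [rot_sub, rot_rot]; abel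
    rcases c1 with rfl | rfl | ⟨rfl, -⟩
    · rcases c2 with c | c | ⟨c, -⟩
      · exact absurd c hd.2.1
      · exact absurd c.symm hd.2.2.2.2.2.2.2.2.2.2.2.2.1
      · exact absurd c hd.2.2.1
    · rw [e] at c2 h ⊢
      rcases c2 with c | c | ⟨-, c⟩
      · rw [sub_sub_cancel] at c; exact absurd c hd.1
      · rw [sub_sub_cancel] at c; exact absurd c.symm hd.2.2.2.2.2.2.2.2.2.2.2.1
      · exact c
    · rw [rot_rot, sub_sub_cancel_left] at c2
      rcases c2 with c | c | ⟨c, -⟩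
      · exact absurd c hd.2.2.2.1
      · exact absurd c.symm hd.2.2.2.2.2.2.2.2.2.2.2.2.2.1
      · exact absurd c hd.2.2.2.2.1

/-- Partial assemblies are smooth. -/
theorem smooth_of_frontClosed (hR : RibbonRegion P pair) {B : Set LatticePoint}
    (hB : FrontClosed P B) : Smooth (B ∪ pair) := by
  have hsub : B ∪ pair ⊆ P ∪ pair := Set.union_subset_union_left _ hB.subset
  intro p hp u hu hpu
  by_cases hpP : p ∈ P
  · exact hR.smooth_at_free hB hpP (fun h => hp (Or.inl h)) hu hpu
  · have hp' : p ∉ P ∪ pair := fun h => h.elim hpP (fun h => hp (Or.inr h))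
    have hsm := hR.smooth p hp' u hu (hsub hpu)
    refine ⟨fun h => hsm.1 (hsub h), fun h => ?_⟩
    rcases hsm.2 (hsub h) with h' | h'
    · by_cases hB' : p + rot u ∈ B
      · exact Or.inl hB'
      · have := (hR.smooth_at_free hB h' hB' hu.neg
          (by rwa [show p + rot u + -u = p + (rot u - u) by abel])).2
        rw [rot_neg, show p + rot u + (-rot u - -u) = p + u by abel,
          show p + rot u + -rot u = p by abel] at this
        exact absurd (this hpu) hp
    · exact Or.inr h'

/-- A finite partial assembly is built by adding points one at a time. -/
theorem frontClosed_induction (hR : RibbonRegion P pair) {motive : Finset LatticePoint → Prop}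
    (empty : motive ∅)
    (insert : ∀ (B : Finset LatticePoint) x c, x ∉ B → FrontClosed P B →
      FrontClosed P (insert x B : Finset LatticePoint) → x ∈ P → lattice.Adj x c →
      c ∈ (B : Set LatticePoint) ∪ pair → motive B → motive (insert x B))
    (B : Finset LatticePoint) (hB : FrontClosed P B) : motive B := by
  induction hn : B.card generalizing B with
  | zero => rw [Finset.card_eq_zero.1 hn]; exact empty
  | succ n ih =>
    have hne : B.Nonempty := Finset.card_pos.1 (by omega)
    obtain ⟨y, hyB, hy⟩ := B.exists_max_image (hop P) hne
    -- the last point of a ribbon of largest gradient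
    obtain ⟨x, hxB, hx, hlast⟩ : ∃ x ∈ B, (∀ z ∈ B, hop P z ≤ hop P x) ∧
        ∀ z ∈ B, ¬ RibbonArc P z x := by
      let r : {z // z ∈ B} → {z // z ∈ B} → Prop := fun a b => Relation.TransGen (RibbonArc P) a b
      have : IsTrans _ r := ⟨fun _ _ _ h h' => Relation.TransGen.trans h h'⟩
      have : Std.Irrefl r := ⟨fun a => hR.acyclic a⟩
      have wf : WellFounded r := Finite.wellFounded_of_trans_of_irrefl r
      obtain ⟨x, hx, hmin⟩ := wf.has_min {z | hop P z = hop P y} ⟨⟨y, hyB⟩, rfl⟩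
      refine ⟨x, x.2, fun z hz => (hy z hz).trans hx.ge, fun z hz harc => ?_⟩
      refine hmin ⟨z, hz⟩ ?_ (Relation.TransGen.single harc)
      have := (ribbonArc_iff.1 harc).2.2.1
      exact this.symm.trans hx
    have hxP := hB.subset hxB
    have hclosed : FrontClosed P (B.erase x : Finset LatticePoint) := by
      refine ⟨fun z hz => hB.subset (Finset.mem_of_mem_erase hz), ?_, ?_, ?_⟩
      · intro z hz w hw hl
        have hzB := Finset.mem_of_mem_erase hz
        refine Finset.mem_coe.2 (Finset.mem_erase.2 ⟨?_, hB.lower z hzB w hw hl⟩)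
        rintro rfl
        have := hx z hzB
        have := hl.2
        omega
      · intro z hz w hl
        have hzB := Finset.mem_of_mem_erase hz
        refine Finset.mem_coe.2 (Finset.mem_erase.2 ⟨?_, hB.front z hzB w hl⟩)
        rintro rfl
        exact hlast z hzB hl
      · intro z hz p hl w hw hpw
        have hzB := Finset.mem_of_mem_erase hz
        refine Finset.mem_coe.2 (Finset.mem_erase.2 ⟨?_, hB.base z hzB p hl w hw hpw⟩)
        rintro rfl
        have := hx z hzB
        have := hpw.2
        have := (ribbonArc_iff.1 hl).2.2.1
        omega
    obtain ⟨c, hc⟩ := hR.exists_lower hxP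
    have := insert (B.erase x) x c (Finset.notMem_erase x B) hclosed
      (by rwa [Finset.insert_erase hxB]) hxP hc.1 ?_
      (ih _ hclosed (by rw [Finset.card_erase_of_mem hxB]; omega))
    · rwa [Finset.insert_erase hxB] at this
    · rcases hR.lower_mem hxP hc with h | h
      · exact Or.inl (Finset.mem_coe.2 (Finset.mem_erase.2 ⟨hc.1.ne', hB.lower x hxB c h hc⟩))
      · exact Or.inr h

end RibbonRegion

/-! ### The seeds together with two partially built regions -/

theorem mem_seeds {x : LatticePoint} :
    x ∈ seeds ↔ x = 0 ∨ x = p₁ ∨ x = p₂ ∨ x = p₄ ∨ x = p₅ := by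
  simp [seeds]

theorem smooth_seeds : Smooth (seeds : Set LatticePoint) := by
  intro p hp u hu hpu
  obtain ⟨s, hs, rfl⟩ : ∃ s ∈ seeds, p = s - u := ⟨p + u, hpu, by abel⟩
  simp only [Finset.mem_coe] at hp ⊢
  clear hpu
  rw [isDir_iff] at hu
  rw [mem_seeds] at hs
  rcases hs with rfl | rfl | rfl | rfl | rfl <;>
    rcases hu with rfl | rfl | rfl | rfl | rfl | rfl <;> revert hp <;> decide

/-- The boundary of the seeds is a cycle of twelve positions. -/
theorem oneOrbit_seeds : OneOrbit (seeds : Set LatticePoint) := by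
  have step : ∀ p u q : LatticePoint, (IsDir u ∧ p ∉ seeds ∧ p + u ∈ seeds ∧ p + rot u ∉ seeds ∧
      p + (rot u - u) ∉ seeds) ∧ q = p + rot u → Step (seeds : Set LatticePoint) p q :=
    fun p u q h => ⟨u, h.1, h.2⟩
  have s0 : Step seeds (-2, 1) (-2, 2) :=
    step _ (1, 0) _ ⟨⟨by simp [IsDir], by decide, by decide, by decide, by decide⟩, by decide⟩
  have s1 : Step seeds (-2, 2) (-1, 2) :=
    step _ (1, -1) _ ⟨⟨by simp [IsDir], by decide, by decide, by decide, by decide⟩, by decide⟩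
  have s2 : Step seeds (-1, 2) (0, 2) :=
    step _ (1, -1) _ ⟨⟨by simp [IsDir], by decide, by decide, by decide, by decide⟩, by decide⟩
  have s3 : Step seeds (0, 2) (1, 1) :=
    step _ (0, -1) _ ⟨⟨by simp [IsDir], by decide, by decide, by decide, by decide⟩, by decide⟩
  have s4 : Step seeds (1, 1) (1, 0) :=
    step _ (-1, 0) _ ⟨⟨by simp [IsDir], by decide, by decide, by decide, by decide⟩, by decide⟩
  have s5 : Step seeds (1, 0) (2, -1) :=
    step _ (0, -1) _ ⟨⟨by simp [IsDir], by decide, by decide, by decide, by decide⟩, by decide⟩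
  have s6 : Step seeds (2, -1) (2, -2) :=
    step _ (-1, 0) _ ⟨⟨by simp [IsDir], by decide, by decide, by decide, by decide⟩, by decide⟩
  have s7 : Step seeds (2, -2) (1, -2) :=
    step _ (-1, 1) _ ⟨⟨by simp [IsDir], by decide, by decide, by decide, by decide⟩, by decide⟩
  have s8 : Step seeds (1, -2) (0, -2) :=
    step _ (-1, 1) _ ⟨⟨by simp [IsDir], by decide, by decide, by decide, by decide⟩, by decide⟩
  have s9 : Step seeds (0, -2) (-1, -1) :=
    step _ (0, 1) _ ⟨⟨by simp [IsDir], by decide, by decide, by decide, by decide⟩, by decide⟩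
  have s10 : Step seeds (-1, -1) (-1, 0) :=
    step _ (1, 0) _ ⟨⟨by simp [IsDir], by decide, by decide, by decide, by decide⟩, by decide⟩
  have s11 : Step seeds (-1, 0) (-2, 1) :=
    step _ (0, 1) _ ⟨⟨by simp [IsDir], by decide, by decide, by decide, by decide⟩, by decide⟩
  have mem : ∀ p, Touches (seeds : Set LatticePoint) p → p ∈ ({(-2, 1), (-2, 2), (-1, 2), (0, 2),
      (1, 1), (1, 0), (2, -1), (2, -2), (1, -2), (0, -2), (-1, -1), (-1, 0)} :
        Finset LatticePoint) := by
    rintro p ⟨hp, u, hu, hpu⟩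
    obtain ⟨s, hs, rfl⟩ : ∃ s ∈ seeds, p = s - u := ⟨p + u, hpu, by abel⟩
    simp only [Finset.mem_coe] at hp
    clear hpu
    rw [isDir_iff] at hu
    rw [mem_seeds] at hs
    rcases hs with rfl | rfl | rfl | rfl | rfl <;>
      rcases hu with rfl | rfl | rfl | rfl | rfl | rfl <;> revert hp <;> decide
  have to0 : ∀ p, Touches (seeds : Set LatticePoint) p →
      Relation.ReflTransGen (Step seeds) p (-2, 1) := by
    intro p hp
    have r11 := Relation.ReflTransGen.single s11
    have r10 := r11.head s10
    have r9 := r10.head s9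
    have r8 := r9.head s8
    have r7 := r8.head s7
    have r6 := r7.head s6
    have r5 := r6.head s5
    have r4 := r5.head s4
    have r3 := r4.head s3
    have r2 := r3.head s2
    have r1 := r2.head s1
    have := mem p hp
    simp only [Finset.mem_insert, Finset.mem_singleton] at this
    rcases this with rfl | rfl | rfl | rfl | rfl | rfl | rfl | rfl | rfl | rfl | rfl | rfl
    exacts [.refl, r1, r2, r3, r4, r5, r6, r7, r8, r9, r10, r11]
  have from0 : ∀ p, Touches (seeds : Set LatticePoint) p →
      Relation.ReflTransGen (Step seeds) (-2, 1) p := by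
    intro p hp
    have r1 := Relation.ReflTransGen.single s0
    have r2 := r1.tail s1
    have r3 := r2.tail s2
    have r4 := r3.tail s3
    have r5 := r4.tail s4
    have r6 := r5.tail s5
    have r7 := r6.tail s6
    have r8 := r7.tail s7
    have r9 := r8.tail s8
    have r10 := r9.tail s9
    have r11 := r10.tail s10
    have := mem p hp
    simp only [Finset.mem_insert, Finset.mem_singleton] at this
    rcases this with rfl | rfl | rfl | rfl | rfl | rfl | rfl | rfl | rfl | rfl | rfl | rfl
    exacts [.refl, r1, r2, r3, r4, r5, r6, r7, r8, r9, r10, r11]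
  exact fun p q hp hq => (to0 p hp).trans (from0 q hq)

/-- Smoothness at a point depends on its neighbours only. -/
theorem Smooth.congr_at {A A' : Set LatticePoint} (hA : Smooth A) {p : LatticePoint} (hp : p ∉ A)
    (h : ∀ w, IsDir w → (p + w ∈ A' ↔ p + w ∈ A)) {u : LatticePoint} (hu : IsDir u)
    (hpu : p + u ∈ A') : p - u ∉ A' ∧ (p + (rot u - u) ∈ A' → p + rot u ∈ A') := by
  rw [sub_eq_add_neg, h _ hu.neg, h _ hu.rot_sub, h _ hu.rot, ← sub_eq_add_neg]
  exact hA p hp u hu ((h u hu).1 hpu)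

/-- Two regions in the two half-planes meet only at the seeds. -/
theorem smooth_join {B C : Set LatticePoint} (hB : Smooth (B ∪ {p₁, p₂}))
    (hC : Smooth (C ∪ {p₄, p₅})) (hB2 : ∀ x ∈ B, 2 ≤ x.2) (hC2 : ∀ x ∈ C, x.2 ≤ -2) :
    Smooth (seeds ∪ C ∪ B) := by
  intro p hp u hu hpu
  simp only [Set.mem_union, Finset.mem_coe, mem_seeds, not_or] at hp
  obtain ⟨⟨⟨q0, q1, q2, q4, q5⟩, qC⟩, qB⟩ := hp
  rcases lt_trichotomy p.2 0 with h | h | h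
  · refine hC.congr_at (p := p) ?_ ?_ hu hpu
    · simp only [Set.mem_union, Set.mem_insert_iff, Set.mem_singleton_iff, not_or]
      exact ⟨qC, q4, q5⟩
    · intro w hw
      simp only [Set.mem_union, Finset.mem_coe, mem_seeds, Set.mem_insert_iff,
        Set.mem_singleton_iff]
      have b1 : w.2 ≤ 1 := by
        rw [isDir_iff] at hw
        rcases hw with rfl | rfl | rfl | rfl | rfl | rfl <;> decide
      have n1 : p + w ∉ B := fun h' => by have := hB2 _ h'; simp at this; omega
      have n2 : p + w ≠ p₁ := fun h' => by
        have := congrArg Prod.snd h'; simp [p₁] at this; omega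
      have n3 : p + w ≠ p₂ := fun h' => by
        have := congrArg Prod.snd h'; simp [p₂] at this; omega
      have n0 : p + w ≠ 0 := by
        intro h'
        rw [add_eq_zero_iff_eq_neg] at h'
        subst h'
        rw [isDir_iff] at hw
        simp only [Prod.snd_neg] at h
        rcases hw with rfl | rfl | rfl | rfl | rfl | rfl <;>
          first
          | exact absurd h (by decide)
          | exact q4 (by decide)
          | exact q5 (by decide)
      tauto
  · refine smooth_seeds.congr_at (p := p) ?_ ?_ hu hpu
    · simp only [Finset.mem_coe, mem_seeds, not_or]
      exact ⟨q0, q1, q2, q4, q5⟩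
    · intro w hw
      have b1 : w.2 ≤ 1 ∧ -1 ≤ w.2 := by
        rw [isDir_iff] at hw
        rcases hw with rfl | rfl | rfl | rfl | rfl | rfl <;> decide
      have n1 : p + w ∉ B := fun h' => by have := hB2 _ h'; simp at this; omega
      have n2 : p + w ∉ C := fun h' => by have := hC2 _ h'; simp at this; omega
      simp only [Set.mem_union]
      tauto
  · refine hB.congr_at (p := p) ?_ ?_ hu hpu
    · simp only [Set.mem_union, Set.mem_insert_iff, Set.mem_singleton_iff, not_or]
      exact ⟨qB, q1, q2⟩
    · intro w hw
      simp only [Set.mem_union, Finset.mem_coe, mem_seeds, Set.mem_insert_iff,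
        Set.mem_singleton_iff]
      have b1 : -1 ≤ w.2 := by
        rw [isDir_iff] at hw
        rcases hw with rfl | rfl | rfl | rfl | rfl | rfl <;> decide
      have n1 : p + w ∉ C := fun h' => by have := hC2 _ h'; simp at this; omega
      have n2 : p + w ≠ p₄ := fun h' => by
        have := congrArg Prod.snd h'; simp [p₄] at this; omega
      have n3 : p + w ≠ p₅ := fun h' => by
        have := congrArg Prod.snd h'; simp [p₅] at this; omega
      have n0 : p + w ≠ 0 := by
        intro h'
        rw [add_eq_zero_iff_eq_neg] at h'
        subst h'
        rw [isDir_iff] at hw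
        simp only [Prod.snd_neg] at h
        rcases hw with rfl | rfl | rfl | rfl | rfl | rfl <;>
          first
          | exact absurd h (by decide)
          | exact q1 (by decide)
          | exact q2 (by decide)
      tauto

/-- The boundary of the seeds together with partial assemblies of both regions is one cycle. -/
theorem oneOrbit_join {P P' : Set LatticePoint} (hR : RibbonRegion P {p₁, p₂})
    (hR' : RibbonRegion P' {p₄, p₅}) (hP : ∀ x ∈ P, 2 ≤ x.2) (hP' : ∀ x ∈ P', x.2 ≤ -2)
    {B C : Finset LatticePoint} (hB : FrontClosed P B) (hC : FrontClosed P' C) :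
    Smooth ((seeds : Set LatticePoint) ∪ C ∪ B) ∧
      OneOrbit ((seeds : Set LatticePoint) ∪ C ∪ B) := by
  have hsm : ∀ {B C : Finset LatticePoint}, FrontClosed P B → FrontClosed P' C →
      Smooth ((seeds : Set LatticePoint) ∪ C ∪ B) := fun {B C} hB hC =>
    smooth_join (hR.smooth_of_frontClosed hB) (hR'.smooth_of_frontClosed hC)
      (fun x hx => hP x (hB.subset hx)) (fun x hx => hP' x (hC.subset hx))
  refine ⟨hsm hB hC, ?_⟩
  have hempty : FrontClosed P (∅ : Finset LatticePoint) :=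
    ⟨by simp, by simp, by simp, by simp⟩
  have hempty' : FrontClosed P' (∅ : Finset LatticePoint) :=
    ⟨by simp, by simp, by simp, by simp⟩
  have hseed : ∀ x ∈ seeds, -1 ≤ x.2 ∧ x.2 ≤ 1 := by decide
  have h1 : OneOrbit ((seeds : Set LatticePoint) ∪ C ∪ (∅ : Finset LatticePoint)) := by
    refine hR'.frontClosed_induction
      (motive := fun C => OneOrbit ((seeds : Set LatticePoint) ∪ C ∪ (∅ : Finset LatticePoint)))
      ?_ ?_ C hC
    · simpa using oneOrbit_seeds
    · intro C x c hxC hC hC' hxP hxc hc ih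
      have e : (seeds : Set LatticePoint) ∪ (insert x C : Finset LatticePoint) ∪
          (∅ : Finset LatticePoint) =
          insert x ((seeds : Set LatticePoint) ∪ C ∪ (∅ : Finset LatticePoint)) := by
        ext z; simp
      have hs' := hsm hempty hC'
      rw [e] at hs' ⊢
      obtain ⟨u, hu, rfl⟩ := exists_dir_of_adj hxc
      refine ih.insert (hsm hempty hC) ⟨?_, u, hu, ?_⟩ hs'
      · have := hP' x hxP
        simp only [Finset.coe_empty, Set.union_empty, Set.mem_union, Finset.mem_coe, not_or]
        exact ⟨fun h => by have := (hseed x h).1; omega, hxC⟩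
      · rcases hc with hc | hc
        · exact Or.inl (Or.inr hc)
        · refine Or.inl (Or.inl ?_)
          rw [Finset.mem_coe, mem_seeds]
          rcases hc with hc | hc
          · exact Or.inr (Or.inr (Or.inr (Or.inl hc)))
          · exact Or.inr (Or.inr (Or.inr (Or.inr hc)))
  refine hR.frontClosed_induction
    (motive := fun B => OneOrbit ((seeds : Set LatticePoint) ∪ C ∪ B)) h1 ?_ B hB
  intro B x c hxB hB hB' hxP hxc hc ih
  have e : (seeds : Set LatticePoint) ∪ C ∪ (insert x B : Finset LatticePoint) =
      insert x ((seeds : Set LatticePoint) ∪ C ∪ B) := by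
    ext z; simp
  have hs' := hsm hB' hC
  rw [e] at hs' ⊢
  obtain ⟨u, hu, rfl⟩ := exists_dir_of_adj hxc
  refine ih.insert (hsm hB hC) ⟨?_, u, hu, ?_⟩ hs'
  · have h2 := hP x hxP
    simp only [Set.mem_union, Finset.mem_coe, not_or]
    refine ⟨⟨fun h => by have := (hseed x h).2; omega, fun h => ?_⟩, hxB⟩
    have := hP' x (hC.subset h)
    omega
  · rcases hc with hc | hc
    · exact Or.inr hc
    · refine Or.inl (Or.inl ?_)
      rw [Finset.mem_coe, mem_seeds]
      rcases hc with hc | hc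
      · exact Or.inr (Or.inl hc)
      · exact Or.inr (Or.inr (Or.inl hc))

/-! ### Localization -/

/-- `B` consists of complete ribbons of `P`, together with all their ancestors. -/
structure RibbonClosed (P B : Set LatticePoint) : Prop where
  subset : B ⊆ P
  lower : ∀ y ∈ B, ∀ z ∈ P, LowerNbr P y z → z ∈ B
  level : ∀ y ∈ B, ∀ z ∈ P, lattice.Adj y z → hop P z = hop P y → z ∈ B

namespace RibbonRegion

variable {P pair : Set LatticePoint}

theorem pair_subset_seeds (hR : RibbonRegion P pair) {c : LatticePoint} (hc : c ∈ pair) :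
    c ∈ seeds := by
  rcases hR.pair_eq with h | h <;> rw [h] at hc <;> rcases hc with rfl | rfl <;> decide

/-- Each point of a union of complete ribbons forms a noncollinear triple with a neighbour on its
ribbon and a neighbour on the parent ribbon. -/
theorem exists_triple (hR : RibbonRegion P pair) {B : Set LatticePoint} (hB : RibbonClosed P B)
    {c : LatticePoint} (hc : c ∈ B ∪ pair) : ∃ u v, IsDir u ∧ IsDir v ∧ v ≠ u ∧ v ≠ -u ∧
      (c + u ∈ B ∪ seeds ∧ hop P (c + u) ≤ hop P c) ∧
      (c + v ∈ B ∪ seeds ∧ hop P (c + v) ≤ hop P c) := by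
  rcases hc with hc | hc
  · have hcP := hB.subset hc
    have h2 := hR.two_le_hop c hcP
    obtain ⟨y, hy, hcy, hyc⟩ := hR.wide c hcP
    obtain ⟨z, hz⟩ := hR.exists_lower hcP
    have hzm : z ∈ B ∪ seeds := (hR.lower_mem hcP hz).elim
      (fun h => Or.inl (hB.lower c hc z h hz)) (fun h => Or.inr (hR.pair_subset_seeds h))
    have hym := hB.level c hc y hy hcy hyc
    obtain ⟨hz1, hz2⟩ := hz
    obtain ⟨u, hu, rfl⟩ := exists_dir_of_adj hcy
    obtain ⟨v, hv, rfl⟩ := exists_dir_of_adj hz1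
    refine ⟨u, v, hu, hv, ?_, ?_, ⟨Or.inl hym, hyc.le⟩, ⟨hzm, by omega⟩⟩
    · rintro rfl; omega
    · rintro rfl
      have hs := hR.shared (hop P c) (by omega) c (u - rot u) hu.sub_rot rfl
        (by rw [rot_sub, rot_rot, sub_sub_cancel]; exact hyc)
      rw [rot_sub, rot_rot, sub_sub_cancel, sub_sub_cancel] at hs
      have hd := dir_distinct hu
      rcases hs with hs | hs
      · have := hR.clique' hcP hu.neg hu.sub_rot hz2 hs
        rw [rot_neg, rot_sub, rot_rot, sub_sub_cancel] at this
        rcases this with h | h | h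
        · exact hd.2.2.2.2.2.2.2.2.2.2.2.2.2.1 h
        · exact hd.2.2.2.2.2.2.2.2.2.2.2.2.2.2 h
        · exact hd.2.2.2.1 h
      · have := hR.clique' hcP hu.neg hu.rot hz2 hs
        rw [rot_neg, rot_rot] at this
        rcases this with h | h | h
        · exact hd.2.2.2.2.1 h.symm
        · exact hd.2.2.2.2.2.2.2.1 h.symm
        · exact hd.2.2.2.2.2.1 h
  · have h1 := hR.pair_hop hc
    have h0 := hop_zero P
    have key : ∀ u, c + u ∈ pair → c + u ∈ B ∪ seeds ∧ hop P (c + u) ≤ hop P c :=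
      fun u hu => ⟨Or.inr (hR.pair_subset_seeds hu), by rw [hR.pair_hop hu, h1]⟩
    have key' : c + -c ∈ B ∪ seeds ∧ hop P (c + -c) ≤ hop P c := by
      rw [add_neg_cancel, h0, h1]
      exact ⟨Or.inr (by decide), by norm_num⟩
    rcases hR.pair_eq with h | h
    · rw [h] at hc
      rcases hc with rfl | rfl
      · exact ⟨(1, 0), -p₁, by simp [IsDir], by simp [IsDir, p₁], by decide, by decide,
          key _ (h ▸ by decide), key'⟩
      · exact ⟨(-1, 0), -p₂, by simp [IsDir], by simp [IsDir, p₂], by decide, by decide,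
          key _ (h ▸ by decide), key'⟩
    · rw [h] at hc
      rcases hc with rfl | rfl
      · exact ⟨(-1, 0), -p₄, by simp [IsDir], by simp [IsDir, p₄], by decide, by decide,
          key _ (h ▸ by decide), key'⟩
      · exact ⟨(1, 0), -p₅, by simp [IsDir], by simp [IsDir, p₅], by decide, by decide,
          key _ (h ▸ by decide), key'⟩

/-- All robots on complete ribbons are localizable, by induction on the hop count: a robot at `x`
sees the triple that `exists_triple` gives for a lower neighbour of `x`. -/
theorem localizable (hR : RibbonRegion P pair) {r : ℝ} (hr : 0 < r) {B : Set LatticePoint}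
    (hB : RibbonClosed P B) {I : Multiset LatticePoint} {M : ℕ} {a b : Fin M → LatticePoint}
    {n : ℕ} (hseeds : ∀ x ∈ seeds, x ∈ config I a b n) (hBc : ∀ x ∈ B, x ∈ config I a b n)
    {x : LatticePoint} (hx : x ∈ B ∪ seeds) : Localizable r I a b n x := by
  have hBs : ∀ x ∈ B ∪ seeds, x ∈ config I a b n := fun x hx => hx.elim (hBc x) (hseeds x)
  obtain ⟨m, hm⟩ : ∃ m : ℕ, hop P x ≤ m := ⟨(hop P x).toNat, Int.self_le_toNat _⟩
  induction m generalizing x with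
  | zero =>
    rcases hx with hx | hx
    · have := hR.two_le_hop x (hB.subset hx)
      push_cast at hm; omega
    · exact .seed n x hx
  | succ m ih =>
    rcases hx with hx | hx
    · have hxP := hB.subset hx
      have h2 := hR.two_le_hop x hxP
      obtain ⟨c, hc⟩ := hR.exists_lower hxP
      have hcB : c ∈ B ∪ pair := (hR.lower_mem hxP hc).elim
        (fun h => Or.inl (hB.lower x hx c h hc)) Or.inr
      have hcm : c ∈ B ∪ seeds := hcB.elim Or.inl (fun h => Or.inr (hR.pair_subset_seeds h))
      obtain ⟨u, v, hu, hv, hvu, hvu', ⟨m1, l1⟩, ⟨m2, l2⟩⟩ := hR.exists_triple hB hcB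
      obtain ⟨t1, t2⟩ := trilateration_triple hr hc.1 hu hv hvu hvu'
      have hcx := hc.2
      push_cast at hm
      have hall : ∀ i, (![c, c + u, c + v] i) ∈ B ∪ seeds ∧
          hop P (![c, c + u, c + v] i) ≤ hop P c := by
        intro i
        fin_cases i
        · exact ⟨hcm, le_rfl⟩
        · exact ⟨m1, l1⟩
        · exact ⟨m2, l2⟩
      refine .trilaterate n x ![c, c + u, c + v] (hBc x hx) (fun i => hBs _ (hall i).1) ?_ ?_ t1 t2
      · intro i h
        have := (hall i).2
        rw [h] at this
        omega
      · intro i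
        have := (hall i).2
        exact ih (hall i).1 (by omega)
    · exact .seed n x hx

/-- A robot next to a complete ribbon, or next to the attaching seeds, can localize itself. -/
theorem canLocalizeAt (hR : RibbonRegion P pair) {r : ℝ} (hr : 0 < r) {B : Set LatticePoint}
    (hB : RibbonClosed P B) {I : Multiset LatticePoint} {M : ℕ} {a b : Fin M → LatticePoint}
    {n : Fin M} (hseeds : ∀ x ∈ seeds, x ∈ stationary I a b n)
    (hBc : ∀ x ∈ B, x ∈ stationary I a b n) {p c : LatticePoint} (hpc : lattice.Adj p c)
    (hc : c ∈ B ∪ pair) : CanLocalizeAt r I a b n p := by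
  have hle : ∀ {x}, x ∈ stationary I a b n → x ∈ config I a b n :=
    fun h => Multiset.mem_of_le (Multiset.sub_le_self _ _) h
  have hcm : c ∈ B ∪ seeds := hc.elim Or.inl (fun h => Or.inr (hR.pair_subset_seeds h))
  obtain ⟨u, v, hu, hv, hvu, hvu', ⟨m1, -⟩, ⟨m2, -⟩⟩ := hR.exists_triple hB hc
  obtain ⟨t1, t2⟩ := trilateration_triple hr hpc hu hv hvu hvu'
  have hall : ∀ i, (![c, c + u, c + v] i) ∈ B ∪ seeds := by
    intro i
    fin_cases i
    · exact hcm
    · exact m1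
    · exact m2
  refine ⟨![c, c + u, c + v], fun i => ⟨(hall i).elim (hBc _) (hseeds _), ?_, t1 i⟩, t2⟩
  exact hR.localizable hr hB (fun x hx => hle (hseeds x hx)) (fun x hx => hle (hBc x hx)) (hall i)

end RibbonRegion

/-! ### Escaping from the neighbourhood of the origin -/

theorem mem_hub_coord {x : LatticePoint} : x ∈ hub ↔ -1 ≤ x.1 ∧ x.1 ≤ 1 ∧ -1 ≤ x.2 ∧ x.2 ≤ 1 ∧
    -1 ≤ x.1 + x.2 ∧ x.1 + x.2 ≤ 1 := by
  simp only [hub, p₁, p₂, p₃, p₄, p₅, p₆, Set.mem_insert_iff, Set.mem_singleton_iff,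
    Prod.ext_iff, Prod.fst_zero, Prod.snd_zero]
  omega

/-- Above (`ε = 1`) or below (`ε = -1`) the origin, a point outside the hub can move away from it
vertically if there is no obstacle but the hub. -/
theorem exists_escape {T : Set LatticePoint} {ε : ℤ} (hε : ε = 1 ∨ ε = -1)
    (hT : ∀ x ∈ T, -1 ≤ ε * x.2 → x ∈ hub) {z : LatticePoint} (hz : z ∉ hub)
    (hz2 : -1 ≤ ε * z.2) (M : ℤ) :
    ∃ z', Relation.ReflTransGen (fun a b => lattice.Adj a b ∧ a ∉ T ∧ b ∉ T) z z' ∧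
      M ≤ |z'.2| := by
  have step : ∀ {a b : LatticePoint}, IsDir (b - a) → -1 ≤ ε * a.2 → -1 ≤ ε * b.2 → a ∉ hub →
      b ∉ hub → lattice.Adj a b ∧ a ∉ T ∧ b ∉ T := fun hd h1 h2 h3 h4 =>
    ⟨(adj_iff _ _).2 hd, fun h => h3 (hT _ h h1), fun h => h4 (hT _ h h2)⟩
  have up : ∀ n : ℕ, ∀ z : LatticePoint, z ∉ hub → 0 ≤ ε * z.2 →
      Relation.ReflTransGen (fun a b => lattice.Adj a b ∧ a ∉ T ∧ b ∉ T) z (z + (0, ε * n)) := by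
    intro n
    induction n with
    | zero =>
      intro z _ _
      have e : z + (0, ε * ((0 : ℕ) : ℤ)) = z := by ext <;> simp
      rw [e]
    | succ n ih =>
      intro z hz hz2
      refine (ih z hz hz2).tail (step ?_ ?_ ?_ ?_ ?_)
      · rcases hε with rfl | rfl <;> simp [IsDir]
      · rcases hε with rfl | rfl <;> simp at hz2 ⊢ <;> omega
      · rcases hε with rfl | rfl <;> simp at hz2 ⊢ <;> omega
      · rw [mem_hub_coord] at hz ⊢
        rcases hε with rfl | rfl <;> simp at hz hz2 ⊢ <;> omega
      · rw [mem_hub_coord] at hz ⊢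
        rcases hε with rfl | rfl <;> simp at hz hz2 ⊢ <;> omega
  obtain ⟨y, hzy, hy, hy2⟩ : ∃ y, Relation.ReflTransGen
      (fun a b => lattice.Adj a b ∧ a ∉ T ∧ b ∉ T) z y ∧ y ∉ hub ∧ 0 ≤ ε * y.2 := by
    by_cases h0 : 0 ≤ ε * z.2
    · exact ⟨z, .refl, hz, h0⟩
    · by_cases h1 : 0 < ε * z.1
      · have hy : z + (0, ε) ∉ hub := by
          rw [mem_hub_coord] at hz ⊢
          rcases hε with rfl | rfl <;> simp at hz hz2 h0 h1 ⊢ <;> omega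
        have hy2 : 0 ≤ ε * (z + (0, ε)).2 := by
          rcases hε with rfl | rfl <;> simp at hz2 ⊢ <;> omega
        refine ⟨_, .single (step ?_ hz2 (by omega) hz hy), hy, hy2⟩
        rcases hε with rfl | rfl <;> simp [IsDir]
      · have hy : z + (-ε, ε) ∉ hub := by
          rw [mem_hub_coord] at hz ⊢
          rcases hε with rfl | rfl <;> simp at hz hz2 h0 h1 ⊢ <;> omega
        have hy2 : 0 ≤ ε * (z + (-ε, ε)).2 := by
          rcases hε with rfl | rfl <;> simp at hz2 ⊢ <;> omega
        refine ⟨_, .single (step ?_ hz2 (by omega) hz hy), hy, hy2⟩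
        rcases hε with rfl | rfl <;> simp [IsDir]
  refine ⟨_, hzy.trans (up M.toNat y hy hy2), ?_⟩
  have := Int.self_le_toNat M
  rw [le_abs]
  rcases hε with rfl | rfl <;> simp at hy2 ⊢ <;> omega

/-! ### The idle half-plane -/

/-- The hop count of a point of the idle half-plane. -/
def idleHop (x : LatticePoint) : ℤ := max (max (-x.2) (-(x.1 + x.2))) x.1

/-- A coordinate along the idle ribbons. It decreases by one along each arc, so it is smallest at
the first vertex: on the lower side of a layer it is the first coordinate, which is continued around
the corner of the layer. -/
def idleIndex (x : LatticePoint) : ℤ := x.1 + if x.1 = idleHop x then x.2 + idleHop x else 0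

/-- None of the three linear forms in `idleHop` grows by more than one along an edge, so hop counts
dominate them. -/
theorem coord_le_hop {P : Set LatticePoint} (n : ℕ) : ∀ x, hop P x = n →
    -x.2 ≤ n ∧ -(x.1 + x.2) ≤ n ∧ x.1 ≤ n := by
  induction n with
  | zero => intro x hx; rw [eq_zero_of_hop_eq_zero hx]; simp
  | succ n ih =>
    intro x hx
    obtain ⟨-, y, -, hxy, hy⟩ := exists_hop_pred (P := P) (x := x) (by rw [hx]; positivity)
    obtain ⟨u, hu, rfl⟩ := exists_dir_of_adj hxy
    have := ih _ (by rw [hy, hx]; push_cast; ring)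
    rw [isDir_iff] at hu
    push_cast
    rcases hu with rfl | rfl | rfl | rfl | rfl | rfl <;> simp at this <;> omega

/-- In the idle half-plane the hop count is the hexagonal norm: from each point a step towards the
seeds decreases it. -/
theorem hop_idleHalf {x : LatticePoint} (hx : x ∈ idleHalf) : hop idleHalf x = idleHop x := by
  have hp : ∀ u : LatticePoint, IsDir u → x + u ∈ hub → x + u ≠ 0 →
      lattice.Adj 0 (x + u) := by
    intro u _ hxu h0
    exact ((mem_hub_iff _).1 hxu).resolve_left h0
  have upper : ∀ n : ℕ, ∀ x ∈ idleHalf, idleHop x ≤ n →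
      0 ≤ hop idleHalf x ∧ hop idleHalf x ≤ idleHop x := by
    intro n
    induction n with
    | zero =>
      intro x hx hn
      simp only [idleHalf, Set.mem_ofPred_eq] at hx
      simp only [idleHop] at hn
      omega
    | succ n ih =>
      intro x hx hn
      obtain ⟨y, hyx, hy, hyh⟩ : ∃ y, IsDir (x - y) ∧ (y ∈ idleHalf ∨ y = p₄ ∨ y = p₅) ∧
          idleHop y = idleHop x - 1 := by
        simp only [idleHalf, Set.mem_ofPred_eq, idleHop, p₄, p₅, Prod.ext_iff] at hx ⊢
        by_cases h1 : -x.2 < x.1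
        · refine ⟨x + (-1, 0), ?_, ?_, ?_⟩
          · rw [sub_add_cancel_left]; simp [IsDir]
          · simp; omega
          · simp; omega
        by_cases h2 : x.1 < 0
        · refine ⟨x + (1, 0), ?_, ?_, ?_⟩
          · rw [sub_add_cancel_left]; simp [IsDir]
          · simp; omega
          · simp; omega
        by_cases h3 : x.1 = -x.2
        · refine ⟨x + (-1, 1), ?_, ?_, ?_⟩
          · rw [sub_add_cancel_left]; simp [IsDir]
          · simp; omega
          · simp; omega
        · refine ⟨x + (0, 1), ?_, ?_, ?_⟩
          · rw [sub_add_cancel_left]; simp [IsDir]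
          · simp; omega
          · simp; omega
      have hyx' := (adj_iff _ _).2 hyx
      have hyhop : 0 ≤ hop idleHalf y ∧ hop idleHalf y ≤ idleHop y := by
        rcases hy with hy | rfl | rfl
        · exact ih y hy (by push_cast at hn; omega)
        · rw [hop_eq_one_iff.2 (by rw [adj_iff]; simp [IsDir, p₄])]; decide
        · rw [hop_eq_one_iff.2 (by rw [adj_iff]; simp [IsDir, p₅])]; decide
      have := hop_adj hyhop.1 (mem_of_hop_nonneg hyhop.1) (Or.inl hx) hyx'
      omega
  obtain ⟨h0, h1⟩ := upper (idleHop x).toNat x hx (Int.self_le_toNat _)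
  obtain ⟨n, hn⟩ := Int.eq_ofNat_of_zero_le h0
  have := coord_le_hop n x hn
  simp only [idleHop] at h1 ⊢
  omega

/-- The neighbours of idle points with a hop count are idle points or the two lower seeds. -/
theorem idle_lower {x c : LatticePoint} (hx : x ∈ idleHalf) (hxc : lattice.Adj x c)
    (hc : 0 ≤ hop idleHalf c) :
    (c ∈ idleHalf ∨ c = p₄ ∨ c = p₅) ∧ hop idleHalf c = idleHop c := by
  rcases mem_of_hop_nonneg hc with h | h
  · exact ⟨Or.inl h, hop_idleHalf h⟩
  · have hcp : c = p₄ ∨ c = p₅ := by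
      obtain ⟨u, hu, rfl⟩ := exists_dir_of_adj hxc
      rw [mem_hub_coord] at h
      rw [isDir_iff] at hu
      simp only [idleHalf, Set.mem_ofPred_eq, p₄, p₅, Prod.ext_iff] at hx ⊢
      rcases hu with rfl | rfl | rfl | rfl | rfl | rfl <;> simp at h ⊢ <;> omega
    refine ⟨Or.inr hcp, ?_⟩
    rcases hcp with rfl | rfl
    · rw [hop_eq_one_iff.2 (by rw [adj_iff]; simp [IsDir, p₄])]; decide
    · rw [hop_eq_one_iff.2 (by rw [adj_iff]; simp [IsDir, p₅])]; decide

theorem idleIndex_of_arc {x y : LatticePoint} (h : RibbonArc idleHalf x y) :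
    idleIndex y = idleIndex x - 1 := by
  obtain ⟨hx, hy, hxy, u, hu, hux, rfl⟩ := ribbonArc_iff.1 h
  have h2 : 2 ≤ idleHop x := by
    simp only [idleHalf, Set.mem_ofPred_eq] at hx
    simp only [idleHop]; omega
  rw [hop_idleHalf hx] at hux hxy
  obtain ⟨-, hl⟩ := idle_lower hx (adj_add hu) (by omega)
  rw [hop_idleHalf hy] at hxy
  rw [hl] at hux
  simp only [idleIndex, hxy]
  simp only [idleHop, idleHalf, Set.mem_ofPred_eq] at *
  rw [isDir_iff] at hu
  rcases hu with rfl | rfl | rfl | rfl | rfl | rfl <;> simp [rot] at * <;> split_ifs <;> omega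

theorem idle_eq_of_index {x y : LatticePoint} (hx : x ∈ idleHalf) (hy : y ∈ idleHalf)
    (h : idleHop x = idleHop y) (h' : idleIndex x = idleIndex y) : x = y := by
  simp only [idleIndex, idleHop, idleHalf, Set.mem_ofPred_eq] at *
  ext <;> split_ifs at h' <;> omega

theorem le_idleIndex {x : LatticePoint} (hx : x ∈ idleHalf) : 2 - idleHop x ≤ idleIndex x := by
  simp only [idleHalf, Set.mem_ofPred_eq] at hx
  simp only [idleIndex, idleHop]
  split_ifs <;> omega

/-- An idle point that is not the first of its layer has a successor. -/
theorem exists_idle_arc {x y : LatticePoint} (hx : x ∈ idleHalf) (hy : y ∈ idleHalf)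
    (h : idleHop x = idleHop y) (h' : idleIndex y < idleIndex x) :
    ∃ z, RibbonArc idleHalf x z := by
  have key : ∀ u, IsDir u → x + rot u ∈ idleHalf → (x + u ∈ idleHalf ∨ x + u = p₄ ∨ x + u = p₅) →
      idleHop (x + rot u) = idleHop x → idleHop (x + u) = idleHop x - 1 →
      ∃ z, RibbonArc idleHalf x z := by
    intro u hu h1 h2 h3 h4
    refine ⟨_, ribbonArc_iff.2 ⟨hx, h1, ?_, u, hu, ?_, rfl⟩⟩
    · rw [hop_idleHalf hx, hop_idleHalf h1, h3]
    · rw [hop_idleHalf hx, ← h4]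
      rcases h2 with h2 | h2 | h2
      · exact hop_idleHalf h2
      · rw [h2, hop_eq_one_iff.2 (by rw [adj_iff]; simp [IsDir, p₄])]; decide
      · rw [h2, hop_eq_one_iff.2 (by rw [adj_iff]; simp [IsDir, p₅])]; decide
  have hy' := le_idleIndex hy
  have hx' : x.2 ≤ -2 := hx
  have hb : x.1 ≤ 0 → x.2 ≤ -3 := by
    intro ha
    by_contra hb
    have h1 : idleHop x = 2 - x.1 := by simp only [idleHop]; omega
    have h2 : idleIndex x = x.1 := by
      rw [idleIndex, if_neg (by omega)]; simp
    omega
  clear h h' hy hy'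
  simp only [idleHop, idleHalf, Set.mem_ofPred_eq, rot, p₄, p₅, Prod.ext_iff, Prod.fst_add,
    Prod.snd_add] at key
  by_cases h1 : -x.2 < x.1
  · refine key (-1, 0) (by simp [IsDir]) ?_ ?_ ?_ ?_ <;> dsimp only <;> omega
  by_cases h2 : 0 < x.1
  · refine key (-1, 1) (by simp [IsDir]) ?_ ?_ ?_ ?_ <;> dsimp only <;> omega
  · refine key (0, 1) (by simp [IsDir]) ?_ ?_ ?_ ?_ <;> dsimp only <;> omega

theorem idle_index_lt_of_ribbonLT {x y : LatticePoint} (h : RibbonLT idleHalf y x) :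
    idleIndex y < idleIndex x := by
  induction h with
  | single h => rw [idleIndex_of_arc h]; omega
  | tail _ h ih => rw [idleIndex_of_arc h]; omega

theorem idle_ribbonLT_iff {x y : LatticePoint} (hx : x ∈ idleHalf) (hy : y ∈ idleHalf)
    (h : idleHop x = idleHop y) : RibbonLT idleHalf y x ↔ idleIndex y < idleIndex x := by
  refine ⟨idle_index_lt_of_ribbonLT, fun h' => ?_⟩
  obtain ⟨n, hn⟩ : ∃ n : ℕ, idleIndex x = idleIndex y + n + 1 :=
    ⟨(idleIndex x - idleIndex y - 1).toNat, by omega⟩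
  induction n generalizing x with
  | zero =>
    obtain ⟨z, hz⟩ := exists_idle_arc hx hy h h'
    have hzm := ribbonArc_iff.1 hz
    have hzh := hzm.2.2.1
    rw [hop_idleHalf hx, hop_idleHalf hzm.2.1] at hzh
    have := idle_eq_of_index hzm.2.1 hy (hzh.trans h) (by rw [idleIndex_of_arc hz]; omega)
    exact .single (this ▸ hz)
  | succ n ih =>
    obtain ⟨z, hz⟩ := exists_idle_arc hx hy h h'
    have hzm := ribbonArc_iff.1 hz
    have hzh := hzm.2.2.1
    have hzi := idleIndex_of_arc hz
    rw [hop_idleHalf hx, hop_idleHalf hzm.2.1] at hzh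
    exact .head hz (ih hzm.2.1 (hzh.trans h) (by omega) (by push_cast at hn; omega))

/-- All points of the idle half-plane with a given hop count form one ribbon. -/
theorem idle_sameRibbon_iff {x y : LatticePoint} (hx : x ∈ idleHalf) (hy : y ∈ idleHalf) :
    SameRibbon idleHalf x y ↔ idleHop x = idleHop y := by
  constructor
  · intro h
    have := h.hop_eq
    rw [hop_idleHalf hx, hop_idleHalf hy] at this
    exact this.symm
  · intro h
    rcases lt_trichotomy (idleIndex x) (idleIndex y) with h' | h' | h'
    · exact ((idle_ribbonLT_iff hy hx h.symm).2 h').sameRibbon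
    · rw [idle_eq_of_index hx hy h h']; exact SimpleGraph.Reachable.refl _
    · exact ((idle_ribbonLT_iff hx hy h).2 h').sameRibbon.symm

theorem idle_two_le {x : LatticePoint} (hx : x ∈ idleHalf) : 2 ≤ idleHop x := by
  simp only [idleHalf, Set.mem_ofPred_eq] at hx
  simp only [idleHop]; omega

theorem idle_ribbonRegion : RibbonRegion idleHalf {p₄, p₅} := by
  have hT : OpenOutside (idleHalf ∪ hub) := by
    intro z hz M
    rw [Set.mem_union, not_or] at hz
    have h1 := hz.1
    simp only [idleHalf, Set.mem_ofPred_eq] at h1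
    refine exists_escape (ε := 1) (Or.inl rfl) ?_ hz.2 (by omega) M
    rintro x (hx | hx) h
    · simp only [idleHalf, Set.mem_ofPred_eq] at hx; omega
    · exact hx
  have hk : ∀ k : ℤ, 1 ≤ k → LowerClique idleHalf k ∧ SharedLower idleHalf k := by
    intro k hk
    have := lowerClique_and_sharedLower hT (k - 1).toNat
    rwa [Int.toNat_of_nonneg (by omega), sub_add_cancel] at this
  refine ⟨?_, fun k h => (hk k h).1, fun k h => (hk k h).2, ?_, Or.inr rfl, ?_, ?_, ?_⟩
  · intro x hx
    rw [hop_idleHalf hx]; exact idle_two_le hx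
  · intro x hx c hxc hc
    obtain ⟨h1, h2⟩ := idle_lower hx hxc (by omega)
    rcases h1 with h1 | h1
    · have := idle_two_le h1; omega
    · exact h1
  · intro p hp u hu hpu
    rw [isDir_iff] at hu
    simp only [Set.mem_union, idleHalf, Set.mem_ofPred_eq, Set.mem_insert_iff, p₄, p₅,
      Set.mem_singleton_iff, Prod.ext_iff (x := p), Prod.ext_iff (x := _ + _),
      Prod.ext_iff (x := _ - _)] at hp hpu ⊢
    rcases hu with rfl | rfl | rfl | rfl | rfl | rfl <;> simp [rot] at hp hpu ⊢ <;> omega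
  · intro x hx
    have h2 := idle_two_le hx
    have key : ∀ u, IsDir u → x + u ∈ idleHalf → idleHop (x + u) = idleHop x →
        ∃ y ∈ idleHalf, lattice.Adj x y ∧ hop idleHalf y = hop idleHalf x := by
      intro u hu h1 h2
      exact ⟨x + u, h1, adj_add hu, by rw [hop_idleHalf h1, hop_idleHalf hx, h2]⟩
    have hx' : x.2 ≤ -2 := hx
    clear h2 hx hT hk
    simp only [idleHop, idleHalf, Set.mem_ofPred_eq, Prod.fst_add, Prod.snd_add] at key
    by_cases h1 : x.1 < 0
    · refine key (1, -1) (by simp [IsDir]) ?_ ?_ <;> dsimp only <;> omega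
    by_cases h3 : -x.2 ≤ x.1
    · by_cases h4 : x.1 = -x.2
      · refine key (-1, 0) (by simp [IsDir]) ?_ ?_ <;> dsimp only <;> omega
      · refine key (0, -1) (by simp [IsDir]) ?_ ?_ <;> dsimp only <;> omega
    · refine key (1, 0) (by simp [IsDir]) ?_ ?_ <;> dsimp only <;> omega
  · intro x _ h
    have := idle_index_lt_of_ribbonLT h
    omega

theorem TreeLT.hop_lt {P Q R : Set LatticePoint} (h : TreeLT P Q R) :
    ∀ x ∈ Q, ∀ y ∈ R, hop P x < hop P y := by
  induction h with
  | single h =>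
    intro x hx y hy
    obtain ⟨-, -, ⟨k, h1, h2⟩, -⟩ := h
    rw [h1 x hx, h2 y hy]; omega
  | tail _ h ih =>
    intro x hx y hy
    obtain ⟨hQ, -, ⟨k, h1, h2⟩, h3⟩ := h
    obtain ⟨z, hz, -⟩ := h3 y hy
    have := ih x hx z hz
    rw [h1 z hz] at this
    rw [h2 y hy]; omega

theorem idle_treeLT_iff {x y : LatticePoint} (hx : x ∈ idleHalf) (hy : y ∈ idleHalf) :
    TreeLT idleHalf (ribbonOf idleHalf x) (ribbonOf idleHalf y) ↔ idleHop x < idleHop y := by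
  constructor
  · intro h
    have := h.hop_lt x (mem_ribbonOf_self hx) y (mem_ribbonOf_self hy)
    rwa [hop_idleHalf hx, hop_idleHalf hy] at this
  · intro h
    obtain ⟨n, hn⟩ : ∃ n : ℕ, idleHop y = idleHop x + n + 1 :=
      ⟨(idleHop y - idleHop x - 1).toNat, by omega⟩
    have h2 := idle_two_le hx
    induction n generalizing y with
    | zero =>
      obtain ⟨c, hc⟩ := idle_ribbonRegion.exists_lower hy
      have hch := hc.2
      rw [hop_idleHalf hy] at hch
      have hcm : c ∈ idleHalf := mem_of_two_le_hop (by omega)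
      rw [hop_idleHalf hcm] at hch
      have := idle_ribbonRegion.isParentRibbon hy hcm hc
      rw [(ribbonOf_eq_iff hx).2 ((idle_sameRibbon_iff hcm hx).2 (by omega))] at this
      exact .single this
    | succ n ih =>
      obtain ⟨c, hc⟩ := idle_ribbonRegion.exists_lower hy
      have hch := hc.2
      rw [hop_idleHalf hy] at hch
      have hcm : c ∈ idleHalf := mem_of_two_le_hop (by omega)
      rw [hop_idleHalf hcm] at hch
      push_cast at hn
      exact .tail (ih hcm (by omega) (by omega)) (idle_ribbonRegion.isParentRibbon hy hcm hc)

/-- The order of the idle points: by layers, and from the front within a layer. -/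
def IdleLT (x y : LatticePoint) : Prop :=
  idleHop x < idleHop y ∨ (idleHop x = idleHop y ∧ idleIndex x < idleIndex y)

theorem IdleLT.trans {x y z : LatticePoint} (h : IdleLT x y) (h' : IdleLT y z) : IdleLT x z := by
  unfold IdleLT at *; omega

theorem IdleLT.irrefl (x : LatticePoint) : ¬ IdleLT x x := by
  unfold IdleLT; omega

theorem IdleLT.total {x y : LatticePoint} (hx : x ∈ idleHalf) (hy : y ∈ idleHalf) (h : x ≠ y) :
    IdleLT x y ∨ IdleLT y x := by
  by_contra hn
  unfold IdleLT at hn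
  exact h (idle_eq_of_index hx hy (by omega) (by omega))

theorem ribbonLex_idle_iff {x y : LatticePoint} (hx : x ∈ idleHalf) (hy : y ∈ idleHalf) :
    RibbonLex idleHalf (TreeLT idleHalf) (RibbonLT idleHalf) x y ↔ IdleLT x y := by
  unfold RibbonLex IdleLT
  rw [idle_treeLT_iff hx hy, ribbonOf_eq_iff hy, idle_sameRibbon_iff hx hy]
  exact or_congr_right (and_congr_right fun h => idle_ribbonLT_iff hy hx h.symm)

theorem ribbonLex_idle_rev_iff {x y : LatticePoint} (hx : x ∈ idleHalf) (hy : y ∈ idleHalf) :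
    RibbonLex idleHalf (fun Q R => TreeLT idleHalf R Q) (fun x y => RibbonLT idleHalf y x) x y ↔
      IdleLT y x := by
  unfold RibbonLex IdleLT
  beta_reduce
  rw [idle_treeLT_iff hy hx, ribbonOf_eq_iff hy, idle_sameRibbon_iff hx hy, @eq_comm _ (idleHop x)]
  exact or_congr_right (and_congr_right fun h => idle_ribbonLT_iff hx hy h.symm)

/-- The idle robots fill complete layers. -/
theorem IdlePlacement.mem_of_le {J : Finset LatticePoint} (hJ : IdlePlacement J)
    {x y : LatticePoint} (hy : y ∈ J) (hx : x ∈ idleHalf) (h : idleHop x ≤ idleHop y) : x ∈ J := by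
  have hyI := hJ.subset y hy
  have hfill : ∀ z ∈ ribbonOf idleHalf y, z ∈ J :=
    (hJ.empty_or_filled _ (ribbonOf_mem_ribbons hyI)).resolve_left
      (fun h => h y (mem_ribbonOf_self hyI) hy)
  rcases h.eq_or_lt with h | h
  · exact hfill x ⟨hx, (idle_sameRibbon_iff hyI hx).2 h.symm⟩
  · refine hJ.filled_closer _ (ribbonOf_mem_ribbons hyI) _ (ribbonOf_mem_ribbons hx)
      (idleHop y) (idleHop x) ?_ ?_ h hfill x (mem_ribbonOf_self hx)
    · intro z hz; rw [SameRibbon.hop_eq hz.2, hop_idleHalf hyI]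
    · intro z hz; rw [SameRibbon.hop_eq hz.2, hop_idleHalf hx]

/-- An initial segment of the idle points is a partial assembly. -/
theorem frontClosed_idle {B : Set LatticePoint} (hB : B ⊆ idleHalf)
    (h : ∀ y ∈ B, ∀ x ∈ idleHalf, IdleLT x y → x ∈ B) : FrontClosed idleHalf B := by
  have hop_low : ∀ y ∈ idleHalf, ∀ z ∈ idleHalf, LowerNbr idleHalf y z →
      idleHop z = idleHop y - 1 := by
    intro y hy z hz hl
    have := hl.2
    rwa [hop_idleHalf hy, hop_idleHalf hz] at this
  have hop_arc : ∀ {y z}, RibbonArc idleHalf y z → y ∈ idleHalf ∧ z ∈ idleHalf ∧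
      idleHop z = idleHop y := by
    intro y z hl
    obtain ⟨h1, h2, h3, -⟩ := ribbonArc_iff.1 hl
    rw [hop_idleHalf h1, hop_idleHalf h2] at h3
    exact ⟨h1, h2, h3⟩
  refine ⟨hB, ?_, ?_, ?_⟩
  · intro y hy z hz hl
    have := hop_low y (hB hy) z hz hl
    exact h y hy z hz (Or.inl (by omega))
  · intro y hy z hl
    obtain ⟨-, hz, hh⟩ := hop_arc hl
    have := idleIndex_of_arc hl
    exact h y hy z hz (Or.inr ⟨hh, by omega⟩)
  · intro y hy p hl z hz hpz
    obtain ⟨hp, -, hh⟩ := hop_arc hl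
    have := hop_low p hp z hz hpz
    exact h y hy z hz (Or.inl (by omega))

/-- The idle points with hop count less than `k` are complete ribbons. -/
theorem ribbonClosed_idle (k : ℤ) : RibbonClosed idleHalf {x | x ∈ idleHalf ∧ idleHop x < k} := by
  refine ⟨fun x hx => hx.1, ?_, ?_⟩
  · intro y hy z hz hl
    have := hl.2
    rw [hop_idleHalf hy.1, hop_idleHalf hz] at this
    exact ⟨hz, by have := hy.2; omega⟩
  · intro y hy z hz _ hl
    rw [hop_idleHalf hy.1, hop_idleHalf hz] at hl
    exact ⟨hz, by have := hy.2; omega⟩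

/-! ### The region of the shape -/

theorem row_adj {x y : LatticePoint} (h : lattice.Adj x y) : y.2 ≤ x.2 + 1 ∧ x.2 ≤ y.2 + 1 := by
  obtain ⟨u, hu, rfl⟩ := exists_dir_of_adj h
  rw [isDir_iff] at hu
  rcases hu with rfl | rfl | rfl | rfl | rfl | rfl <;> simp <;> omega

theorem eq_of_adj_hub {x c : LatticePoint} (hx : 2 ≤ x.2) (hc : c ∈ hub) (h : lattice.Adj x c) :
    (c = p₁ ∨ c = p₂) ∧ (x = (-2, 2) ∨ x = (-1, 2) ∨ x = (0, 2)) := by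
  obtain ⟨u, hu, rfl⟩ := exists_dir_of_adj h
  rw [mem_hub_coord] at hc
  rw [isDir_iff] at hu
  simp only [p₁, p₂, Prod.ext_iff, Prod.fst_add, Prod.snd_add] at hc ⊢
  rcases hu with rfl | rfl | rfl | rfl | rfl | rfl <;> simp at hc ⊢ <;> omega

namespace ProperRibbonization

variable {S D : Finset LatticePoint}

theorem row (hp : ProperRibbonization S D) {x : LatticePoint} (hx : x ∈ S) : 2 ≤ x.2 :=
  (hp.placement x hx).1

theorem two_le_hop (hp : ProperRibbonization S D) {x : LatticePoint} (hx : x ∈ S) :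
    2 ≤ hop S x := by
  have h := hp.hop_pos x hx
  have h1 : hop S x ≠ 1 := fun h1 =>
    (hp.placement x hx).2 ((mem_hub_iff x).2 (Or.inr (hop_eq_one_iff.1 h1)))
  omega

/-- The root ribbon consists of the three common neighbours of the seeds and the half-plane. -/
theorem root_mem (hp : ProperRibbonization S D) {x : LatticePoint}
    (hx : x = (-2, 2) ∨ x = (-1, 2) ∨ x = (0, 2)) : x ∈ S := by
  obtain ⟨R, hR, hg, hc, -⟩ := hp.root
  have hsub : R ⊆ (({(-2, 2), (-1, 2), (0, 2)} : Finset LatticePoint) : Set LatticePoint) := by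
    intro y hy
    have hyS := (eq_ribbonOf hR hy).1
    obtain ⟨-, c, -, hyc, hc⟩ := exists_hop_pred (hp.hop_pos y hyS)
    rw [hg y hy] at hc
    have := (eq_of_adj_hub (hp.row hyS)
      ((mem_hub_iff c).2 (Or.inr ((hop_eq_one_iff (P := (S : Set LatticePoint))).1 hc))) hyc).2
    simpa using this
  have heq : R = (({(-2, 2), (-1, 2), (0, 2)} : Finset LatticePoint) : Set LatticePoint) := by
    refine Set.eq_of_subset_of_ncard_le hsub ?_ (Finset.finite_toSet _)
    rw [Set.ncard_coe_finset, hc]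
    decide
  have : x ∈ R := by rw [heq]; simpa using hx
  exact (eq_ribbonOf hR this).1

/-- The complement of `S` is connected, but the hub has to be avoided as well. A path from a point
outside can be cut at the first point of ordinate at most `d`, and the positions next to the hub
above it all belong to the root ribbon. -/
theorem openOutside (hp : ProperRibbonization S D) (hS : HoleFree S) :
    OpenOutside ((S : Set LatticePoint) ∪ hub) := by
  have low : ∀ z : LatticePoint, z ∉ hub → z.2 ≤ 1 → ∀ M : ℤ, ∃ z', Relation.ReflTransGen
      (fun a b => lattice.Adj a b ∧ a ∉ (S : Set LatticePoint) ∪ hub ∧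
        b ∉ (S : Set LatticePoint) ∪ hub) z z' ∧ M ≤ |z'.2| := by
    intro z hz hz2 M
    refine exists_escape (ε := -1) (Or.inr rfl) ?_ hz (by omega) M
    rintro x (hx | hx) h
    · have := hp.row hx; omega
    · exact hx
  have key : ∀ (u v : {x // x ∉ S}) (w : (lattice.induce {x | x ∉ S}).Walk u v),
      (v : LatticePoint).2 ≤ 1 → (v : LatticePoint) ∉ hub → (u : LatticePoint) ∉ hub →
      ∀ M : ℤ, ∃ z', Relation.ReflTransGen (fun a b => lattice.Adj a b ∧
        a ∉ (S : Set LatticePoint) ∪ hub ∧ b ∉ (S : Set LatticePoint) ∪ hub) u z' ∧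
        M ≤ |z'.2| := by
    intro u v w
    induction w with
    | nil => exact fun h1 h2 _ => low _ h2 h1
    | cons ha w ih =>
      rename_i u u' v
      intro h1 h2 h3 M
      by_cases hu : (u : LatticePoint).2 ≤ 1
      · exact low _ h3 hu M
      · have hadj : lattice.Adj (u : LatticePoint) u' := ha
        have hu' : (u' : LatticePoint) ∉ hub := fun h =>
          u.2 (hp.root_mem (eq_of_adj_hub (by omega) h hadj).2)
        obtain ⟨z', hz', hM⟩ := ih h1 h2 hu' M
        exact ⟨z', .head ⟨hadj, fun h => h.elim u.2 h3, fun h => h.elim u'.2 hu'⟩ hz', hM⟩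
  intro z hz M
  have hv : ((0, -2) : LatticePoint) ∉ S := fun h => by have := hp.row h; simp at this
  obtain ⟨w⟩ := hS.preconnected ⟨z, fun h => hz (Or.inl h)⟩ ⟨(0, -2), hv⟩
  exact key _ _ w (by simp) (by rw [mem_hub_coord]; simp) (fun h => hz (Or.inr h)) M

/-- The free positions next to both the shape and the two seeds. -/
theorem mixed_contact (hp : ProperRibbonization S D) {p w v : LatticePoint}
    (hpA : p ∉ (S : Set LatticePoint) ∪ {p₁, p₂}) (hw : IsDir w) (hv : IsDir v)
    (hpw : p + w ∈ ({p₁, p₂} : Set LatticePoint)) (hpv : p + v ∈ S) :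
    (p = (1, 1) ∧ w = (-1, 0) ∨ p = (-2, 1) ∧ w = (1, 0)) ∧ (v = (0, 1) ∨ v = (-1, 1)) := by
  have h1 := hp.row hpv
  have hpS : p ∉ S := fun h => hpA (Or.inl h)
  have h2 : p.2 ≤ 1 := by
    by_contra h
    refine hpS (hp.root_mem (eq_of_adj_hub (by omega) ?_ (adj_add hw)).2)
    rw [mem_hub_coord]
    rcases hpw with h | h <;> rw [h] <;> decide
  have h3 : p ≠ p₁ := fun h => hpA (Or.inr (Or.inl h))
  have h4 : p ≠ p₂ := fun h => hpA (Or.inr (Or.inr h))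
  clear hpA hpS hpv
  simp only [Set.mem_insert_iff, Set.mem_singleton_iff, p₁, p₂, Prod.ext_iff, Prod.fst_add,
    Prod.snd_add, ne_eq] at *
  rw [isDir_iff] at hw hv
  rcases hw with rfl | rfl | rfl | rfl | rfl | rfl <;>
  rcases hv with rfl | rfl | rfl | rfl | rfl | rfl <;> simp at * <;> omega

/-- Away from the seeds, smoothness is part of a proper ribbonization; at the points that touch both
the shape and the seeds, it is due to the root ribbon. -/
theorem smooth (hp : ProperRibbonization S D) : Smooth ((S : Set LatticePoint) ∪ {p₁, p₂}) := by
  intro p hpA u hu hpu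
  have hpS : p ∉ S := fun h => hpA (Or.inl h)
  have adj' : ∀ {v : LatticePoint}, IsDir v → lattice.Adj (p + v) p := fun hv => (adj_add hv).symm
  have far : ∀ v w : LatticePoint, w ≠ 0 → ¬ IsDir w →
      p + v ∈ ({p₁, p₂} : Set LatticePoint) → p + (v + w) ∉ ({p₁, p₂} : Set LatticePoint) := by
    intro v w hw0 hw h1 h2
    rw [← add_assoc] at h2
    rcases h1 with h1 | h1 <;> rw [h1] at h2 <;> rcases h2 with h2 | h2
    · exact hw0 (by simpa using h2)
    · refine hw ?_
      have : w = p₂ - p₁ := by rw [← h2]; abel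
      rw [this]; simp [IsDir, p₁, p₂]
    · refine hw ?_
      have : w = p₁ - p₂ := by rw [← h2]; abel
      rw [this]; simp [IsDir, p₁, p₂]
    · exact hw0 (by simpa using h2)
  have hu' := hu
  rw [isDir_iff] at hu'
  constructor
  · rw [sub_eq_add_neg]
    rintro (h | h) <;> rcases hpu with h' | h'
    · refine hpS (hp.smooth_two _ h' _ h ?_ p (adj' hu) (adj' hu.neg))
      rcases hu' with rfl | rfl | rfl | rfl | rfl | rfl <;> simp [sqDist]
    · obtain ⟨h1, h2⟩ := hp.mixed_contact hpA hu hu.neg h' h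
      rcases h1 with ⟨-, rfl⟩ | ⟨-, rfl⟩ <;> simp at h2
    · obtain ⟨h1, h2⟩ := hp.mixed_contact hpA hu.neg hu h h'
      rcases h2 with rfl | rfl <;> simp at h1
    · refine far u (-u - u) ?_ ?_ h' (by rwa [show u + (-u - u) = -u by abel])
      · rcases hu' with rfl | rfl | rfl | rfl | rfl | rfl <;> decide
      · rcases hu' with rfl | rfl | rfl | rfl | rfl | rfl <;> simp [IsDir]
  · rintro (h | h) <;> rcases hpu with h' | h'
    · obtain ⟨z, hz1, hz2, hz⟩ := hp.smooth_sqrt_three _ h' _ h (by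
        rcases hu' with rfl | rfl | rfl | rfl | rfl | rfl <;> simp [sqDist, rot])
      have hzc : z = p ∨ z = p + rot u := by
        rw [adj_iff] at hz1 hz2
        obtain ⟨v, rfl⟩ : ∃ v, z = p + v := ⟨z - p, by abel⟩
        rw [add_sub_add_left_eq_sub] at hz1 hz2
        have e : v = 0 ∨ v = rot u := by
          rw [isDir_iff] at hz1 hz2
          simp only [Prod.ext_iff, Prod.fst_sub, Prod.snd_sub, Prod.fst_zero, Prod.snd_zero, rot]
            at hz1 hz2 ⊢
          rcases hu' with rfl | rfl | rfl | rfl | rfl | rfl <;> simp at hz1 hz2 ⊢ <;> omega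
        rcases e with rfl | rfl
        · left; simp
        · right; rfl
      rcases hzc with rfl | rfl
      · exact absurd hz hpS
      · exact Or.inl hz
    · obtain ⟨h1, h2⟩ := hp.mixed_contact hpA hu hu.rot_sub h' h
      rcases h1 with ⟨rfl, rfl⟩ | ⟨rfl, rfl⟩
      · simp [rot] at h2
      · exact Or.inl (hp.root_mem (by decide))
    · obtain ⟨h1, h2⟩ := hp.mixed_contact hpA hu.rot_sub hu h h'
      rcases h2 with rfl | rfl
      · rcases h1 with ⟨rfl, -⟩ | ⟨-, h1⟩
        · exact Or.inl (hp.root_mem (by decide))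
        · simp [rot] at h1
      · simp [rot] at h1
    · refine absurd h' fun h' => far u (rot u - u - u) ?_ ?_ h'
        (by rwa [show u + (rot u - u - u) = rot u - u by abel])
      · rcases hu' with rfl | rfl | rfl | rfl | rfl | rfl <;> decide
      · rcases hu' with rfl | rfl | rfl | rfl | rfl | rfl <;> simp [IsDir, rot]

theorem wide (hp : ProperRibbonization S D) {x : LatticePoint} (hx : x ∈ S) :
    ∃ y ∈ S, lattice.Adj x y ∧ hop S y = hop S x := by
  have h2 := hp.two_le_length _ (ribbonOf_mem_ribbons (P := (S : Set LatticePoint)) hx)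
  obtain ⟨y, hy, hyx⟩ := Set.exists_ne_of_one_lt_ncard (s := ribbonOf S x) (by omega) x
  obtain ⟨w⟩ := hy.2
  cases w with
  | nil => exact absurd rfl hyx
  | cons ha _ => exact ⟨_, ha.2.2.1, ha.1, ha.2.2.2.symm⟩

/-- The arcs of the root ribbon lead to the right. -/
theorem root_arc (hp : ProperRibbonization S D) {x y : LatticePoint} (hx : hop S x = 2)
    (h : RibbonArc S x y) : x.1 < y.1 := by
  obtain ⟨hxS, hyS, hxy, u, hu, hux, rfl⟩ := ribbonArc_iff.1 h
  rw [hx] at hux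
  have h1 := (eq_of_adj_hub (hp.row hxS)
    ((mem_hub_iff _).2 (Or.inr ((hop_eq_one_iff (P := (S : Set LatticePoint))).1 hux)))
    (adj_add hu)).1
  have h2 := hp.row hxS
  have h3 := hp.row hyS
  rw [isDir_iff] at hu
  simp only [p₁, p₂, Prod.ext_iff (x := _ + _), rot, Prod.fst_add, Prod.snd_add] at h1 h3 ⊢
  clear hux hxy hyS h
  rcases hu with rfl | rfl | rfl | rfl | rfl | rfl <;> simp at * <;> omega

/-- A proper ribbonization makes the shape a region in the sense of `RibbonRegion`. -/
theorem ribbonRegion (hp : ProperRibbonization S D) (hS : HoleFree S) :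
    RibbonRegion S {p₁, p₂} := by
  have hk : ∀ k : ℤ, 1 ≤ k → LowerClique S k ∧ SharedLower S k := by
    intro k hk
    have := lowerClique_and_sharedLower (hp.openOutside hS) (k - 1).toNat
    rwa [Int.toNat_of_nonneg (by omega), sub_add_cancel] at this
  refine ⟨fun x hx => hp.two_le_hop hx, fun k h => (hk k h).1, fun k h => (hk k h).2, ?_,
    Or.inl rfl, hp.smooth, fun x hx => hp.wide hx, ?_⟩
  · intro x hx c hxc hc
    exact (eq_of_adj_hub (hp.row hx)
      ((mem_hub_iff _).2 (Or.inr (hop_eq_one_iff.1 hc))) hxc).1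
  · intro x hx h
    have key : ∀ y, Relation.TransGen (RibbonArc S) x y → hop S y = 2 ∧ x.1 < y.1 := by
      intro y hy
      induction hy with
      | single h => exact ⟨(ribbonArc_iff.1 h).2.2.1.trans hx, hp.root_arc hx h⟩
      | tail _ h ih =>
        have := hp.root_arc ih.1 h
        exact ⟨(ribbonArc_iff.1 h).2.2.1.trans ih.1, by omega⟩
    exact lt_irrefl _ (key x h).2

end ProperRibbonization

/-! ### Ribbon-following -/

namespace RibbonRegion

variable {P pair : Set LatticePoint}

theorem parent_unique (hR : RibbonRegion P pair) {x c : LatticePoint} (hx : x ∈ P) (hc : c ∈ P)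
    (h : LowerNbr P x c) {Q : Set LatticePoint} (hQ : IsParentRibbon P Q (ribbonOf P x)) :
    Q = ribbonOf P c := by
  obtain ⟨d, hd, hxd, rfl⟩ := hQ.exists_lowerNbr hx
  exact (ribbonOf_eq_iff hc).2
    (hR.lower_sameRibbon hx (SimpleGraph.Reachable.refl _) hxd h hd).2

/-- Each ribbon has a guide, which contains the lower neighbours of its vertices. -/
theorem exists_guide (hR : RibbonRegion P {p₁, p₂}) {x : LatticePoint} (hx : x ∈ P) :
    ∃ F, IsGuide P F (ribbonOf P x) ∧
      (∀ y ∈ ribbonOf P x, ∀ c, lattice.Adj y c → (c ∈ F ↔ hop P c = hop P y - 1)) ∧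
      ∀ c ∈ F, c ∈ ({p₁, p₂} : Set LatticePoint) ∨
        c ∈ P ∧ IsParentRibbon P (ribbonOf P c) (ribbonOf P x) := by
  have h2 := hR.two_le_hop x hx
  obtain ⟨c, hc⟩ := hR.exists_lower hx
  have hopR : ∀ y ∈ ribbonOf P x, hop P y = hop P x := fun y hy => SameRibbon.hop_eq hy.2
  rcases h2.eq_or_lt with h2 | h2
  · refine ⟨{p₂, p₁}, Or.inr ⟨ribbonOf_mem_ribbons hx, rfl, ⟨1, ?_, ?_⟩, ?_⟩, ?_, ?_⟩
    · intro y hy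
      exact hR.pair_hop (Set.pair_comm p₂ p₁ ▸ hy)
    · intro y hy
      rw [hopR y hy, ← h2]; norm_num
    · intro y hy
      obtain ⟨d, hd⟩ := hR.exists_lower hy.1
      refine ⟨d, ?_, hd.1⟩
      rw [Set.pair_comm]
      exact hR.low y hy.1 d hd.1 (by rw [hd.2, hopR y hy, ← h2]; norm_num)
    · intro y hy d hyd
      rw [Set.pair_comm, hopR y hy, ← h2]
      exact ⟨fun h => by rw [hR.pair_hop h]; norm_num,
        fun h => hR.low y hy.1 d hyd (by rw [h]; norm_num)⟩
    · intro d hd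
      exact Or.inl (Set.pair_comm p₂ p₁ ▸ hd)
  · have hcP : c ∈ P := mem_of_two_le_hop (by rw [hc.2]; omega)
    have hpar := hR.isParentRibbon hx hcP hc
    refine ⟨ribbonOf P c, Or.inl hpar, ?_, ?_⟩
    · intro y hy d hyd
      constructor
      · intro hd
        rw [SameRibbon.hop_eq hd.2, hopR y hy, hc.2]
      · intro hd
        exact hR.lower_sameRibbon hx hy.2 hc ⟨hyd, hd⟩ hcP
    · intro d hd
      refine Or.inr ⟨hd.1, ?_⟩
      rwa [(ribbonOf_eq_iff hcP).2 (SameRibbon.symm hd.2)]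

/-- An arc of a ribbon is a step of a robot that follows the guide of the ribbon: the robots of the
guide next to `x` are just the lower neighbours of `x`. -/
theorem followStep_arc (hR : RibbonRegion P pair) {r : ℝ} (hr : 0 < r) {Q F : Set LatticePoint}
    {x u : LatticePoint} (hx : x ∈ P) (hu : LowerPivot P x u)
    (hF : ∀ c, lattice.Adj x c → (c ∈ F ↔ hop P c = hop P x - 1)) (hFQ : F ⊆ Q)
    (hxQ : x ∉ Q) (hxQ' : x + rot u ∉ Q) : FollowStep r Q (Q ∩ F) x (x + rot u) := by
  have hm : ∀ w, IsDir w → (x + w ∈ Q ∩ F ↔ hop P (x + w) = hop P x - 1) := fun w hw =>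
    ⟨fun h => (hF _ (adj_add hw)).1 h.2, fun h =>
      have h' := (hF _ (adj_add hw)).2 h
      ⟨hFQ h', h'⟩⟩
  refine followStep_of_pivot hr ⟨hu.1, fun h => hxQ h.1, (hm u hu.1).2 hu.2.1,
    fun h => hxQ' h.1, fun h => ?_⟩ ?_ hxQ hxQ'
  · have h' := (hm _ hu.1.rot_sub).1 h
    have hd := dir_distinct hu.1
    rcases hR.clique' hx hu.1 hu.1.rot_sub hu.2.1 h' with e | e | e
    · exact hd.2.1 e
    · exact hd.2.2.1 e
    · rw [rot_sub, rot_rot] at e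
      exact hd.2.2.2.1 (by rw [show -u = rot u - u - rot u by abel]; exact e.symm)
  · rintro v ⟨hv, -, h1, h2, -⟩
    exact hR.lowerPivot_unique hx hu
      ⟨hv, (hm v hv).1 h1, fun h => h2 ((hm _ hv.rot).2 h)⟩

/-- Ribbon-following leads from `x` to `y` if the part of the ribbon in between is free. -/
theorem ribbonFollows (hR : RibbonRegion P pair) {r : ℝ} (hr : 0 < r) {Q F : Set LatticePoint}
    {x y : LatticePoint} (hx : x ∈ P) (hxy : Relation.ReflTransGen (RibbonArc P) x y)
    (hF : ∀ z ∈ ribbonOf P x, ∀ c, lattice.Adj z c → (c ∈ F ↔ hop P c = hop P z - 1))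
    (hFQ : F ⊆ Q) (hQ : ∀ z, Relation.ReflTransGen (RibbonArc P) x z →
      Relation.ReflTransGen (RibbonArc P) z y → z ∉ Q) :
    RibbonFollows r Q F (ribbonOf P x) x y := by
  suffices h : ∀ z, Relation.ReflTransGen (RibbonArc P) x z →
      Relation.ReflTransGen (RibbonArc P) z y → RibbonFollows r Q F (ribbonOf P x) x z from
    h y hxy .refl
  intro z hz
  induction hz with
  | refl => exact fun _ => .refl
  | tail hxa ha ih =>
    rename_i a b
    intro hby
    have haP : a ∈ ribbonOf P x :=
      ⟨(sameRibbon_of_arcs hxa).mem hx, sameRibbon_of_arcs hxa⟩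
    have hbP : b ∈ ribbonOf P x :=
      ⟨(sameRibbon_of_arcs (hxa.tail ha)).mem hx, sameRibbon_of_arcs (hxa.tail ha)⟩
    refine (ih (.head ha hby)).tail ⟨?_, hbP⟩
    have hbQ := hQ b (hxa.tail ha) hby
    have haQ := hQ a hxa (.head ha hby)
    obtain ⟨-, -, -, u, hu, rfl⟩ := ribbonArc_iff_pivot.1 ha
    exact hR.followStep_arc hr haP.1 hu (hF a haP) hFQ haQ hbQ

theorem exists_firstVertex (hR : RibbonRegion P pair) (hfin : P.Finite) {x : LatticePoint}
    (hx : x ∈ P) : ∃ x₁, IsFirstVertex P (ribbonOf P x) x₁ ∧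
      ∀ y ∈ ribbonOf P x, Relation.ReflTransGen (RibbonArc P) y x₁ := by
  have := hfin.to_subtype
  let r : P → P → Prop := fun a b => RibbonLT P a b
  have : IsTrans _ r := ⟨fun _ _ _ h h' => RibbonLT.trans h h'⟩
  have : Std.Irrefl r := ⟨fun a => hR.acyclic a⟩
  have wf : WellFounded r := Finite.wellFounded_of_trans_of_irrefl r
  obtain ⟨x₁, hx₁, hmin⟩ := wf.has_min {z | SameRibbon P x z}
    ⟨⟨x, hx⟩, SimpleGraph.Reachable.refl _⟩
  refine ⟨x₁, ⟨⟨x₁.2, hx₁⟩, fun y hy h => hmin ⟨y, hy.1⟩ hy.2 h⟩, fun y hy => ?_⟩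
  rcases hR.ribbonLT_total (SameRibbon.trans (SameRibbon.symm hx₁) hy.2) with h | h | h
  · rw [h]
  · exact h.to_reflTransGen
  · exact absurd h (hmin ⟨y, hy.1⟩ hy.2)

/-- The point to which a robot rotates from `x` has the hop count of `x`, if it has one. -/
theorem hop_rot_pivot (hR : RibbonRegion P pair) {x u : LatticePoint} (hx : x ∈ P)
    (hu : LowerPivot P x u) (h : 0 ≤ hop P (x + rot u)) : hop P (x + rot u) = hop P x := by
  have h2 := hR.two_le_hop x hx
  have h1 := hop_adj_le (P := P) (x := x + rot u) (y := x) h (by omega) (adj_add hu.1.rot).symm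
  have h3 := hop_adj_le (P := P) (x := x + u) (y := x + rot u) (by rw [hu.2.1]; omega) h (by
    rw [adj_iff, add_sub_add_left_eq_sub]; exact hu.1.rot_sub)
  have h4 := hu.2.1
  have h5 := hu.2.2
  omega

/-- A robot at the front of its ribbon leaves the region when it rotates on. -/
theorem front_leaves (hR : RibbonRegion P pair) {x u : LatticePoint} (hx : x ∈ P)
    (hu : LowerPivot P x u) (hfirst : ∀ y, ¬ RibbonArc P x y) : x + rot u ∉ P := by
  intro h
  have h2 := hR.two_le_hop _ h
  exact hfirst _ (ribbonArc_iff_pivot.2 ⟨hx, h, hR.hop_rot_pivot hx hu (by omega), u, hu, rfl⟩)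

end RibbonRegion

/-- The position to which a robot at the front of its ribbon rotates on is free. -/
theorem RibbonRegion.front_free {S : Finset LatticePoint} (hR : RibbonRegion S {p₁, p₂})
    (hS : ∀ x ∈ S, 2 ≤ x.2) {x u : LatticePoint} (hx : x ∈ S) (hu : LowerPivot S x u)
    (hm : x + rot u ∉ S) : x + rot u ∉ seeds ∧ 1 ≤ (x + rot u).2 := by
  have h1 := hS _ hx
  have h2 := row_adj (adj_add (x := x) hu.1.rot)
  refine ⟨fun h => ?_, by omega⟩
  have h0 : 0 ≤ hop (S : Set LatticePoint) (x + rot u) := by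
    rw [mem_seeds] at h
    rcases h with h | h | h | h | h
    · rw [h, hop_zero]
    · rw [h, hR.pair_hop (Or.inl rfl)]; norm_num
    · rw [h, hR.pair_hop (Or.inr rfl)]; norm_num
    · rw [h] at h2; simp [p₄] at h2; omega
    · rw [h] at h2; simp [p₅] at h2; omega
  have h3 := hR.hop_rot_pivot hx hu h0
  have h4 := hR.two_le_hop _ hx
  exact hm (mem_of_two_le_hop (P := (S : Set LatticePoint)) (by omega))

/-! ### Avoiding a ribbon and its descendants -/

/-- The points of `S` on ribbons other than `R` and its descendants. -/
def besideRibbon (S R : Set LatticePoint) : Set LatticePoint :=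
  {y | y ∈ S ∧ ribbonOf S y ≠ R ∧ ¬ TreeLT S R (ribbonOf S y)}

namespace RibbonRegion

variable {P pair : Set LatticePoint}

theorem beside_lower (hR : RibbonRegion P pair) {R : Set LatticePoint} {y z : LatticePoint}
    (hy : y ∈ P) (h : ribbonOf P y ≠ R ∧ ¬ TreeLT P R (ribbonOf P y)) (hz : z ∈ P)
    (hyz : LowerNbr P y z) : z ∈ besideRibbon P R := by
  have hp := hR.isParentRibbon hy hz hyz
  refine ⟨hz, ?_, fun h' => h.2 (h'.tail hp)⟩
  rintro rfl
  exact h.2 (.single hp)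

theorem frontClosed_beside (hR : RibbonRegion P pair) (R : Set LatticePoint) :
    FrontClosed P (besideRibbon P R) := by
  refine ⟨fun y hy => hy.1, fun y hy z hz hyz => hR.beside_lower hy.1 hy.2 hz hyz, ?_, ?_⟩
  · intro y hy z hyz
    have hz := (ribbonArc_iff.1 hyz).2.1
    have e := (ribbonOf_eq_iff hz).2 hyz.sameRibbon
    exact ⟨hz, e ▸ hy.2⟩
  · intro y hy p hpy z hz hpz
    have hp := (ribbonArc_iff.1 hpy).1
    have e := (ribbonOf_eq_iff hy.1).2 hpy.sameRibbon
    exact hR.beside_lower hp (e ▸ hy.2) hz hpz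

/-- Among the points of `P` outside `besideRibbon P R`, only those of `R` touch it, and only at
their lower neighbours. -/
theorem beside_contact (hR : RibbonRegion P pair) {x q w : LatticePoint} (hx : x ∈ P)
    (hq : q ∈ P) (hqB : q ∉ besideRibbon P (ribbonOf P x)) (hw : IsDir w)
    (hqw : q + w ∈ besideRibbon P (ribbonOf P x) ∪ pair) :
    ribbonOf P q = ribbonOf P x ∧ hop P (q + w) = hop P q - 1 := by
  have hlow : ∀ v, IsDir v → q + v ∈ besideRibbon P (ribbonOf P x) ∪ pair →
      hop P (q + v) = hop P q - 1 → ribbonOf P q = ribbonOf P x := by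
    intro v hv hqv hl
    by_contra hne
    have ht : TreeLT P (ribbonOf P x) (ribbonOf P q) := by
      by_contra ht
      exact hqB ⟨hq, hne, ht⟩
    rcases hqv with hqv | hqv
    · obtain ⟨Q, hQ1, hQ2⟩ := Relation.TransGen.tail'_iff.1 ht
      rw [hR.parent_unique hq hqv.1 ⟨adj_add hv, hl⟩ hQ2] at hQ1
      rcases Relation.reflTransGen_iff_eq_or_transGen.1 hQ1 with e | e
      · exact hqv.2.1 e
      · exact hqv.2.2 e
    · have h1 := ht.hop_lt x (mem_ribbonOf_self hx) q (mem_ribbonOf_self hq)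
      have h2 := hR.two_le_hop x hx
      have := hR.pair_hop hqv
      omega
  obtain ⟨s, hs⟩ := hR.exists_lowerPivot hq
  have h2 := hR.two_le_hop q hq
  by_cases hl : hop P (q + w) = hop P q - 1
  · exact ⟨hlow w hw hqw hl, hl⟩
  exfalso
  have hwP : 1 ≤ hop P (q + w) := by
    rcases hqw with h | h
    · have := hR.two_le_hop _ h.1; omega
    · rw [hR.pair_hop h]
  rcases hR.contact (hR.frontClosed_beside _) hq hqB hs hw hqw with rfl | rfl | ⟨rfl, hqs⟩
  · exact hl hs.2.1
  · -- a second lower neighbour, or a point of the ribbon behind `q`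
    have h3 := hop_adj_le (P := P) (x := q + (s - rot s)) (y := q) (by omega) (by omega)
      (adj_add hw).symm
    have h4 := hop_adj_le (P := P) (x := q + s) (y := q + (s - rot s)) (by rw [hs.2.1]; omega)
      (by omega) (by
        rw [adj_iff, add_sub_add_left_eq_sub, sub_sub_cancel_left]; exact hs.1.rot.neg)
    have h5 : hop P (q + (s - rot s)) = hop P q := by have := hs.2.1; omega
    have h6 : q + (s - rot s) ∈ P := mem_of_two_le_hop (by omega)
    rcases hR.arc_or_arc (adj_add hw) hq h6 h5.symm with arc | arc
    · obtain ⟨-, -, -, u, hu, e⟩ := ribbonArc_iff_pivot.1 arc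
      rw [hR.lowerPivot_unique hq hs hu] at e
      exact (dir_distinct hs.1).2.2.2.2.2.2.2.2.2.2.2.1 (add_left_cancel e)
    · have hm : q + (s - rot s) ∈ besideRibbon P (ribbonOf P x) := by
        refine hqw.resolve_right fun h => ?_
        have := hR.pair_hop h; omega
      exact hqB ((hR.frontClosed_beside _).front _ hm _ arc)
  · have e1 := hlow s hs.1 hqs hs.2.1
    have e2 := hR.hop_rot_pivot hq hs (by omega)
    have h6 : q + rot s ∈ P := mem_of_two_le_hop (by omega)
    rcases hqw with h | h
    · refine h.2.1 ?_
      rw [← e1]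
      exact ((ribbonOf_eq_iff h6).2 (sameRibbon_of_adj (adj_add hs.1.rot) hq h6 e2.symm)).symm
    · have := hR.pair_hop h; omega

end RibbonRegion

/-- Edge-following leads from the merging point of a ribbon to any other boundary position `b`,
without a rotation around that ribbon or its descendants. For the boundary walk around the rest of
the configuration enters the ribbon only to leave it at the merging point. -/
theorem exists_detour {S C : Finset LatticePoint} {P' : Set LatticePoint}
    (hR : RibbonRegion S {p₁, p₂}) (hR' : RibbonRegion P' {p₄, p₅})
    (hS : ∀ x ∈ S, 2 ≤ x.2) (hP' : ∀ x ∈ P', x.2 ≤ -2) (hC : FrontClosed P' C)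
    {x x₁ u b : LatticePoint} (hx : x ∈ S) (hx₁ : x₁ ∈ ribbonOf S x)
    (hfirst : ∀ y ∈ ribbonOf S x, Relation.ReflTransGen (RibbonArc S) y x₁)
    (hu : LowerPivot S x₁ u) (hm : x₁ + rot u ∉ S)
    (hb : Touches ((seeds : Set LatticePoint) ∪ C) b) (hbS : b ∉ S) :
    Relation.ReflTransGen (fun q q' => ∃ v, Pivot ((seeds : Set LatticePoint) ∪ C ∪ S) q v ∧
      q' = q + rot v ∧ q + v ∈ (seeds : Set LatticePoint) ∪ C ∪ besideRibbon S (ribbonOf S x))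
      (x₁ + rot u) b := by
  classical
  set R := ribbonOf (S : Set LatticePoint) x with hRdef
  have hfullc : FrontClosed (S : Set LatticePoint) S :=
    ⟨subset_rfl, fun _ _ z hz _ => hz, fun _ _ z h => (ribbonArc_iff.1 h).2.1,
      fun _ _ _ _ z hz _ => hz⟩
  obtain ⟨hA, -⟩ := oneOrbit_join hR hR' hS hP' hfullc hC
  have hB0 : ((S.filter (· ∈ besideRibbon S R) : Finset LatticePoint) : Set LatticePoint) =
      besideRibbon S R := by
    ext z
    simp only [Finset.coe_filter, Set.mem_ofPred_eq, and_iff_right_iff_imp]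
    exact fun h => h.1
  obtain ⟨hA0, hO0⟩ := oneOrbit_join hR hR' hS hP'
    (B := S.filter (· ∈ besideRibbon S R)) (by rw [hB0]; exact hR.frontClosed_beside R) hC
  rw [hB0] at hA0 hO0
  set A0 := (seeds : Set LatticePoint) ∪ C ∪ besideRibbon S R with hA0def
  have hsub : A0 ⊆ (seeds : Set LatticePoint) ∪ C ∪ S :=
    Set.union_subset_union_right _ fun z hz => hz.1
  have hx₁S : x₁ ∈ S := hx₁.1
  have hRx₁ : ribbonOf (S : Set LatticePoint) x₁ = R := ((ribbonOf_eq_iff hx₁.1).2 hx₁.2).symm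
  have hseed : ∀ z ∈ seeds, -1 ≤ z.2 ∧ z.2 ≤ 1 := by decide
  -- from points of `S` one sees no idle robots, and of the seeds only `p₁` and `p₂`
  have hrow : ∀ {q w : LatticePoint}, q ∈ S → IsDir w → q + w ∈ A0 →
      q + w ∈ besideRibbon S R ∪ {p₁, p₂} := by
    intro q w hq hw h
    have h1 := hS q hq
    have h2 := row_adj (adj_add (x := q) hw)
    rcases h with (h | h) | h
    · right
      rw [Finset.mem_coe, mem_seeds] at h
      rcases h with h | h | h | h | h
      · rw [h] at h2; simp at h2; omega
      · exact Or.inl h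
      · exact Or.inr h
      · rw [h] at h2; simp [p₄] at h2; omega
      · rw [h] at h2; simp [p₅] at h2; omega
    · have := hP' _ (hC.subset h); omega
    · exact Or.inl h
  -- the lower neighbours of the vertices of `R` are in `A0`
  have hlowA0 : ∀ {q c : LatticePoint}, q ∈ S → ribbonOf (S : Set LatticePoint) q = R →
      LowerNbr S q c → c ∈ A0 := by
    intro q c hq hqR hc
    rcases hR.lower_mem hq hc with h | h
    · refine Or.inr ⟨h, ?_, ?_⟩
      · intro e
        have := SameRibbon.hop_eq ((ribbonOf_eq_iff h).1 (hqR.trans e.symm))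
        have := hc.2
        omega
      · intro e
        rw [← hqR] at e
        have := e.hop_lt q (mem_ribbonOf_self hq) c (mem_ribbonOf_self h)
        have := hc.2
        omega
    · exact Or.inl (Or.inl (hR.pair_subset_seeds h))
  have hmA0 : Touches A0 (x₁ + rot u) := by
    refine ⟨?_, u - rot u, hu.1.sub_rot, ?_⟩
    · obtain ⟨h1, h2⟩ := hR.front_free hS hx₁S hu hm
      rintro ((h | h) | h)
      · exact h1 h
      · have := hP' _ (hC.subset h); omega
      · exact hm h.1
    · rw [show x₁ + rot u + (u - rot u) = x₁ + u by abel]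
      exact hlowA0 hx₁S hRx₁ ⟨adj_add hu.1, hu.2.1⟩
  have hbA0 : Touches A0 b := by
    obtain ⟨h1, w, hw, h2⟩ := hb
    exact ⟨fun h => h.elim h1 (fun h => hbS h.1), w, hw, Or.inl h2⟩
  -- when the walk around `A0` is outside `S`, some walk has led there without entering `S`: each
  -- excursion into `R` ends at the merging point, where the walk can be started afresh
  have key : ∀ q, Relation.ReflTransGen (Step A0) (x₁ + rot u) q → q ∈ S ∨
      Relation.ReflTransGen (fun q q' => Step A0 q q' ∧ q ∉ S ∧ q' ∉ S) (x₁ + rot u) q := by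
    intro q hq
    induction hq with
    | refl => exact Or.inr .refl
    | tail _ hs ih =>
      rename_i q q' _
      by_cases hq' : q' ∈ S
      · exact Or.inl hq'
      right
      by_cases hqS : q ∈ S
      · obtain ⟨v, ⟨hv, hqA, hqv, hqv', -⟩, rfl⟩ := hs
        obtain ⟨h1, h2⟩ := hR.beside_contact hx hqS (fun h => hqA (Or.inr h)) hv
          (hrow hqS hv hqv)
        have hpv : LowerPivot S q v :=
          ⟨hv, h2, fun h => hqv' (hlowA0 hqS h1 ⟨adj_add hv.rot, h⟩)⟩
        -- the walk has reached the first vertex of the ribbon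
        have hqx : q = x₁ := by
          rcases Relation.ReflTransGen.cases_head
            (hfirst q (hRdef ▸ h1 ▸ mem_ribbonOf_self hqS)) with e | ⟨z, hz, -⟩
          · exact e
          · obtain ⟨-, hzS, -, v', hv', rfl⟩ := ribbonArc_iff_pivot.1 hz
            rw [hR.lowerPivot_unique hqS hpv hv'] at hzS
            exact absurd hzS hq'
        subst hqx
        rw [hR.lowerPivot_unique hqS hu hpv]
      · exact (ih.resolve_left hqS).tail ⟨hs, hqS, hq'⟩
  refine Relation.ReflTransGen.mono ?_ _ _ ((key b (hO0 _ _ hmA0 hbA0)).resolve_left hbS)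
  rintro q q' ⟨⟨v, hv, rfl⟩, hqS, hqS'⟩
  obtain ⟨hvd, hqA, hqv, hqv', -⟩ := hv
  have hfree : ∀ {z : LatticePoint}, z ∉ A0 → z ∉ S →
      z ∉ (seeds : Set LatticePoint) ∪ C ∪ S := by
    rintro z h1 h2 (h | h)
    · exact h1 (Or.inl h)
    · exact h2 h
  refine ⟨v, ⟨hvd, hfree hqA hqS, hsub hqv, hfree hqv' hqS', fun h => ?_⟩, rfl, hqv⟩
  exact hfree hqv' hqS' ((hA q (hfree hqA hqS) v hvd (hsub hqv)).2 h)

/-! ### Greedy sequences -/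

/-- `lt` is a strict total order on `C`. -/
structure StrictOn (lt : LatticePoint → LatticePoint → Prop) (C : Set LatticePoint) : Prop where
  irrefl : ∀ x ∈ C, ¬ lt x x
  trans : ∀ x ∈ C, ∀ y ∈ C, ∀ z ∈ C, lt x y → lt y z → lt x z
  total : ∀ x ∈ C, ∀ y ∈ C, x ≠ y → lt x y ∨ lt y x

theorem StrictOn.mono {lt : LatticePoint → LatticePoint → Prop} {C C' : Set LatticePoint}
    (h : StrictOn lt C) (hC : C' ⊆ C) : StrictOn lt C' :=
  ⟨fun x hx => h.irrefl x (hC hx),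
    fun x hx y hy z hz => h.trans x (hC hx) y (hC hy) z (hC hz),
    fun x hx y hy => h.total x (hC hx) y (hC hy)⟩

theorem StrictOn.asymm {lt : LatticePoint → LatticePoint → Prop} {C : Set LatticePoint}
    (h : StrictOn lt C) {x y : LatticePoint} (hx : x ∈ C) (hy : y ∈ C) (hxy : lt x y) :
    ¬ lt y x := fun hyx => h.irrefl x hx (h.trans x hx y hy x hx hxy hyx)

theorem StrictOn.exists_first {lt : LatticePoint → LatticePoint → Prop} {C C' : Set LatticePoint}
    (h : StrictOn lt C) (hfin : C.Finite) (hC : C' ⊆ C) (hne : C'.Nonempty) :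
    ∃ x, IsFirstFor lt C' x := by
  have := (hfin.subset hC).to_subtype
  have h' := h.mono hC
  let r : C' → C' → Prop := fun a b => lt a b
  have : IsTrans _ r := ⟨fun a b c => h'.trans a a.2 b b.2 c c.2⟩
  have : Std.Irrefl r := ⟨fun a => h'.irrefl a a.2⟩
  have wf : WellFounded r := Finite.wellFounded_of_trans_of_irrefl r
  obtain ⟨y, hy⟩ := hne
  obtain ⟨x, -, hmin⟩ := wf.has_min Set.univ ⟨⟨y, hy⟩, trivial⟩
  refine ⟨x, x.2, fun z hz hzx => ?_⟩
  exact (h'.total z hz x x.2 hzx).resolve_left (hmin ⟨z, hz⟩ trivial)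

section Greedy

variable {N : ℕ} {lt : Fin N → LatticePoint → LatticePoint → Prop} {C : Fin N → Set LatticePoint}
  {u : Fin N → LatticePoint}

theorem greedy_mem (h : ∀ k, IsFirstFor (lt k) (remaining (C k) u k) (u k)) (k : Fin N) :
    u k ∈ C k := (h k).1.1

theorem greedy_injective (h : ∀ k, IsFirstFor (lt k) (remaining (C k) u k) (u k)) :
    Function.Injective u := by
  intro j k hjk
  rcases lt_trichotomy j k with h' | h' | h'
  · exact absurd hjk ((h k).1.2 j h')
  · exact h'
  · exact absurd hjk.symm ((h j).1.2 k h')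

theorem greedy_mono (h : ∀ k, IsFirstFor (lt k) (remaining (C k) u k) (u k)) {j k : Fin N}
    (hjk : j < k) (hC : C j = C k) : lt j (u j) (u k) := by
  refine (h j).2 _ ⟨hC ▸ greedy_mem h k, fun i hi => (h k).1.2 i (hi.trans hjk)⟩ ?_
  exact ((h k).1.2 j hjk).symm

theorem greedy_downward (h : ∀ k, IsFirstFor (lt k) (remaining (C k) u k) (u k)) {k : Fin N}
    (hlt : StrictOn (lt k) (C k)) {y : LatticePoint} (hy : y ∈ C k) (hyk : lt k y (u k)) :
    ∃ j < k, u j = y := by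
  by_contra hn
  push Not at hn
  have hne : y ≠ u k := fun e => hlt.irrefl y hy (by rwa [← e] at hyk)
  exact hlt.asymm hy (greedy_mem h k) hyk ((h k).2 y ⟨hy, hn⟩ hne)

theorem remaining_congr {C : Set LatticePoint} {u u' : Fin N → LatticePoint} {k : Fin N}
    (h : ∀ j < k, u j = u' j) : remaining C u k = remaining C u' k := by
  ext x
  exact and_congr_right fun _ => forall₂_congr fun j hj => by rw [h j hj]

/-- Choosing in each round the first candidate not chosen before determines a sequence, provided
that the candidate sets of different rounds are equal or disjoint and large enough. -/
theorem existsUnique_greedy {C : Fin N → Finset LatticePoint} (hlt : ∀ k, StrictOn (lt k) (C k))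
    (hC : ∀ j k, C j = C k ∨ Disjoint (C j) (C k))
    (hcard : ∀ k, (Finset.univ.filter (fun j => j < k ∧ C j = C k)).card < (C k).card) :
    ∃! u : Fin N → LatticePoint, ∀ k, IsFirstFor (lt k) (remaining (C k) u k) (u k) := by
  -- the `k`-th choice is determined by the earlier ones
  have huniq : ∀ u u' : Fin N → LatticePoint,
      (∀ k, IsFirstFor (lt k) (remaining (C k) u k) (u k)) →
      (∀ k, IsFirstFor (lt k) (remaining (C k) u' k) (u' k)) → u = u' := by
    intro u u' h h'
    funext k
    induction k using WellFoundedLT.induction with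
    | ind k ih =>
      have hr := remaining_congr (C := C k) ih
      have h1 := h k
      have h2 := h' k
      rw [hr] at h1
      by_contra hne
      exact (hlt k).asymm h1.1.1 h2.1.1 (h1.2 _ h2.1 (Ne.symm hne)) (h2.2 _ h1.1 hne)
  have hex : ∀ n : ℕ, n ≤ N → ∃ u : Fin N → LatticePoint,
      ∀ k : Fin N, k.val < n → IsFirstFor (lt k) (remaining (C k) u k) (u k) := by
    intro n
    induction n with
    | zero => exact fun _ => ⟨fun _ => 0, fun k hk => absurd hk (by omega)⟩
    | succ n ih =>
      intro hn
      obtain ⟨u, hu⟩ := ih (by omega)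
      let k : Fin N := ⟨n, hn⟩
      have hne : (remaining (C k : Set LatticePoint) u k).Nonempty := by
        rw [Set.nonempty_iff_ne_empty]
        intro hempty
        -- otherwise all candidates have been chosen in earlier rounds with the same candidate set
        refine absurd (Finset.card_le_card (s := C k)
          (t := (Finset.univ.filter (fun j => j < k ∧ C j = C k)).image u) ?_)
          (not_le.2 (lt_of_le_of_lt Finset.card_image_le (hcard k)))
        intro y hy
        have hy' : y ∉ remaining (C k : Set LatticePoint) u k := by rw [hempty]; simp
        obtain ⟨j, hj, rfl⟩ : ∃ j < k, u j = y := by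
          by_contra hno
          push Not at hno
          exact hy' ⟨hy, hno⟩
        have hjC : u j ∈ C j := (hu j hj).1.1
        rcases hC j k with e | e
        · exact Finset.mem_image_of_mem _ (Finset.mem_filter.2 ⟨Finset.mem_univ _, hj, e⟩)
        · exact absurd hy (Finset.disjoint_left.1 e hjC)
      obtain ⟨x, hx⟩ := (hlt k).exists_first (Finset.finite_toSet _) (fun z hz => hz.1) hne
      refine ⟨Function.update u k x, fun j hj => ?_⟩
      have hrem : remaining (C j : Set LatticePoint) (Function.update u k x) j =
          remaining (C j : Set LatticePoint) u j := by
        refine remaining_congr fun i hi => Function.update_of_ne ?_ _ _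
        rintro rfl
        have : k.val < j.val := hi
        change n < j.val at this
        omega
      rw [hrem]
      by_cases hjk : j = k
      · subst hjk
        rw [Function.update_self]
        exact hx
      · rw [Function.update_of_ne hjk]
        refine hu j ?_
        have : j.val ≠ n := fun e => hjk (Fin.ext e)
        omega
  obtain ⟨u, hu⟩ := hex N le_rfl
  exact ⟨u, fun k => hu k k.2, fun u' hu' => huniq u' u hu' fun k => hu k k.2⟩

end Greedy

theorem card_earlier_lt {N : ℕ} (p : Fin N → Prop) [DecidablePred p] (k : Fin N) {n : ℕ}
    (hn : N ≤ n) : (Finset.univ.filter (fun j => j < k ∧ p j)).card < n := by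
  refine lt_of_lt_of_le (lt_of_le_of_lt (Finset.card_le_card (t := Finset.Iio k) ?_) ?_) hn
  · intro j hj
    exact Finset.mem_Iio.2 (Finset.mem_filter.1 hj).2.1
  · rw [Fin.card_Iio]; exact k.2

/-! ### The orders of the movement sequences -/

theorem strictOn_idle : StrictOn IdleLT idleHalf :=
  ⟨fun x _ => IdleLT.irrefl x, fun _ _ _ _ _ _ => IdleLT.trans, fun _ hx _ hy => IdleLT.total hx hy⟩

theorem StrictOn.congr {lt lt' : LatticePoint → LatticePoint → Prop} {C : Set LatticePoint}
    (h : StrictOn lt C) (hl : ∀ x ∈ C, ∀ y ∈ C, (lt' x y ↔ lt x y)) : StrictOn lt' C :=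
  ⟨fun x hx => by rw [hl x hx x hx]; exact h.irrefl x hx,
    fun x hx y hy z hz => by
      rw [hl x hx y hy, hl y hy z hz, hl x hx z hz]; exact h.trans x hx y hy z hz,
    fun x hx y hy => by rw [hl x hx y hy, hl y hy x hx]; exact h.total x hx y hy⟩

theorem StrictOn.flip {lt : LatticePoint → LatticePoint → Prop} {C : Set LatticePoint}
    (h : StrictOn lt C) : StrictOn (fun x y => lt y x) C :=
  ⟨h.irrefl, fun x hx y hy z hz h1 h2 => h.trans z hz y hy x hx h2 h1,
    fun x hx y hy hne => (h.total x hx y hy hne).symm⟩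

theorem strictOn_ribbonLex_idle :
    StrictOn (RibbonLex idleHalf (TreeLT idleHalf) (RibbonLT idleHalf)) idleHalf :=
  strictOn_idle.congr fun _ hx _ hy => ribbonLex_idle_iff hx hy

theorem strictOn_ribbonLex_idle_rev :
    StrictOn (RibbonLex idleHalf (fun Q R => TreeLT idleHalf R Q)
      (fun x y => RibbonLT idleHalf y x)) idleHalf :=
  strictOn_idle.flip.congr fun _ hx _ hy => ribbonLex_idle_rev_iff hx hy

theorem IsCompleteTreeOrder.asymm {P : Set LatticePoint}
    {lt : Set LatticePoint → Set LatticePoint → Prop} (h : IsCompleteTreeOrder P lt)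
    {Q R : Set LatticePoint} (hQ : Q ∈ ribbons P) (hR : R ∈ ribbons P) (h1 : lt Q R) :
    ¬ lt R Q := fun h2 => h.irrefl Q hQ (h.trans Q hQ R hR Q hQ h1 h2)

theorem RibbonRegion.strictOn_ribbonLex {P pair : Set LatticePoint} (hR : RibbonRegion P pair)
    {lt : Set LatticePoint → Set LatticePoint → Prop} (irrefl : ∀ R ∈ ribbons P, ¬ lt R R)
    (trans : ∀ R₁ ∈ ribbons P, ∀ R₂ ∈ ribbons P, ∀ R₃ ∈ ribbons P, lt R₁ R₂ → lt R₂ R₃ → lt R₁ R₃)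
    (total : ∀ R₁ ∈ ribbons P, ∀ R₂ ∈ ribbons P, R₁ ≠ R₂ → lt R₁ R₂ ∨ lt R₂ R₁) :
    StrictOn (RibbonLex P lt (RibbonLT P)) P := by
  have hm : ∀ {x}, x ∈ P → ribbonOf P x ∈ ribbons P := fun hx => ribbonOf_mem_ribbons hx
  refine ⟨?_, ?_, ?_⟩
  · rintro x hx (h | ⟨-, h⟩)
    · exact irrefl _ (hm hx) h
    · exact hR.acyclic x h
  · rintro x hx y hy z hz (h | ⟨e, h⟩) (h' | ⟨e', h'⟩)
    · exact Or.inl (trans _ (hm hx) _ (hm hy) _ (hm hz) h h')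
    · exact Or.inl (e' ▸ h)
    · exact Or.inl (e ▸ h')
    · exact Or.inr ⟨e.trans e', h.trans h'⟩
  · intro x hx y hy hne
    by_cases e : ribbonOf P x = ribbonOf P y
    · rcases hR.ribbonLT_total ((ribbonOf_eq_iff hy).1 e) with h | h | h
      · exact absurd h hne
      · exact Or.inl (Or.inr ⟨e, h⟩)
      · exact Or.inr (Or.inr ⟨e.symm, h⟩)
    · exact (total _ (hm hx) _ (hm hy) e).imp Or.inl Or.inl

theorem RibbonRegion.strictOn_assembly {P pair : Set LatticePoint} (hR : RibbonRegion P pair)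
    {lt : Set LatticePoint → Set LatticePoint → Prop} (hlt : IsCompleteTreeOrder P lt) :
    StrictOn (RibbonLex P lt (RibbonLT P)) P :=
  hR.strictOn_ribbonLex hlt.irrefl hlt.trans hlt.total

theorem RibbonRegion.strictOn_reactivation {P pair : Set LatticePoint} (hR : RibbonRegion P pair)
    {lt : Set LatticePoint → Set LatticePoint → Prop} (hlt : IsCompleteTreeOrder P lt) :
    StrictOn (RibbonLex P (fun Q R => lt R Q) (RibbonLT P)) P :=
  hR.strictOn_ribbonLex hlt.irrefl
    (fun R₁ h₁ R₂ h₂ R₃ h₃ h h' => hlt.trans R₃ h₃ R₂ h₂ R₁ h₁ h' h)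
    (fun R₁ h₁ R₂ h₂ hne => (hlt.total R₁ h₁ R₂ h₂ hne).symm)

/-! ### Counting recycled robots -/

/-- In a finite strict total order, exactly `c` elements have fewer than `c` predecessors. -/
theorem card_filter_rank_lt {lt : LatticePoint → LatticePoint → Prop} [DecidableRel lt]
    {R : Finset LatticePoint} (h : StrictOn lt R) {c : ℕ} (hc : c ≤ R.card) :
    (R.filter (fun x => (R.filter (fun y => lt y x)).card < c)).card = c := by
  set rk : LatticePoint → ℕ := fun x => (R.filter (fun y => lt y x)).card with hrk
  have hlt : ∀ x ∈ R, ∀ y ∈ R, lt x y → rk x < rk y := by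
    intro x hx y hy hxy
    refine Finset.card_lt_card ⟨fun z hz => ?_, fun hsub => ?_⟩
    · rw [Finset.mem_filter] at hz ⊢
      exact ⟨hz.1, h.trans z hz.1 x hx y hy hz.2 hxy⟩
    · have := hsub (Finset.mem_filter.2 ⟨hx, hxy⟩)
      exact h.irrefl x hx (Finset.mem_filter.1 this).2
  have hinj : Set.InjOn rk R := by
    intro x hx y hy e
    by_contra hne
    rcases h.total x hx y hy hne with h' | h'
    · exact absurd e (hlt x hx y hy h').ne
    · exact absurd e (hlt y hy x hx h').ne'
  have himg : R.image rk = Finset.range R.card := by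
    refine Finset.eq_of_subset_of_card_le ?_ ?_
    · intro n hn
      obtain ⟨x, hx, rfl⟩ := Finset.mem_image.1 hn
      refine Finset.mem_range.2 (Finset.card_lt_card ⟨Finset.filter_subset _ _, fun hsub => ?_⟩)
      exact h.irrefl x hx (Finset.mem_filter.1 (hsub hx)).2
    · rw [Finset.card_range, Finset.card_image_of_injOn hinj]
  have : (R.filter (fun x => rk x < c)).image rk = Finset.range c := by
    ext n
    have hn : n ∈ R.image rk ↔ n < R.card := by rw [himg, Finset.mem_range]
    rw [Finset.mem_image] at hn ⊢
    rw [Finset.mem_range]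
    constructor
    · rintro ⟨x, hx, rfl⟩
      exact (Finset.mem_filter.1 hx).2
    · intro h'
      obtain ⟨x, hx, rfl⟩ := hn.2 (by omega)
      exact ⟨x, Finset.mem_filter.2 ⟨hx, h'⟩, rfl⟩
  rw [← Finset.card_image_of_injOn (hinj.mono (Finset.coe_subset.2 (Finset.filter_subset _ _))),
    this, Finset.card_range]

section Counting

open Classical in
/-- Among the vertices of the ribbons of a set that is closed towards the front, there are at least
as many recycled ones as holes. -/
theorem RibbonRegion.card_holes_le {S D : Finset LatticePoint} {pair : Set LatticePoint}
    (hR : RibbonRegion S pair) {V : Finset LatticePoint} (hV : V ⊆ S)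
    (hdown : ∀ y ∈ V, ∀ z ∈ S, RibbonLT S z y → z ∈ V) :
    (V.filter (· ∈ D)).card ≤ (V.filter (IsRecycled S D)).card ∧
      ((∀ y ∈ V, ∀ z ∈ S, ribbonOf S z = ribbonOf S y → z ∈ V) →
        (V.filter (IsRecycled S D)).card ≤ (V.filter (· ∈ D)).card) := by
  have fib : ∀ W : Finset LatticePoint, W ⊆ S → W.card =
      ∑ R ∈ S.image (ribbonOf (S : Set LatticePoint)),
        (W.filter (fun x => ribbonOf (S : Set LatticePoint) x = R)).card := fun W hW =>
    Finset.card_eq_sum_card_fiberwise fun x hx => Finset.mem_image_of_mem _ (hW hx)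
  -- the ribbon through `x`, its holes and its recycled vertices
  have hrib : ∀ x ∈ S, ∀ y, y ∈ S.filter (fun z => ribbonOf (S : Set LatticePoint) z = ribbonOf S x)
      ↔ y ∈ ribbonOf (S : Set LatticePoint) x := by
    intro x hx y
    rw [Finset.mem_filter]
    constructor
    · rintro ⟨hy, e⟩
      rw [← e]; exact mem_ribbonOf_self hy
    · intro hy
      exact ⟨hy.1, ((ribbonOf_eq_iff hy.1).2 hy.2).symm⟩
  have hrank : ∀ x ∈ S, ∀ y ∈ S, ribbonOf (S : Set LatticePoint) y = ribbonOf S x →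
      (IsRecycled S D y ↔
        ((S.filter (fun z => ribbonOf (S : Set LatticePoint) z = ribbonOf S x)).filter
          (fun z => RibbonLT S z y)).card <
        ((S.filter (fun z => ribbonOf (S : Set LatticePoint) z = ribbonOf S x)).filter
          (· ∈ D)).card) := by
    intro x hx y hy e
    have e1 : {z | z ∈ S ∧ RibbonLT S z y} =
        (((S.filter (fun z => ribbonOf (S : Set LatticePoint) z = ribbonOf S x)).filter
          (fun z => RibbonLT S z y) : Finset LatticePoint) : Set LatticePoint) := by
      ext z
      simp only [Finset.coe_filter, Set.mem_ofPred_eq, Finset.mem_filter]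
      constructor
      · rintro ⟨hz, hzy⟩
        exact ⟨⟨hz, ((ribbonOf_eq_iff hy).2 hzy.sameRibbon).trans e⟩, hzy⟩
      · rintro ⟨⟨hz, -⟩, hzy⟩
        exact ⟨hz, hzy⟩
    have e2 : ribbonOf (S : Set LatticePoint) y ∩ D =
        (((S.filter (fun z => ribbonOf (S : Set LatticePoint) z = ribbonOf S x)).filter
          (· ∈ D) : Finset LatticePoint) : Set LatticePoint) := by
      ext z
      rw [e, Finset.mem_coe, Finset.mem_filter, hrib x hx z]
      exact Iff.rfl
    unfold IsRecycled
    rw [e1, e2, Set.ncard_coe_finset, Set.ncard_coe_finset]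
  -- on each ribbon there are as many recycled vertices as holes
  have hcount : ∀ x ∈ S,
      ((S.filter (fun z => ribbonOf (S : Set LatticePoint) z = ribbonOf S x)).filter
        (IsRecycled S D)).card =
      ((S.filter (fun z => ribbonOf (S : Set LatticePoint) z = ribbonOf S x)).filter
          (· ∈ D)).card := by
    intro x hx
    have hstrict : StrictOn (RibbonLT (S : Set LatticePoint))
        (S.filter (fun z => ribbonOf (S : Set LatticePoint) z = ribbonOf S x) :
          Finset LatticePoint) := by
      refine ⟨fun y _ => hR.acyclic y, fun _ _ _ _ _ _ => RibbonLT.trans, ?_⟩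
      intro y hy z hz hne
      have hy' := (hrib x hx y).1 hy
      have hz' := (hrib x hx z).1 hz
      exact (hR.ribbonLT_total (SameRibbon.trans (SameRibbon.symm hy'.2) hz'.2)).resolve_left hne
    have := card_filter_rank_lt hstrict (Finset.card_le_card
      (Finset.filter_subset (· ∈ D) _))
    rw [← this]
    congr 1
    refine Finset.filter_congr fun y hy => ?_
    rw [Finset.mem_filter] at hy
    exact hrank x hx y hy.1 hy.2
  constructor
  · rw [fib _ ((Finset.filter_subset _ _).trans hV), fib _ ((Finset.filter_subset _ _).trans hV)]
    refine Finset.sum_le_sum fun R hRm => ?_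
    obtain ⟨x, hx, rfl⟩ := Finset.mem_image.1 hRm
    by_cases hall : ∀ y ∈ V, ribbonOf (S : Set LatticePoint) y = ribbonOf S x → IsRecycled S D y
    · refine Finset.card_le_card fun y hy => ?_
      rw [Finset.mem_filter, Finset.mem_filter] at hy ⊢
      exact ⟨⟨hy.1.1, hall y hy.1.1 hy.2⟩, hy.2⟩
    · push Not at hall
      obtain ⟨a, haV, hax, harec⟩ := hall
      calc ((V.filter (· ∈ D)).filter
            (fun z => ribbonOf (S : Set LatticePoint) z = ribbonOf S x)).card
          ≤ ((S.filter (fun z => ribbonOf (S : Set LatticePoint) z = ribbonOf S x)).filter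
            (· ∈ D)).card := by
            refine Finset.card_le_card fun y hy => ?_
            simp only [Finset.mem_filter] at hy ⊢
            exact ⟨⟨hV hy.1.1, hy.2⟩, hy.1.2⟩
        _ = ((S.filter (fun z => ribbonOf (S : Set LatticePoint) z = ribbonOf S x)).filter
            (IsRecycled S D)).card := (hcount x hx).symm
        _ ≤ _ := by
            refine Finset.card_le_card fun y hy => ?_
            simp only [Finset.mem_filter] at hy ⊢
            obtain ⟨⟨hyS, hyx⟩, hyr⟩ := hy
            refine ⟨⟨?_, hyr⟩, hyx⟩
            have haS := hV haV
            -- a recycled vertex lies in front of one that is not recycled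
            rcases hR.ribbonLT_total ((ribbonOf_eq_iff haS).1 (hyx.trans hax.symm)) with h | h | h
            · rwa [h]
            · exact hdown a haV y hyS h
            · refine absurd ?_ harec
              rw [hrank x hx a haS hax]
              rw [hrank x hx y hyS hyx] at hyr
              refine lt_of_le_of_lt (Finset.card_le_card fun z hz => ?_) hyr
              simp only [Finset.mem_filter] at hz ⊢
              exact ⟨hz.1, hz.2.trans h⟩
  · intro hfull
    rw [fib _ ((Finset.filter_subset _ _).trans hV), fib _ ((Finset.filter_subset _ _).trans hV)]
    refine Finset.sum_le_sum fun R hRm => ?_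
    obtain ⟨x, hx, rfl⟩ := Finset.mem_image.1 hRm
    by_cases hex : ∃ y ∈ V, ribbonOf (S : Set LatticePoint) y = ribbonOf S x
    · obtain ⟨y, hyV, hyx⟩ := hex
      refine le_trans (Finset.card_le_card fun z hz => ?_) ((hcount x hx).le.trans
        (Finset.card_le_card fun z hz => ?_))
      · simp only [Finset.mem_filter] at hz ⊢
        exact ⟨⟨hV hz.1.1, hz.2⟩, hz.1.2⟩
      · simp only [Finset.mem_filter] at hz ⊢
        exact ⟨⟨hfull y hyV z hz.1.1 (hz.1.2.trans hyx.symm), hz.2⟩, hz.1.2⟩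
    · push Not at hex
      rw [Finset.card_eq_zero.2]
      · exact Nat.zero_le _
      · refine Finset.filter_eq_empty_iff.2 fun z hz => hex z (Finset.mem_filter.1 hz).1

end Counting

/-! ### The movement sequences -/

/-- The assumptions on the shape, the idle robots and the order of the ribbons, in the form in which
they enter the analysis of the movement sequences. -/
structure Scenario (S D J : Finset LatticePoint)
    (lt : Set LatticePoint → Set LatticePoint → Prop) : Prop where
  region : RibbonRegion S {p₁, p₂}
  row : ∀ x ∈ S, 2 ≤ x.2
  boundary : ∀ x ∈ S, ∀ y, y ∉ S → lattice.Adj x y → x ∉ D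
  order : IsCompleteTreeOrder S lt
  idle : IdlePlacement J
  enough : S.card ≤ J.card

/-- The order in which the robots of the shape are reactivated. -/
def ReactLT (S : Finset LatticePoint) (lt : Set LatticePoint → Set LatticePoint → Prop) :
    LatticePoint → LatticePoint → Prop := RibbonLex S (fun Q R => lt R Q) (RibbonLT S)

open Classical in
/-- The complementary form of `RibbonRegion.card_holes_le`. -/
theorem card_not_recycled {S D : Finset LatticePoint} {pair : Set LatticePoint}
    (hR : RibbonRegion S pair) {V : Finset LatticePoint} (hV : V ⊆ S)
    (hdown : ∀ y ∈ V, ∀ z ∈ S, RibbonLT S z y → z ∈ V) :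
    (V.filter (¬ IsRecycled S D ·)).card ≤ (V \ D).card ∧
      ((∀ y ∈ V, ∀ z ∈ S, ribbonOf S z = ribbonOf S y → z ∈ V) →
        (V \ D).card = (V.filter (¬ IsRecycled S D ·)).card) := by
  obtain ⟨h1, h2⟩ := hR.card_holes_le (D := D) hV hdown
  have e1 := Finset.card_filter_add_card_filter_not (s := V) (IsRecycled S D)
  have e2 := Finset.card_filter_add_card_filter_not (s := V) (· ∈ D)
  rw [← Finset.sdiff_eq_filter] at e2
  refine ⟨by omega, fun h => ?_⟩
  have := h2 h
  omega

theorem strictOn_ite {p : Prop} [Decidable p] {lt lt' : LatticePoint → LatticePoint → Prop}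
    {C C' : Finset LatticePoint} (h : StrictOn lt C) (h' : StrictOn lt' C') :
    StrictOn (if p then lt else lt') ((if p then C else C' : Finset LatticePoint)) := by
  split_ifs
  · exact h
  · exact h'

namespace Scenario

variable {S D J : Finset LatticePoint} {lt : Set LatticePoint → Set LatticePoint → Prop}

theorem idle_row (h : Scenario S D J lt) {x : LatticePoint} (hx : x ∈ J) : x.2 ≤ -2 :=
  h.idle.subset x hx

theorem strictOn_react (h : Scenario S D J lt) : StrictOn (ReactLT S lt) S :=
  h.region.strictOn_reactivation h.order

theorem image_eq {S : Finset LatticePoint} {u : Fin S.card → LatticePoint}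
    (hinj : Function.Injective u) (hmem : ∀ k, u k ∈ S) : Finset.univ.image u = S := by
  refine Finset.eq_of_subset_of_card_le ?_ ?_
  · intro x hx
    obtain ⟨k, -, rfl⟩ := Finset.mem_image.1 hx
    exact hmem k
  · rw [Finset.card_image_of_injective _ hinj, Finset.card_univ, Fintype.card_fin]

open Classical in
/-- There are as many rearranged robots as points in the desired shape. -/
theorem card_rearranged (h : Scenario S D J lt) {u : Fin S.card → LatticePoint}
    (hinj : Function.Injective u) (hmem : ∀ k, u k ∈ S) :
    (Finset.univ.filter (fun k => ¬ IsRecycled S D (u k))).card = (S \ D).card := by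
  have e := congrArg (fun T => (T.filter (¬ IsRecycled S D ·)).card) (image_eq hinj hmem)
  beta_reduce at e
  rw [Finset.filter_image, Finset.card_image_of_injective _ hinj] at e
  rw [(card_not_recycled h.region subset_rfl (fun _ _ z hz _ => hz)).2
    (fun _ _ z hz _ => hz), e]

/-- The movement sequences exist and are unique. -/
theorem existsUnique_plan (h : Scenario S D J lt) :
    ∃! q : MovementPlan S.card, IsAddSubtractPlan S D J lt q := by
  classical
  have hconst : ∀ {C : Finset LatticePoint} {l : LatticePoint → LatticePoint → Prop},
      StrictOn l C → S.card ≤ C.card → ∃! u : Fin S.card → LatticePoint,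
        ∀ k, IsFirstFor l (remaining C u k) (u k) := fun {C l} hl hC =>
    existsUnique_greedy (lt := fun _ => l) (C := fun _ => C) (fun _ => hl) (fun _ _ => Or.inl rfl)
      (fun k => card_earlier_lt _ k hC)
  have hJ : (J : Set LatticePoint) ⊆ idleHalf := fun x hx => h.idle.subset x hx
  obtain ⟨s, hs, hs'⟩ := hconst (strictOn_ribbonLex_idle_rev.mono hJ) h.enough
  obtain ⟨t, ht, ht'⟩ := hconst (h.region.strictOn_assembly h.order) le_rfl
  obtain ⟨sr, hsr, hsr'⟩ := hconst (h.region.strictOn_reactivation h.order) le_rfl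
  have hsJ : ∀ k, s k ∈ J := greedy_mem (C := fun _ => (J : Set LatticePoint)) hs
  have hsinj : Function.Injective s := greedy_injective (C := fun _ => (J : Set LatticePoint)) hs
  have hsrS : ∀ k, sr k ∈ S := greedy_mem (C := fun _ => (S : Set LatticePoint)) hsr
  have hsrinj : Function.Injective sr :=
    greedy_injective (C := fun _ => (S : Set LatticePoint)) hsr
  have hdisj : Disjoint (Finset.univ.image s) (S \ D) := by
    rw [Finset.disjoint_left]
    intro x hx hxS
    obtain ⟨k, -, rfl⟩ := Finset.mem_image.1 hx
    have h1 := h.idle_row (hsJ k)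
    have h2 := h.row _ (Finset.mem_sdiff.1 hxS).1
    omega
  have hcards : (Finset.univ.image s).card = S.card := by
    rw [Finset.card_image_of_injective _ hsinj, Finset.card_univ, Fintype.card_fin]
  -- in the reassembly sequence the candidates and their order depend on the round
  -- (vacated idle points or points of the desired shape), and the two candidate sets are disjoint
  let C : Fin S.card → Finset LatticePoint := fun k =>
    if IsRecycled S D (sr k) then Finset.univ.image s else S \ D
  let l : Fin S.card → LatticePoint → LatticePoint → Prop := fun k =>
    if IsRecycled S D (sr k) then RibbonLex idleHalf (TreeLT idleHalf) (RibbonLT idleHalf)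
    else RibbonLex S (fun Q R => lt R Q) (RibbonLT S)
  obtain ⟨tr, htr, htr'⟩ := existsUnique_greedy (lt := l) (C := C) (by
      intro k
      refine strictOn_ite (strictOn_ribbonLex_idle.mono ?_)
        ((h.region.strictOn_reactivation h.order).mono ?_)
      · intro x hx
        obtain ⟨k, -, rfl⟩ := Finset.mem_image.1 (Finset.mem_coe.1 hx)
        exact hJ (hsJ k)
      · exact Finset.coe_subset.2 Finset.sdiff_subset) (by
      intro j k
      simp only [C]
      split_ifs
      · exact Or.inl rfl
      · exact Or.inr hdisj
      · exact Or.inr hdisj.symm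
      · exact Or.inl rfl) (by
      intro k
      by_cases hk : IsRecycled S D (sr k)
      · refine card_earlier_lt _ k (le_of_eq ?_)
        simp only [C, if_pos hk]
        exact hcards.symm
      · simp only [C, if_neg hk]
        rw [← h.card_rearranged hsrinj hsrS]
        refine Finset.card_lt_card ⟨fun j hj => ?_, fun hsub => ?_⟩
        · rw [Finset.mem_filter] at hj ⊢
          refine ⟨hj.1, fun hjr => ?_⟩
          have e := hj.2.2
          rw [if_pos hjr] at e
          have h1 : (Finset.univ.image s).card = 0 := by
            rw [Finset.card_eq_zero, ← Finset.disjoint_self_iff_empty]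
            nth_rewrite 2 [e]
            exact hdisj
          rw [hcards] at h1
          exact absurd k.2 (by omega)
        · have := hsub (Finset.mem_filter.2 ⟨Finset.mem_univ k, hk⟩)
          exact absurd (Finset.mem_filter.1 this).2.1 (lt_irrefl _))
  have hsplit : ∀ u : Fin S.card → LatticePoint,
      (∀ k, IsFirstFor (l k) (remaining (C k) u k) (u k)) ↔
      (∀ k, IsRecycled S D (sr k) → IsFirstFor
        (RibbonLex idleHalf (TreeLT idleHalf) (RibbonLT idleHalf))
        (remaining (Set.range s) u k) (u k)) ∧
      (∀ k, ¬ IsRecycled S D (sr k) → IsFirstFor (RibbonLex S (fun Q R => lt R Q) (RibbonLT S))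
        (remaining ((S \ D : Finset LatticePoint) : Set LatticePoint) u k) (u k)) := by
    intro u
    have e : ((Finset.univ.image s : Finset LatticePoint) : Set LatticePoint) = Set.range s := by
      simp
    rw [← forall_and]
    refine forall_congr' fun k => ?_
    by_cases hk : IsRecycled S D (sr k)
    · simp only [l, C, if_pos hk, e]
      tauto
    · simp only [l, C, if_neg hk]
      tauto
  refine ⟨⟨s, t, sr, tr⟩, ⟨hs, ht, hsr, ((hsplit tr).1 htr).1, ((hsplit tr).1 htr).2⟩, ?_⟩
  rintro ⟨s₁, t₁, sr₁, tr₁⟩ hq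
  obtain rfl := hs' s₁ hq.activation
  obtain rfl := ht' t₁ hq.assembly
  obtain rfl := hsr' sr₁ hq.reactivation
  obtain rfl := htr' tr₁ ((hsplit tr₁).2 ⟨hq.recycle, hq.rearrange⟩)
  rfl

section Facts

variable {q : MovementPlan S.card}

theorem s_mem (hq : IsAddSubtractPlan S D J lt q) (k : Fin S.card) : q.s k ∈ J :=
  greedy_mem (C := fun _ => (J : Set LatticePoint)) hq.activation k

theorem s_injective (hq : IsAddSubtractPlan S D J lt q) : Function.Injective q.s :=
  greedy_injective (C := fun _ => (J : Set LatticePoint)) hq.activation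

theorem s_mono (h : Scenario S D J lt) (hq : IsAddSubtractPlan S D J lt q) {j k : Fin S.card}
    (hjk : j < k) : IdleLT (q.s k) (q.s j) :=
  (ribbonLex_idle_rev_iff (h.idle.subset _ (s_mem hq j)) (h.idle.subset _ (s_mem hq k))).1
    (greedy_mono (C := fun _ => (J : Set LatticePoint)) hq.activation hjk rfl)

/-- The activated robots are the largest ones. -/
theorem s_downward (h : Scenario S D J lt) (hq : IsAddSubtractPlan S D J lt q) {k : Fin S.card}
    {y : LatticePoint} (hy : y ∈ J) (hyk : IdleLT (q.s k) y) : ∃ j < k, q.s j = y := by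
  have hJ : (J : Set LatticePoint) ⊆ idleHalf := fun x hx => h.idle.subset x hx
  exact greedy_downward (C := fun _ => (J : Set LatticePoint)) hq.activation
    (strictOn_ribbonLex_idle_rev.mono hJ) hy
    ((ribbonLex_idle_rev_iff (hJ hy) (hJ (s_mem hq k))).2 hyk)

theorem t_mem (hq : IsAddSubtractPlan S D J lt q) (k : Fin S.card) : q.t k ∈ S :=
  greedy_mem (C := fun _ => (S : Set LatticePoint)) hq.assembly k

theorem t_injective (hq : IsAddSubtractPlan S D J lt q) : Function.Injective q.t :=
  greedy_injective (C := fun _ => (S : Set LatticePoint)) hq.assembly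

theorem t_downward (h : Scenario S D J lt) (hq : IsAddSubtractPlan S D J lt q) {k : Fin S.card}
    {y : LatticePoint} (hy : y ∈ S) (hyk : RibbonLex S lt (RibbonLT S) y (q.t k)) :
    ∃ j < k, q.t j = y :=
  greedy_downward (C := fun _ => (S : Set LatticePoint)) hq.assembly
    (h.region.strictOn_assembly h.order) hy hyk

theorem sr_mem (hq : IsAddSubtractPlan S D J lt q) (k : Fin S.card) : q.sr k ∈ S :=
  greedy_mem (C := fun _ => (S : Set LatticePoint)) hq.reactivation k

theorem sr_injective (hq : IsAddSubtractPlan S D J lt q) : Function.Injective q.sr :=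
  greedy_injective (C := fun _ => (S : Set LatticePoint)) hq.reactivation

theorem sr_surjective (hq : IsAddSubtractPlan S D J lt q) {x : LatticePoint} (hx : x ∈ S) :
    ∃ k, q.sr k = x := by
  rw [← image_eq (sr_injective hq) (sr_mem hq)] at hx
  obtain ⟨k, -, hk⟩ := Finset.mem_image.1 hx
  exact ⟨k, hk⟩

theorem t_surjective (hq : IsAddSubtractPlan S D J lt q) {x : LatticePoint} (hx : x ∈ S) :
    ∃ k, q.t k = x := by
  rw [← image_eq (t_injective hq) (t_mem hq)] at hx
  obtain ⟨k, -, hk⟩ := Finset.mem_image.1 hx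
  exact ⟨k, hk⟩

theorem sr_mono (hq : IsAddSubtractPlan S D J lt q) {j k : Fin S.card} (hjk : j < k) :
    ReactLT S lt (q.sr j) (q.sr k) :=
  greedy_mono (C := fun _ => (S : Set LatticePoint)) hq.reactivation hjk rfl

theorem sr_lt_iff (h : Scenario S D J lt) (hq : IsAddSubtractPlan S D J lt q)
    {j k : Fin S.card} : ReactLT S lt (q.sr j) (q.sr k) ↔ j < k := by
  refine ⟨fun hl => ?_, sr_mono hq⟩
  by_contra hn
  rcases (not_lt.1 hn).eq_or_lt with e | e
  · rw [e] at hl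
    exact h.strictOn_react.irrefl _ (sr_mem hq j) hl
  · exact h.strictOn_react.asymm (sr_mem hq j) (sr_mem hq k) hl (sr_mono hq e)

open Classical in
theorem tr_spec (hq : IsAddSubtractPlan S D J lt q) (k : Fin S.card) :
    IsFirstFor (if IsRecycled S D (q.sr k) then
        RibbonLex idleHalf (TreeLT idleHalf) (RibbonLT idleHalf) else ReactLT S lt)
      (remaining (if IsRecycled S D (q.sr k) then Set.range q.s
        else ((S \ D : Finset LatticePoint) : Set LatticePoint)) q.tr k) (q.tr k) := by
  by_cases hk : IsRecycled S D (q.sr k)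
  · rw [if_pos hk, if_pos hk]; exact hq.recycle k hk
  · rw [if_neg hk, if_neg hk]; exact hq.rearrange k hk

theorem tr_injective (hq : IsAddSubtractPlan S D J lt q) : Function.Injective q.tr := by
  classical
  exact greedy_injective (tr_spec hq)

theorem tr_mem_range (hq : IsAddSubtractPlan S D J lt q) {k : Fin S.card}
    (hk : IsRecycled S D (q.sr k)) : q.tr k ∈ Set.range q.s := (hq.recycle k hk).1.1

theorem tr_mem_idle (hq : IsAddSubtractPlan S D J lt q) {k : Fin S.card}
    (hk : IsRecycled S D (q.sr k)) : q.tr k ∈ J := by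
  obtain ⟨j, hj⟩ := tr_mem_range hq hk
  rw [← hj]; exact s_mem hq j

theorem tr_mem_sdiff (hq : IsAddSubtractPlan S D J lt q) {k : Fin S.card}
    (hk : ¬ IsRecycled S D (q.sr k)) : q.tr k ∈ S \ D := (hq.rearrange k hk).1.1

theorem not_recycled_of_mem (h : Scenario S D J lt) (hq : IsAddSubtractPlan S D J lt q)
    {k : Fin S.card} (hk : q.tr k ∈ S) : ¬ IsRecycled S D (q.sr k) := fun hr => by
  have h1 := h.row _ hk
  have h2 := h.idle_row (tr_mem_idle hq hr)
  omega

theorem tr_mono (hq : IsAddSubtractPlan S D J lt q) {j k : Fin S.card} (hjk : j < k)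
    (hj : ¬ IsRecycled S D (q.sr j)) (hk : ¬ IsRecycled S D (q.sr k)) :
    ReactLT S lt (q.tr j) (q.tr k) := by
  classical
  have := greedy_mono (tr_spec hq) hjk (by rw [if_neg hj, if_neg hk])
  rwa [if_neg hj] at this

theorem tr_downward (h : Scenario S D J lt) (hq : IsAddSubtractPlan S D J lt q) {k : Fin S.card}
    (hk : ¬ IsRecycled S D (q.sr k)) {y : LatticePoint} (hy : y ∈ S \ D)
    (hyk : ReactLT S lt y (q.tr k)) :
    ∃ j < k, ¬ IsRecycled S D (q.sr j) ∧ q.tr j = y := by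
  classical
  obtain ⟨j, hj, e⟩ := greedy_downward (tr_spec hq) (k := k)
    (by rw [if_neg hk, if_neg hk]
        exact h.strictOn_react.mono (Finset.coe_subset.2 Finset.sdiff_subset))
    (y := y) (by rw [if_neg hk]; exact hy) (by rwa [if_neg hk])
  exact ⟨j, hj, h.not_recycled_of_mem hq (e ▸ (Finset.mem_sdiff.1 hy).1), e⟩

/-- The vacated idle points are refilled starting with the smallest ones. -/
theorem tr_downward_idle (h : Scenario S D J lt) (hq : IsAddSubtractPlan S D J lt q)
    {k : Fin S.card} (hk : IsRecycled S D (q.sr k)) {i : Fin S.card}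
    (hyk : IdleLT (q.s i) (q.tr k)) :
    ∃ j < k, IsRecycled S D (q.sr j) ∧ q.tr j = q.s i := by
  classical
  have hJ : ∀ i, q.s i ∈ idleHalf := fun i => h.idle.subset _ (s_mem hq i)
  obtain ⟨j, hj, e⟩ := greedy_downward (tr_spec hq) (k := k)
    (by rw [if_pos hk, if_pos hk]
        refine strictOn_ribbonLex_idle.mono ?_
        rintro _ ⟨i, rfl⟩
        exact hJ i)
    (y := q.s i) (by rw [if_pos hk]; exact ⟨i, rfl⟩)
    (by rw [if_pos hk]
        exact (ribbonLex_idle_iff (hJ i) (h.idle.subset _ (tr_mem_idle hq hk))).2 hyk)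
  refine ⟨j, hj, ?_, e⟩
  by_contra hr
  have h1 := h.row _ (Finset.mem_sdiff.1 (tr_mem_sdiff hq hr)).1
  have h2 := h.idle_row (s_mem hq i)
  rw [e] at h1
  omega

theorem tr_surjective (h : Scenario S D J lt) (hq : IsAddSubtractPlan S D J lt q)
    {x : LatticePoint} (hx : x ∈ S \ D) : ∃ k, ¬ IsRecycled S D (q.sr k) ∧ q.tr k = x := by
  classical
  have : (Finset.univ.filter (fun k => ¬ IsRecycled S D (q.sr k))).image q.tr = S \ D := by
    refine Finset.eq_of_subset_of_card_le ?_ ?_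
    · intro y hy
      obtain ⟨k, hk, rfl⟩ := Finset.mem_image.1 hy
      exact tr_mem_sdiff hq (Finset.mem_filter.1 hk).2
    · rw [Finset.card_image_of_injective _ (tr_injective hq),
        h.card_rearranged (sr_injective hq) (sr_mem hq)]
  rw [← this] at hx
  obtain ⟨k, hk, e⟩ := Finset.mem_image.1 hx
  exact ⟨k, (Finset.mem_filter.1 hk).2, e⟩

/-- A rearranged robot stays on its ribbon and moves to the front, or not at all. Otherwise there
would be, among the points that precede its start or its target, too many or too few vertices
outside the holes. -/
theorem tr_eq_or_lt (h : Scenario S D J lt) (hq : IsAddSubtractPlan S D J lt q) {k : Fin S.card}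
    (hk : ¬ IsRecycled S D (q.sr k)) :
    q.tr k = q.sr k ∨ RibbonLT S (q.tr k) (q.sr k) := by
  classical
  have hst := h.strictOn_react
  have haS := sr_mem hq k
  obtain ⟨hbS, hbD⟩ := Finset.mem_sdiff.1 (tr_mem_sdiff hq hk)
  set K := Finset.univ.filter (fun j : Fin S.card => j < k ∧ ¬ IsRecycled S D (q.sr j)) with hK
  -- the rearranged robots before the `k`-th one start and stop at equally many points
  have ha : (S.filter (fun y => ¬ IsRecycled S D y ∧ ReactLT S lt y (q.sr k))).card = K.card := by
    rw [← Finset.card_image_of_injective K (sr_injective hq)]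
    congr 1
    ext y
    simp only [Finset.mem_filter, Finset.mem_image, hK, Finset.mem_univ, true_and]
    constructor
    · rintro ⟨hy, hyr, hyk⟩
      obtain ⟨j, rfl⟩ := sr_surjective hq hy
      exact ⟨j, ⟨(h.sr_lt_iff hq).1 hyk, hyr⟩, rfl⟩
    · rintro ⟨j, ⟨hj, hjr⟩, rfl⟩
      exact ⟨sr_mem hq j, hjr, sr_mono hq hj⟩
  have hb : ((S \ D).filter (fun y => ReactLT S lt y (q.tr k))).card = K.card := by
    rw [← Finset.card_image_of_injective K (tr_injective hq)]
    congr 1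
    ext y
    simp only [Finset.mem_filter, Finset.mem_image, hK, Finset.mem_univ, true_and]
    constructor
    · rintro ⟨hy, hyk⟩
      obtain ⟨j, hj, hjr, rfl⟩ := h.tr_downward hq hk hy hyk
      exact ⟨j, ⟨hj, hjr⟩, rfl⟩
    · rintro ⟨j, ⟨hj, hjr⟩, rfl⟩
      exact ⟨tr_mem_sdiff hq hjr, tr_mono hq hj hjr hk⟩
  by_cases hab : q.tr k = q.sr k
  · exact Or.inl hab
  rcases hst.total _ hbS _ haS hab with hlt | hlt
  · rcases hlt with hlt | ⟨-, hlt⟩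
    · exfalso
      -- all ribbons from that of the target on
      set V := S.filter (fun y => lt (ribbonOf S (q.tr k)) (ribbonOf S y) ∨
        ribbonOf (S : Set LatticePoint) y = ribbonOf S (q.tr k)) with hV
      have hfull : ∀ y ∈ V, ∀ z ∈ S, ribbonOf (S : Set LatticePoint) z = ribbonOf S y → z ∈ V := by
        intro y hy z hz e
        rw [hV, Finset.mem_filter] at hy ⊢
        exact ⟨hz, by rw [e]; exact hy.2⟩
      -- all rearranged robots that start in `V` start before the `k`-th one, but its target is one
      -- more point of `V \ D` than the targets before it
      have hc : (V \ D).card = (V.filter (¬ IsRecycled S D ·)).card :=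
        (card_not_recycled h.region (Finset.filter_subset _ _) (fun y hy z hz hzy => hfull y hy z hz
          ((ribbonOf_eq_iff (Finset.mem_filter.1 hy).1).2 hzy.sameRibbon))).2 hfull
      have h1 : insert (q.tr k) ((S \ D).filter (fun y => ReactLT S lt y (q.tr k))) ⊆ V \ D := by
        intro y hy
        rw [Finset.mem_sdiff, hV, Finset.mem_filter]
        rcases Finset.mem_insert.1 hy with rfl | hy
        · exact ⟨⟨hbS, Or.inr rfl⟩, hbD⟩
        · rw [Finset.mem_filter, Finset.mem_sdiff] at hy
          exact ⟨⟨hy.1.1, hy.2.imp id (fun h => h.1)⟩, hy.1.2⟩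
      have h2 : V.filter (¬ IsRecycled S D ·) ⊆
          S.filter (fun y => ¬ IsRecycled S D y ∧ ReactLT S lt y (q.sr k)) := by
        intro y hy
        simp only [hV, Finset.mem_filter] at hy ⊢
        refine ⟨hy.1.1, hy.2, Or.inl ?_⟩
        have hm : ∀ {x}, x ∈ S → ribbonOf (S : Set LatticePoint) x ∈ ribbons S :=
          fun hx => ribbonOf_mem_ribbons hx
        rcases hy.1.2 with e | e
        · exact h.order.trans _ (hm haS) _ (hm hbS) _ (hm hy.1.1) hlt e
        · rw [e]; exact hlt
      have h3 := Finset.card_le_card h1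
      have h4 := Finset.card_le_card h2
      rw [Finset.card_insert_of_notMem, hb] at h3
      · omega
      · intro hm
        exact hst.irrefl _ hbS (Finset.mem_filter.1 hm).2
    · exact Or.inr hlt
  · exfalso
    -- all points up to the start
    set V := S.filter (fun y => ReactLT S lt y (q.sr k) ∨ y = q.sr k) with hV
    have hdown : ∀ y ∈ V, ∀ z ∈ S, RibbonLT S z y → z ∈ V := by
      intro y hy z hz hzy
      rw [hV, Finset.mem_filter] at hy ⊢
      have hzy' : ReactLT S lt z y := Or.inr ⟨(ribbonOf_eq_iff hy.1).2 hzy.sameRibbon, hzy⟩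
      refine ⟨hz, Or.inl ?_⟩
      rcases hy.2 with h' | rfl
      · exact hst.trans z hz y hy.1 _ haS hzy' h'
      · exact hzy'
    -- all points of `V \ D` are targets before the `k`-th one, but its start is one more point of
    -- `V` that is not recycled than the starts before it
    have hc : (V.filter (¬ IsRecycled S D ·)).card ≤ (V \ D).card :=
      (card_not_recycled h.region (Finset.filter_subset _ _) hdown).1
    have h1 : insert (q.sr k) (S.filter (fun y => ¬ IsRecycled S D y ∧
        ReactLT S lt y (q.sr k))) ⊆ V.filter (¬ IsRecycled S D ·) := by
      intro y hy
      rw [hV, Finset.mem_filter, Finset.mem_filter]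
      rcases Finset.mem_insert.1 hy with rfl | hy
      · exact ⟨⟨haS, Or.inr rfl⟩, hk⟩
      · rw [Finset.mem_filter] at hy
        exact ⟨⟨hy.1, Or.inl hy.2.2⟩, hy.2.1⟩
    have h2 : V \ D ⊆ (S \ D).filter (fun y => ReactLT S lt y (q.tr k)) := by
      intro y hy
      rw [Finset.mem_sdiff, hV, Finset.mem_filter] at hy
      rw [Finset.mem_filter, Finset.mem_sdiff]
      refine ⟨⟨hy.1.1, hy.2⟩, ?_⟩
      rcases hy.1.2 with e | rfl
      · exact hst.trans y hy.1.1 _ haS _ hbS e hlt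
      · exact hlt
    have h3 := Finset.card_le_card h1
    have h4 := Finset.card_le_card h2
    rw [Finset.card_insert_of_notMem, ha] at h3
    · rw [hb] at h4
      omega
    · intro hm
      exact hst.irrefl _ haS (Finset.mem_filter.1 hm).2.2

end Facts

end Scenario

/-! ### The occupied positions -/

theorem entriesBefore_succ {M : ℕ} (u : Fin M → LatticePoint) (n : Fin M) :
    entriesBefore u (n.val + 1) = u n ::ₘ entriesBefore u n.val := by
  have : Finset.univ.filter (fun i : Fin M => i.val < n.val + 1) =
      insert n (Finset.univ.filter (fun i : Fin M => i.val < n.val)) := by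
    ext i
    simp only [Finset.mem_filter, Finset.mem_univ, true_and, Finset.mem_insert, Fin.ext_iff]
    omega
  rw [entriesBefore, this, Finset.insert_val_of_notMem (by simp), Multiset.map_cons]
  rfl

/-- If the occupied positions form sets that change by one move per epoch, then `config` is given
by these sets. -/
theorem config_eq {M : ℕ} {I : Multiset LatticePoint} {a b : Fin M → LatticePoint}
    {F : ℕ → Finset LatticePoint} (h0 : (F 0).val = I) (ha : ∀ n : Fin M, a n ∈ F n)
    (hb : ∀ n : Fin M, b n ∉ (F n).erase (a n))
    (hF : ∀ n : Fin M, F (n.val + 1) = insert (b n) ((F n).erase (a n))) (n : ℕ) (hn : n ≤ M) :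
    config I a b n = (F n).val := by
  suffices h : I + entriesBefore b n = (F n).val + entriesBefore a n by
    rw [config, h, Multiset.add_sub_cancel_right]
  induction n with
  | zero => simp [entriesBefore, h0]
  | succ n ih =>
    have h1 := entriesBefore_succ a ⟨n, hn⟩
    have h2 := entriesBefore_succ b ⟨n, hn⟩
    have h3 := hF ⟨n, hn⟩
    dsimp only at h1 h2 h3
    rw [h1, h2, h3, Finset.insert_val_of_notMem (hb ⟨n, hn⟩), Finset.erase_val, Multiset.add_cons,
      ih (by omega), Multiset.cons_add, Multiset.add_cons, ← Multiset.cons_add (a _),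
      Multiset.cons_erase (ha ⟨n, hn⟩)]

theorem stationary_eq {M : ℕ} {I : Multiset LatticePoint} {a b : Fin M → LatticePoint}
    {F : Finset LatticePoint} {n : Fin M} (h : config I a b n = F.val) :
    stationary I a b n = (F.erase (a n)).val := by
  rw [stationary, h, Finset.erase_val, Multiset.sub_singleton]

open Classical in
/-- The entries of `u` with index less than `n` that satisfy `p`. -/
noncomputable def entriesWhere {N : ℕ} (u : Fin N → LatticePoint) (p : Fin N → Prop) (n : ℕ) :
    Finset LatticePoint :=
  (Finset.univ.filter (fun j : Fin N => j.val < n ∧ p j)).image u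

theorem mem_entriesWhere {N : ℕ} {u : Fin N → LatticePoint} {p : Fin N → Prop} {n : ℕ}
    {x : LatticePoint} : x ∈ entriesWhere u p n ↔ ∃ j : Fin N, (j.val < n ∧ p j) ∧ u j = x := by
  simp [entriesWhere]

theorem mem_entriesWhere_succ {N : ℕ} {u : Fin N → LatticePoint} {p : Fin N → Prop} {k : Fin N}
    {x : LatticePoint} : x ∈ entriesWhere u p (k.val + 1) ↔
      x ∈ entriesWhere u p k.val ∨ (p k ∧ x = u k) := by
  rw [mem_entriesWhere, mem_entriesWhere]
  constructor
  · rintro ⟨j, ⟨hj, hp⟩, rfl⟩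
    rcases Nat.lt_succ_iff_lt_or_eq.1 hj with h | h
    · exact Or.inl ⟨j, ⟨h, hp⟩, rfl⟩
    · obtain rfl := Fin.ext h
      exact Or.inr ⟨hp, rfl⟩
  · rintro (⟨j, ⟨hj, hp⟩, rfl⟩ | ⟨hp, rfl⟩)
    · exact ⟨j, ⟨by omega, hp⟩, rfl⟩
    · exact ⟨k, ⟨by omega, hp⟩, rfl⟩

theorem entriesWhere_zero {N : ℕ} {u : Fin N → LatticePoint} {p : Fin N → Prop} :
    entriesWhere u p 0 = ∅ := by
  ext x
  simp [mem_entriesWhere]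

namespace Scenario

variable {S D J : Finset LatticePoint} {lt : Set LatticePoint → Set LatticePoint → Prop}
  {q : MovementPlan S.card}

/-- The occupied idle points after `n` epochs. In the first `S.card` epochs, `n - S.card` is `0`. -/
noncomputable def idlePart (S D J : Finset LatticePoint) (q : MovementPlan S.card) (n : ℕ) :
    Finset LatticePoint :=
  (J \ entriesWhere q.s (fun _ => True) n) ∪
    entriesWhere q.tr (fun j => IsRecycled S D (q.sr j)) (n - S.card)

/-- The occupied points of the formation half-plane after `n` epochs. -/
noncomputable def shapePart (S D : Finset LatticePoint) (q : MovementPlan S.card) (n : ℕ) :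
    Finset LatticePoint :=
  (entriesWhere q.t (fun _ => True) n \ entriesWhere q.sr (fun _ => True) (n - S.card)) ∪
    entriesWhere q.tr (fun j => ¬ IsRecycled S D (q.sr j)) (n - S.card)

/-- All occupied positions after `n` epochs. -/
noncomputable def robots (S D J : Finset LatticePoint) (q : MovementPlan S.card) (n : ℕ) :
    Finset LatticePoint :=
  seeds ∪ idlePart S D J q n ∪ shapePart S D q n

theorem seed_row : ∀ x ∈ seeds, -1 ≤ x.2 ∧ x.2 ≤ 1 := by decide

theorem idlePart_subset (hq : IsAddSubtractPlan S D J lt q) (n : ℕ) :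
    idlePart S D J q n ⊆ J := by
  intro x hx
  rcases Finset.mem_union.1 hx with hx | hx
  · exact (Finset.mem_sdiff.1 hx).1
  · obtain ⟨j, ⟨-, hj⟩, rfl⟩ := mem_entriesWhere.1 hx
    exact tr_mem_idle hq hj

theorem shapePart_subset (hq : IsAddSubtractPlan S D J lt q) (n : ℕ) :
    shapePart S D q n ⊆ S := by
  intro x hx
  rcases Finset.mem_union.1 hx with hx | hx
  · obtain ⟨j, -, rfl⟩ := mem_entriesWhere.1 (Finset.mem_sdiff.1 hx).1
    exact t_mem hq j
  · obtain ⟨j, ⟨-, hj⟩, rfl⟩ := mem_entriesWhere.1 hx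
    exact (Finset.mem_sdiff.1 (tr_mem_sdiff hq hj)).1

theorem idlePart_row (h : Scenario S D J lt) (hq : IsAddSubtractPlan S D J lt q) {n : ℕ}
    {x : LatticePoint} (hx : x ∈ idlePart S D J q n) : x.2 ≤ -2 :=
  h.idle_row (idlePart_subset hq n hx)

theorem shapePart_row (h : Scenario S D J lt) (hq : IsAddSubtractPlan S D J lt q) {n : ℕ}
    {x : LatticePoint} (hx : x ∈ shapePart S D q n) : 2 ≤ x.2 :=
  h.row _ (shapePart_subset hq n hx)

theorem mem_robots {n : ℕ} {x : LatticePoint} : x ∈ robots S D J q n ↔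
    x ∈ seeds ∨ x ∈ idlePart S D J q n ∨ x ∈ shapePart S D q n := by
  simp only [robots, Finset.mem_union, or_assoc]

theorem mem_idlePart_add {k : Fin S.card} {x : LatticePoint} :
    x ∈ idlePart S D J q k.val ↔ x ∈ J ∧ ∀ j < k, q.s j ≠ x := by
  have e : k.val - S.card = 0 := by omega
  simp only [idlePart, e, entriesWhere_zero, Finset.union_empty, Finset.mem_sdiff,
    mem_entriesWhere, and_true, not_exists, not_and]
  rfl

theorem mem_shapePart_add {k : Fin S.card} {x : LatticePoint} :
    x ∈ shapePart S D q k.val ↔ ∃ j < k, q.t j = x := by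
  have e : k.val - S.card = 0 := by omega
  simp only [shapePart, e, entriesWhere_zero, Finset.union_empty, Finset.sdiff_empty,
    mem_entriesWhere, and_true]
  rfl

theorem mem_idlePart_sub {k : ℕ} {x : LatticePoint} :
    x ∈ idlePart S D J q (S.card + k) ↔ (x ∈ J ∧ ∀ j, q.s j ≠ x) ∨
      ∃ j : Fin S.card, (j.val < k ∧ IsRecycled S D (q.sr j)) ∧ q.tr j = x := by
  have hj : ∀ j : Fin S.card, j.val < S.card + k := fun j => by omega
  simp only [idlePart, Nat.add_sub_cancel_left, Finset.mem_union, Finset.mem_sdiff,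
    mem_entriesWhere, and_true, not_exists, not_and, hj, true_imp_iff, ne_eq]

theorem mem_shapePart_sub (hq : IsAddSubtractPlan S D J lt q) {k : ℕ} {x : LatticePoint} :
    x ∈ shapePart S D q (S.card + k) ↔ (x ∈ S ∧ ∀ j : Fin S.card, j.val < k → q.sr j ≠ x) ∨
      ∃ j : Fin S.card, (j.val < k ∧ ¬ IsRecycled S D (q.sr j)) ∧ q.tr j = x := by
  have hj : ∀ j : Fin S.card, j.val < S.card + k := fun j => by omega
  have ht : (∃ j, q.t j = x) ↔ x ∈ S :=
    ⟨fun ⟨j, e⟩ => e ▸ t_mem hq j, fun hx => t_surjective hq hx⟩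
  simp only [shapePart, Nat.add_sub_cancel_left, Finset.mem_union, Finset.mem_sdiff,
    mem_entriesWhere, and_true, not_exists, not_and, hj, true_and, ne_eq, ht]

theorem starts_castAdd (k : Fin S.card) : q.starts (Fin.castAdd S.card k) = q.s k :=
  Fin.append_left _ _ k

theorem starts_natAdd (k : Fin S.card) : q.starts (Fin.natAdd S.card k) = q.sr k :=
  Fin.append_right _ _ k

theorem stops_castAdd (k : Fin S.card) : q.stops (Fin.castAdd S.card k) = q.t k :=
  Fin.append_left _ _ k

theorem stops_natAdd (k : Fin S.card) : q.stops (Fin.natAdd S.card k) = q.tr k :=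
  Fin.append_right _ _ k

/-- In each epoch, the starting position is occupied, the stopping position is free, and the move
leads to the next set of occupied positions. -/
theorem robots_step (h : Scenario S D J lt) (hq : IsAddSubtractPlan S D J lt q)
    (n : Fin (S.card + S.card)) : q.starts n ∈ robots S D J q n ∧
      q.stops n ∉ (robots S D J q n).erase (q.starts n) ∧
      robots S D J q (n.val + 1) = insert (q.stops n) ((robots S D J q n).erase (q.starts n)) := by
  have hir : ∀ {n x}, x ∈ idlePart S D J q n → x.2 ≤ -2 := fun hx => h.idlePart_row hq hx
  have hsr : ∀ {n x}, x ∈ shapePart S D q n → 2 ≤ x.2 := fun hx => h.shapePart_row hq hx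
  have low : ∀ {x : LatticePoint} {n}, x.2 ≤ -2 → x ∉ seeds ∧ x ∉ shapePart S D q n :=
    fun hx => ⟨fun h' => by have := (seed_row _ h').1; omega, fun h' => by have := hsr h'; omega⟩
  have high : ∀ {x : LatticePoint} {n}, 2 ≤ x.2 → x ∉ seeds ∧ x ∉ idlePart S D J q n :=
    fun hx => ⟨fun h' => by have := (seed_row _ h').2; omega, fun h' => by have := hir h'; omega⟩
  refine Fin.addCases (fun k => ?_) (fun k => ?_) n
  · rw [starts_castAdd, stops_castAdd, Fin.val_castAdd]
    have hs := h.idle_row (s_mem hq k)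
    have ht := h.row _ (t_mem hq k)
    have hsI : q.s k ∈ idlePart S D J q k :=
      mem_idlePart_add.2 ⟨s_mem hq k, fun j hj e => hj.ne (s_injective hq e)⟩
    refine ⟨mem_robots.2 (Or.inr (Or.inl hsI)), fun hm => ?_, ?_⟩
    · rcases mem_robots.1 (Finset.mem_of_mem_erase hm) with hm | hm | hm
      · exact (high (n := 0) ht).1 hm
      · exact (high ht).2 hm
      · obtain ⟨j, hj, e⟩ := mem_shapePart_add.1 hm
        exact hj.ne (t_injective hq e)
    · have e1 : ∀ x, x ∈ idlePart S D J q (k.val + 1) ↔ x ∈ idlePart S D J q k ∧ x ≠ q.s k := by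
        intro x
        have e : k.val - S.card = 0 := by omega
        have e' : k.val + 1 - S.card = 0 := by omega
        simp only [idlePart, e, e', entriesWhere_zero, Finset.union_empty, Finset.mem_sdiff,
          mem_entriesWhere_succ, true_and, not_or, and_assoc, ne_eq]
      have e2 : ∀ x, x ∈ shapePart S D q (k.val + 1) ↔ x ∈ shapePart S D q k ∨ x = q.t k := by
        intro x
        have e : k.val - S.card = 0 := by omega
        have e' : k.val + 1 - S.card = 0 := by omega
        simp only [shapePart, e, e', entriesWhere_zero, Finset.union_empty, Finset.sdiff_empty,
          mem_entriesWhere_succ, true_and]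
      ext x
      rw [Finset.mem_insert, Finset.mem_erase, mem_robots, mem_robots, e1, e2]
      by_cases hx : x = q.s k
      · subst hx
        have := low (n := k.val) hs
        tauto
      · tauto
  · rw [starts_natAdd, stops_natAdd, Fin.val_natAdd]
    have hs := h.row _ (sr_mem hq k)
    have hsS : q.sr k ∈ shapePart S D q (S.card + k) :=
      (mem_shapePart_sub hq).2 (Or.inl ⟨sr_mem hq k, fun j hj e => hj.ne (by rw [sr_injective hq e])⟩)
    have hnext : S.card + k.val + 1 = S.card + (k.val + 1) := by ring
    have hsucc : ∀ j : Fin S.card, j.val < k.val + 1 ↔ j.val < k.val ∨ j = k := by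
      intro j; rw [Fin.ext_iff]; omega
    refine ⟨mem_robots.2 (Or.inr (Or.inr hsS)), ?_⟩
    by_cases hk : IsRecycled S D (q.sr k)
    · have ht := h.idle_row (tr_mem_idle hq hk)
      refine ⟨fun hm => ?_, ?_⟩
      · rcases mem_robots.1 (Finset.mem_of_mem_erase hm) with hm | hm | hm
        · exact (low (n := 0) ht).1 hm
        · rcases mem_idlePart_sub.1 hm with ⟨-, hm⟩ | ⟨j, ⟨hj, -⟩, e⟩
          · obtain ⟨j, e⟩ := tr_mem_range hq hk
            exact hm j e
          · rw [tr_injective hq e] at hj; exact lt_irrefl _ hj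
        · exact (low ht).2 hm
      · have e1 : ∀ x, x ∈ idlePart S D J q (S.card + (k.val + 1)) ↔
            x ∈ idlePart S D J q (S.card + k) ∨ x = q.tr k := by
          intro x
          rw [mem_idlePart_sub, mem_idlePart_sub, or_assoc]
          refine or_congr_right ?_
          constructor
          · rintro ⟨j, ⟨hj, hr⟩, e⟩
            rcases (hsucc j).1 hj with hj | rfl
            · exact Or.inl ⟨j, ⟨hj, hr⟩, e⟩
            · exact Or.inr e.symm
          · rintro (⟨j, ⟨hj, hr⟩, e⟩ | rfl)
            · exact ⟨j, ⟨by omega, hr⟩, e⟩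
            · exact ⟨k, ⟨by omega, hk⟩, rfl⟩
        have e2 : ∀ x, x ∈ shapePart S D q (S.card + (k.val + 1)) ↔
            x ∈ shapePart S D q (S.card + k) ∧ x ≠ q.sr k := by
          intro x
          rw [mem_shapePart_sub hq, mem_shapePart_sub hq]
          constructor
          · rintro (⟨hx, hj⟩ | ⟨j, ⟨hj, hr⟩, rfl⟩)
            · exact ⟨Or.inl ⟨hx, fun j hjk => hj j (by omega)⟩, (hj k (by omega)).symm⟩
            · rcases (hsucc j).1 hj with hj' | rfl
              -- a robot rearranged earlier does not rest on the start of the `k`-th one, since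
              -- targets are not behind starts
              · refine ⟨Or.inr ⟨j, ⟨hj', hr⟩, rfl⟩, fun e => ?_⟩
                rcases h.tr_eq_or_lt hq hr with e' | e'
                · rw [e'] at e
                  rw [sr_injective hq e] at hj'
                  exact lt_irrefl _ hj'
                · rw [e] at e'
                  have e'' : ReactLT S lt (q.sr k) (q.sr j) :=
                    Or.inr ⟨(ribbonOf_eq_iff (sr_mem hq j)).2 e'.sameRibbon, e'⟩
                  have : k.val < j.val := (h.sr_lt_iff hq).1 e''
                  omega
              · exact absurd hk hr
          · rintro ⟨⟨hx, hj⟩ | ⟨j, ⟨hj, hr⟩, rfl⟩, hne⟩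
            · refine Or.inl ⟨hx, fun j hjk => ?_⟩
              rcases (hsucc j).1 hjk with hj' | rfl
              · exact hj j hj'
              · exact hne.symm
            · exact Or.inr ⟨j, ⟨by omega, hr⟩, rfl⟩
        ext x
        rw [Finset.mem_insert, Finset.mem_erase, hnext, mem_robots, mem_robots, e1, e2]
        by_cases hx : x = q.sr k
        · subst hx
          have := high (n := S.card + k.val) hs
          tauto
        · tauto
    · have htS := (Finset.mem_sdiff.1 (tr_mem_sdiff hq hk)).1
      have ht := h.row _ htS
      refine ⟨fun hm => ?_, ?_⟩
      · rcases mem_robots.1 (Finset.mem_of_mem_erase hm) with hm' | hm' | hm'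
        · exact (high (n := 0) ht).1 hm'
        · exact (high ht).2 hm'
        · rcases (mem_shapePart_sub hq).1 hm' with ⟨-, hj⟩ | ⟨j, ⟨hj, -⟩, e⟩
          · rcases h.tr_eq_or_lt hq hk with e | e
            · exact (Finset.mem_erase.1 hm).1 e
            · obtain ⟨j, e'⟩ := sr_surjective hq htS
              rw [← e'] at e
              have e'' : ReactLT S lt (q.sr j) (q.sr k) :=
                Or.inr ⟨(ribbonOf_eq_iff (sr_mem hq k)).2 e.sameRibbon, e⟩
              exact hj j ((h.sr_lt_iff hq).1 e'') e'
          · rw [tr_injective hq e] at hj; exact lt_irrefl _ hj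
      · have e1 : ∀ x, x ∈ idlePart S D J q (S.card + (k.val + 1)) ↔
            x ∈ idlePart S D J q (S.card + k) := by
          intro x
          rw [mem_idlePart_sub, mem_idlePart_sub]
          refine or_congr_right ?_
          constructor
          · rintro ⟨j, ⟨hj, hr⟩, e⟩
            rcases (hsucc j).1 hj with hj | rfl
            · exact ⟨j, ⟨hj, hr⟩, e⟩
            · exact absurd hr hk
          · rintro ⟨j, ⟨hj, hr⟩, e⟩
            exact ⟨j, ⟨by omega, hr⟩, e⟩
        have e2 : ∀ x, x ∈ shapePart S D q (S.card + (k.val + 1)) ↔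
            x = q.tr k ∨ (x ≠ q.sr k ∧ x ∈ shapePart S D q (S.card + k)) := by
          intro x
          rw [mem_shapePart_sub hq, mem_shapePart_sub hq]
          constructor
          · rintro (⟨hx, hj⟩ | ⟨j, ⟨hj, hr⟩, rfl⟩)
            · exact Or.inr ⟨(hj k (by omega)).symm, Or.inl ⟨hx, fun j hjk => hj j (by omega)⟩⟩
            · rcases (hsucc j).1 hj with hj' | rfl
              · refine Or.inr ⟨fun e => ?_, Or.inr ⟨j, ⟨hj', hr⟩, rfl⟩⟩
                rcases h.tr_eq_or_lt hq hr with e' | e'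
                · rw [e'] at e
                  rw [sr_injective hq e] at hj'
                  exact lt_irrefl _ hj'
                · rw [e] at e'
                  have e'' : ReactLT S lt (q.sr k) (q.sr j) :=
                    Or.inr ⟨(ribbonOf_eq_iff (sr_mem hq j)).2 e'.sameRibbon, e'⟩
                  have : k.val < j.val := (h.sr_lt_iff hq).1 e''
                  omega
              · exact Or.inl rfl
          · rintro (rfl | ⟨hne, ⟨hx, hj⟩ | ⟨j, ⟨hj, hr⟩, rfl⟩⟩)
            · exact Or.inr ⟨k, ⟨by omega, hk⟩, rfl⟩
            · refine Or.inl ⟨hx, fun j hjk => ?_⟩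
              rcases (hsucc j).1 hjk with hj' | rfl
              · exact hj j hj'
              · exact hne.symm
            · exact Or.inr ⟨j, ⟨by omega, hr⟩, rfl⟩
        ext x
        rw [Finset.mem_insert, Finset.mem_erase, hnext, mem_robots, mem_robots, e1, e2]
        by_cases hx : x = q.sr k
        · subst hx
          have := high (n := S.card + k.val) hs
          tauto
        · tauto

theorem robots_zero (h : Scenario S D J lt) :
    (robots S D J q 0).val = initialRobots J := by
  have hd : Disjoint seeds J := by
    rw [Finset.disjoint_left]
    intro x hx hxJ
    have := (seed_row x hx).1
    have := h.idle_row hxJ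
    omega
  simp only [robots, idlePart, shapePart, Nat.zero_sub, entriesWhere_zero, Finset.union_empty,
    Finset.sdiff_empty]
  rw [← Finset.disjUnion_eq_union _ _ hd]
  rfl

theorem config_eq_robots (h : Scenario S D J lt) (hq : IsAddSubtractPlan S D J lt q) {n : ℕ}
    (hn : n ≤ S.card + S.card) :
    config (initialRobots J) q.starts q.stops n = (robots S D J q n).val :=
  config_eq (h.robots_zero) (fun n => (h.robots_step hq n).1)
    (fun n => (h.robots_step hq n).2.1) (fun n => (h.robots_step hq n).2.2) n hn

theorem mem_stationary (h : Scenario S D J lt) (hq : IsAddSubtractPlan S D J lt q)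
    {n : Fin (S.card + S.card)} {x : LatticePoint} :
    x ∈ stationary (initialRobots J) q.starts q.stops n ↔
      x ≠ q.starts n ∧ x ∈ robots S D J q n := by
  rw [stationary_eq (h.config_eq_robots hq n.2.le), Finset.mem_val, Finset.mem_erase]

/-- The final positions in the formation half-plane form the desired shape. -/
theorem final_config (h : Scenario S D J lt) (hq : IsAddSubtractPlan S D J lt q) :
    formationPart (config (initialRobots J) q.starts q.stops (S.card + S.card)) = (S \ D).val := by
  rw [h.config_eq_robots hq le_rfl, formationPart, ← Finset.filter_val, Finset.val_inj]
  ext x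
  rw [Finset.mem_filter, mem_robots, mem_shapePart_sub hq]
  constructor
  · rintro ⟨hx | hx | ⟨hx, hj⟩ | ⟨j, ⟨-, hj⟩, rfl⟩, h2⟩
    · have := (seed_row x hx).2; omega
    · have := h.idlePart_row hq hx; omega
    · obtain ⟨j, e⟩ := sr_surjective hq hx
      exact absurd e (hj j j.2)
    · exact tr_mem_sdiff hq hj
  · intro hx
    obtain ⟨j, hj, e⟩ := h.tr_surjective hq hx
    exact ⟨Or.inr (Or.inr (Or.inr ⟨j, ⟨j.2, hj⟩, e⟩)), h.row x (Finset.mem_sdiff.1 hx).1⟩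

theorem map_append {N : ℕ} (f g : Fin N → LatticePoint) :
    (Finset.univ.val.map (Fin.append f g) : Multiset LatticePoint) =
      Finset.univ.val.map f + Finset.univ.val.map g := by
  rw [Fin.univ_val_map, Fin.univ_val_map, Fin.univ_val_map, List.ofFn_fin_append]
  rfl

theorem map_val_of_injective {N : ℕ} {f : Fin N → LatticePoint} (hf : Function.Injective f) :
    (Finset.univ.val.map f : Multiset LatticePoint) = (Finset.univ.image f).val := by
  rw [Finset.image_val_of_injOn hf.injOn]

/-- The net result of all movements in the formation half-plane is the desired shape. -/
theorem final_difference (h : Scenario S D J lt) (hq : IsAddSubtractPlan S D J lt q) :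
    formationPart (Finset.univ.val.map q.stops - Finset.univ.val.map q.starts) =
      (S \ D).val := by
  have e1 : formationPart (Finset.univ.val.map q.t) = S.val := by
    rw [map_val_of_injective (t_injective hq), image_eq (t_injective hq) (t_mem hq), formationPart,
      Multiset.filter_eq_self]
    exact fun x hx => h.row x hx
  have e2 : formationPart (Finset.univ.val.map q.sr) = S.val := by
    rw [map_val_of_injective (sr_injective hq), image_eq (sr_injective hq) (sr_mem hq),
      formationPart, Multiset.filter_eq_self]
    exact fun x hx => h.row x hx
  have e3 : formationPart (Finset.univ.val.map q.s) = 0 := by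
    rw [formationPart, Multiset.filter_eq_nil]
    intro x hx
    obtain ⟨k, -, rfl⟩ := Multiset.mem_map.1 hx
    have := h.idle_row (s_mem hq k)
    omega
  have e4 : formationPart (Finset.univ.val.map q.tr) = (S \ D).val := by
    rw [map_val_of_injective (tr_injective hq), formationPart, ← Finset.filter_val, Finset.val_inj]
    ext x
    rw [Finset.mem_filter, Finset.mem_image]
    constructor
    · rintro ⟨⟨k, -, rfl⟩, hk⟩
      refine tr_mem_sdiff hq fun hr => ?_
      have := h.idle_row (tr_mem_idle hq hr)
      omega
    · intro hx
      obtain ⟨k, -, e⟩ := h.tr_surjective hq hx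
      exact ⟨⟨k, Finset.mem_univ k, e⟩, h.row x (Finset.mem_sdiff.1 hx).1⟩
  have hadd : ∀ m m' : Multiset LatticePoint,
      formationPart (m + m') = formationPart m + formationPart m' :=
    fun m m' => Multiset.filter_add _ _ _
  rw [formationPart, Multiset.filter_sub]
  change formationPart _ - formationPart _ = _
  rw [MovementPlan.stops, MovementPlan.starts, map_append, map_append, hadd, hadd, e1, e2, e3, e4,
    zero_add, add_comm S.val, Multiset.add_sub_cancel_right]

end Scenario

/-! ### The movements -/

namespace Scenario

variable {S D J : Finset LatticePoint} {lt : Set LatticePoint → Set LatticePoint → Prop}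
  {q : MovementPlan S.card}

open Classical in
/-- The idle robots that are closer to the seeds than `p`. -/
noncomputable def idleBefore (J : Finset LatticePoint) (p : LatticePoint) : Finset LatticePoint :=
  J.filter (fun y => IdleLT y p)

open Classical in
/-- The points of the shape that are assembled before `p`. -/
noncomputable def shapeBefore (S : Finset LatticePoint)
    (lt : Set LatticePoint → Set LatticePoint → Prop) (p : LatticePoint) : Finset LatticePoint :=
  S.filter (fun y => RibbonLex S lt (RibbonLT S) y p)

theorem mem_idleBefore {p y : LatticePoint} : y ∈ idleBefore J p ↔ y ∈ J ∧ IdleLT y p := by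
  simp [idleBefore]

theorem mem_shapeBefore {p y : LatticePoint} :
    y ∈ shapeBefore S lt p ↔ y ∈ S ∧ RibbonLex S lt (RibbonLT S) y p := by
  simp [shapeBefore]

theorem frontClosed_idleBefore (h : Scenario S D J lt) (p : LatticePoint) :
    FrontClosed idleHalf (idleBefore J p) := by
  refine frontClosed_idle (fun y hy => h.idle.subset y (mem_idleBefore.1 hy).1) ?_
  intro y hy x hx hxy
  obtain ⟨hyJ, hyp⟩ := mem_idleBefore.1 hy
  refine mem_idleBefore.2 ⟨h.idle.mem_of_le hyJ hx ?_, hxy.trans hyp⟩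
  unfold IdleLT at hxy
  omega

theorem lt_of_lower (h : Scenario S D J lt) {x c : LatticePoint} (hx : x ∈ S) (hc : c ∈ S)
    (hxc : LowerNbr S x c) : lt (ribbonOf S c) (ribbonOf S x) :=
  h.order.extends_tree _ _ (.single (h.region.isParentRibbon hx hc hxc))

theorem frontClosed_shapeBefore (h : Scenario S D J lt) {p : LatticePoint} (hp : p ∈ S) :
    FrontClosed S (shapeBefore S lt p) := by
  have hst := h.region.strictOn_assembly h.order
  refine ⟨fun y hy => (mem_shapeBefore.1 hy).1, ?_, ?_, ?_⟩
  · intro y hy z hz hyz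
    obtain ⟨hyS, hyp⟩ := mem_shapeBefore.1 hy
    exact mem_shapeBefore.2 ⟨hz, hst.trans z hz y hyS p hp (Or.inl (h.lt_of_lower hyS hz hyz)) hyp⟩
  · intro y hy z hyz
    obtain ⟨hyS, hyp⟩ := mem_shapeBefore.1 hy
    have hz := (ribbonArc_iff.1 hyz).2.1
    refine mem_shapeBefore.2 ⟨hz, hst.trans z hz y hyS p hp (Or.inr ⟨?_, .single hyz⟩) hyp⟩
    exact ((ribbonOf_eq_iff hz).2 hyz.sameRibbon).symm
  · intro y hy w hwy z hz hwz
    obtain ⟨hyS, hyp⟩ := mem_shapeBefore.1 hy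
    have hw := (ribbonArc_iff.1 hwy).1
    refine mem_shapeBefore.2 ⟨hz, hst.trans z hz y hyS p hp (Or.inl ?_) hyp⟩
    rw [← (ribbonOf_eq_iff hyS).2 hwy.sameRibbon]
    exact h.lt_of_lower hw hz hwz

/-- The ribbons of the shape that are smaller than the one through `p`. -/
def lowerRibbons (S : Finset LatticePoint) (lt : Set LatticePoint → Set LatticePoint → Prop)
    (p : LatticePoint) : Set LatticePoint := {y | y ∈ S ∧ lt (ribbonOf S y) (ribbonOf S p)}

theorem ribbonClosed_lowerRibbons (h : Scenario S D J lt) {p : LatticePoint} (hp : p ∈ S) :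
    RibbonClosed S (lowerRibbons S lt p) := by
  refine ⟨fun y hy => hy.1, ?_, ?_⟩
  · intro y hy z hz hyz
    exact ⟨hz, h.order.trans _ (ribbonOf_mem_ribbons hz) _ (ribbonOf_mem_ribbons hy.1) _
      (ribbonOf_mem_ribbons hp) (h.lt_of_lower hy.1 hz hyz) hy.2⟩
  · intro y hy z hz hyz hh
    refine ⟨hz, ?_⟩
    rw [← (ribbonOf_eq_iff hz).2 (sameRibbon_of_adj hyz hy.1 hz hh.symm)]
    exact hy.2

theorem lower_mem_lowerRibbons (h : Scenario S D J lt) {x c : LatticePoint} (hx : x ∈ S)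
    (hxc : LowerNbr S x c) : c ∈ lowerRibbons S lt x ∪ {p₁, p₂} :=
  (h.region.lower_mem hx hxc).imp (fun hc => ⟨hc, h.lt_of_lower hx hc hxc⟩) id

theorem pair_mem_seeds {c : LatticePoint} (hc : c ∈ ({p₁, p₂} : Set LatticePoint)) :
    c ∈ seeds := by
  rcases hc with rfl | rfl <;> decide

theorem seeds_subset_stationary (h : Scenario S D J lt) (hq : IsAddSubtractPlan S D J lt q)
    (n : Fin (S.card + S.card)) :
    ∀ x ∈ seeds, x ∈ stationary (initialRobots J) q.starts q.stops n := by
  intro x hx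
  refine (h.mem_stationary hq).2 ⟨?_, mem_robots.2 (Or.inl hx)⟩
  have h1 := seed_row x hx
  refine Fin.addCases (fun k => ?_) (fun k => ?_) n
  · rw [starts_castAdd]
    rintro rfl
    have := h.idle_row (s_mem hq k); omega
  · rw [starts_natAdd]
    rintro rfl
    have := h.row _ (sr_mem hq k); omega

/-- The idle points closer to the seeds than `p` allow a robot at `p` to localize itself. -/
theorem canLocalizeAt_idle (h : Scenario S D J lt) (hq : IsAddSubtractPlan S D J lt q) {r : ℝ}
    (hr : 0 < r) {n : Fin (S.card + S.card)} {p : LatticePoint} (hp : p ∈ J)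
    (hB : ∀ x ∈ idleBefore J p, x ∈ stationary (initialRobots J) q.starts q.stops n) :
    CanLocalizeAt r (initialRobots J) q.starts q.stops n p := by
  have hpI := h.idle.subset p hp
  obtain ⟨c, hc⟩ := idle_ribbonRegion.exists_lower hpI
  have hch := hc.2
  refine idle_ribbonRegion.canLocalizeAt hr (ribbonClosed_idle (idleHop p))
    (h.seeds_subset_stationary hq n) (fun x hx => hB x ?_) hc.1 ?_
  · exact mem_idleBefore.2 ⟨h.idle.mem_of_le hp hx.1 hx.2.le, Or.inl hx.2⟩
  · refine (idle_ribbonRegion.lower_mem hpI hc).imp (fun hcI => ⟨hcI, ?_⟩) id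
    rw [hop_idleHalf hcI, hop_idleHalf hpI] at hch
    omega

/-- Smaller ribbons allow a robot next to them to localize itself. -/
theorem canLocalizeAt_shape (h : Scenario S D J lt) (hq : IsAddSubtractPlan S D J lt q) {r : ℝ}
    (hr : 0 < r) {n : Fin (S.card + S.card)} {p z c : LatticePoint} (hp : p ∈ S)
    (hB : ∀ x ∈ lowerRibbons S lt p, x ∈ stationary (initialRobots J) q.starts q.stops n)
    (hz : lattice.Adj z c) (hc : c ∈ lowerRibbons S lt p ∪ {p₁, p₂}) :
    CanLocalizeAt r (initialRobots J) q.starts q.stops n z :=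
  h.region.canLocalizeAt hr (h.ribbonClosed_lowerRibbons hp) (h.seeds_subset_stationary hq n) hB
    hz hc

theorem touches_idle (h : Scenario S D J lt) {p : LatticePoint} (hp : p ∈ J) :
    Touches ((seeds : Set LatticePoint) ∪ idleBefore J p) p := by
  have hpI := h.idle.subset p hp
  have hrow : p.2 ≤ -2 := hpI
  obtain ⟨c, hc⟩ := idle_ribbonRegion.exists_lower hpI
  have hch := hc.2
  obtain ⟨u, hu, rfl⟩ := exists_dir_of_adj hc.1
  refine ⟨?_, u, hu, ?_⟩
  · rintro (h' | h')
    · have := (seed_row p h').1; omega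
    · exact IdleLT.irrefl p (mem_idleBefore.1 h').2
  · rcases idle_ribbonRegion.lower_mem hpI hc with hcI | hcI
    · refine Or.inr (mem_idleBefore.2 ?_)
      rw [hop_idleHalf hcI, hop_idleHalf hpI] at hch
      exact ⟨h.idle.mem_of_le hp hcI (by omega), Or.inl (by omega)⟩
    · exact Or.inl (idle_ribbonRegion.pair_subset_seeds hcI)

theorem Touches.union {A B : Set LatticePoint} {p : LatticePoint} (h : Touches A p) (hp : p ∉ B) :
    Touches (A ∪ B) p := by
  obtain ⟨h1, u, hu, h2⟩ := h
  exact ⟨fun h' => h'.elim h1 hp, u, hu, Or.inl h2⟩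

theorem touches_shape (h : Scenario S D J lt) {p : LatticePoint} (hp : p ∈ S)
    {C : Finset LatticePoint} (hC : ∀ x ∈ C, x.2 ≤ -2) :
    Touches ((seeds : Set LatticePoint) ∪ C ∪ shapeBefore S lt p) p := by
  have hrow := h.row p hp
  obtain ⟨c, hc⟩ := h.region.exists_lower hp
  have hcm := h.lower_mem_lowerRibbons hp hc
  obtain ⟨u, hu, rfl⟩ := exists_dir_of_adj hc.1
  refine ⟨?_, u, hu, ?_⟩
  · rintro ((h' | h') | h')
    · have := (seed_row p h').2; omega
    · have := hC p h'; omega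
    · exact (h.region.strictOn_assembly h.order).irrefl p hp (mem_shapeBefore.1 h').2
  · rcases hcm with hcm | hcm
    · exact Or.inr (mem_shapeBefore.2 ⟨hcm.1, Or.inl hcm.2⟩)
    · exact Or.inl (Or.inl (pair_mem_seeds hcm))

/-! ### Additive epochs -/

/-- During an additive epoch, the stationary robots form an initial segment of the idle points and
one of the shape. -/
theorem stationary_add (h : Scenario S D J lt) (hq : IsAddSubtractPlan S D J lt q)
    (k : Fin S.card) :
    {w | w ∈ stationary (initialRobots J) q.starts q.stops (Fin.castAdd S.card k)} =
      (seeds : Set LatticePoint) ∪ idleBefore J (q.s k) ∪ shapeBefore S lt (q.t k) := by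
  ext w
  rw [Set.mem_ofPred_eq, h.mem_stationary hq, starts_castAdd, Fin.val_castAdd, mem_robots]
  simp only [Set.mem_union, Finset.mem_coe]
  have e1 : w ≠ q.s k ∧ w ∈ idlePart S D J q k ↔ w ∈ idleBefore J (q.s k) := by
    rw [mem_idlePart_add, mem_idleBefore]
    constructor
    · rintro ⟨hne, hw, hj⟩
      refine ⟨hw, (IdleLT.total (h.idle.subset _ hw) (h.idle.subset _ (s_mem hq k))
        hne).resolve_right fun hlt => ?_⟩
      obtain ⟨j, hjk, e⟩ := h.s_downward hq hw hlt
      exact hj j hjk e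
    · rintro ⟨hw, hlt⟩
      refine ⟨?_, hw, fun j hj e => ?_⟩
      · rintro rfl
        exact IdleLT.irrefl _ hlt
      · rw [← e] at hlt
        exact IdleLT.irrefl _ (hlt.trans (h.s_mono hq hj))
  have e2 : w ∈ shapePart S D q k ↔ w ∈ shapeBefore S lt (q.t k) := by
    rw [mem_shapePart_add, mem_shapeBefore]
    constructor
    · rintro ⟨j, hj, rfl⟩
      exact ⟨t_mem hq j, greedy_mono (C := fun _ => (S : Set LatticePoint)) hq.assembly hj rfl⟩
    · rintro ⟨hw, hlt⟩
      exact h.t_downward hq hw hlt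
  have e3 : w ∈ seeds → w ≠ q.s k := by
    rintro hw rfl
    have := (seed_row _ hw).1
    have := h.idle_row (s_mem hq k)
    omega
  have e4 : w ∈ shapePart S D q k → w ≠ q.s k := by
    rintro hw rfl
    have := h.shapePart_row hq hw
    have := h.idle_row (s_mem hq k)
    omega
  rw [← e1, ← e2]
  tauto

/-- In an additive epoch both ends of the move are boundary positions of one smooth set, whose
boundary is a single cycle. -/
theorem additiveMove (h : Scenario S D J lt) (hq : IsAddSubtractPlan S D J lt q) {r : ℝ}
    (hr : 0 < r) (k : Fin S.card) :
    AdditiveMove r (initialRobots J) q.starts q.stops (Fin.castAdd S.card k) := by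
  have hQ := h.stationary_add hq k
  have hQ' : ∀ w, w ∈ (seeds : Set LatticePoint) ∪ idleBefore J (q.s k) ∪
      shapeBefore S lt (q.t k) →
      w ∈ stationary (initialRobots J) q.starts q.stops (Fin.castAdd S.card k) := by
    intro w hw
    rw [← hQ] at hw
    exact hw
  have hs := s_mem hq k
  have ht := t_mem hq k
  rw [AdditiveMove, hQ, starts_castAdd, stops_castAdd]
  refine ⟨?_, h.canLocalizeAt_idle hq hr hs fun x hx => hQ' x (Or.inl (Or.inr hx)), ?_⟩
  · obtain ⟨hA, hO⟩ := oneOrbit_join h.region idle_ribbonRegion h.row (fun x hx => hx)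
      (h.frontClosed_shapeBefore ht) (h.frontClosed_idleBefore (q.s k))
    refine hA.edgeFollows hr hO (Touches.union (h.touches_idle hs) ?_)
      (h.touches_shape ht fun x hx => h.idle_row (mem_idleBefore.1 hx).1)
    intro hm
    have := h.row _ (mem_shapeBefore.1 hm).1
    have := h.idle_row hs
    omega
  · obtain ⟨c, hc⟩ := h.region.exists_lower ht
    refine h.canLocalizeAt_shape hq hr ht (fun x hx => hQ' x (Or.inr ?_)) hc.1
      (h.lower_mem_lowerRibbons ht hc)
    exact mem_shapeBefore.2 ⟨hx.1, Or.inl hx.2⟩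

/-! ### Subtractive epochs -/

theorem mem_stationary_sub (h : Scenario S D J lt) (hq : IsAddSubtractPlan S D J lt q)
    {k : Fin S.card} {x : LatticePoint} :
    x ∈ stationary (initialRobots J) q.starts q.stops (Fin.natAdd S.card k) ↔
      x ≠ q.sr k ∧ x ∈ robots S D J q (S.card + k) := by
  rw [h.mem_stationary hq, starts_natAdd, Fin.val_natAdd]

/-- In a subtractive epoch, the ribbons smaller than that of the moving robot are intact. -/
theorem lowerRibbons_subset (h : Scenario S D J lt) (hq : IsAddSubtractPlan S D J lt q)
    {k : Fin S.card} : ∀ x ∈ lowerRibbons S lt (q.sr k),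
      x ∈ stationary (initialRobots J) q.starts q.stops (Fin.natAdd S.card k) := by
  rintro x ⟨hx, hlt⟩
  have hm : ∀ {x}, x ∈ S → ribbonOf (S : Set LatticePoint) x ∈ ribbons S :=
    fun hx => ribbonOf_mem_ribbons hx
  refine (h.mem_stationary_sub hq).2 ⟨?_, mem_robots.2 (Or.inr (Or.inr
    ((mem_shapePart_sub hq).2 (Or.inl ⟨hx, fun j hj e => ?_⟩))))⟩
  · rintro rfl
    exact h.order.irrefl _ (hm hx) hlt
  · rcases sr_mono hq (show j < k from hj) with h' | ⟨h', -⟩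
    · rw [e] at h'
      exact h.order.asymm (hm hx) (hm (sr_mem hq k)) hlt h'
    · rw [e] at h'
      rw [h'] at hlt
      exact h.order.irrefl _ (hm (sr_mem hq k)) hlt

theorem guide_subset (h : Scenario S D J lt) (hq : IsAddSubtractPlan S D J lt q)
    {k : Fin S.card} {F : Set LatticePoint}
    (hF : ∀ c ∈ F, c ∈ ({p₁, p₂} : Set LatticePoint) ∨
      c ∈ (S : Set LatticePoint) ∧ IsParentRibbon S (ribbonOf S c) (ribbonOf S (q.sr k))) :
    F ⊆ {w | w ∈ stationary (initialRobots J) q.starts q.stops (Fin.natAdd S.card k)} := by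
  intro c hc
  rcases hF c hc with hc | ⟨hc, hp⟩
  · exact h.seeds_subset_stationary hq _ c (pair_mem_seeds hc)
  · exact h.lowerRibbons_subset hq c ⟨hc, h.order.extends_tree _ _ (.single hp)⟩

/-- In front of the moving robot, its ribbon holds at most robots that have been rearranged. -/
theorem free_ahead (h : Scenario S D J lt) (hq : IsAddSubtractPlan S D J lt q) {k : Fin S.card}
    {z : LatticePoint} (hz : Relation.ReflTransGen (RibbonArc S) (q.sr k) z)
    (hzQ : z ∈ stationary (initialRobots J) q.starts q.stops (Fin.natAdd S.card k)) :
    ∃ j < k, ¬ IsRecycled S D (q.sr j) ∧ q.tr j = z := by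
  obtain ⟨hne, hzr⟩ := (h.mem_stationary_sub hq).1 hzQ
  have hsame := sameRibbon_of_arcs hz
  have hzS : z ∈ S := hsame.mem (sr_mem hq k)
  have hrow := h.row z hzS
  rcases mem_robots.1 hzr with hm | hm | hm
  · have := (seed_row z hm).2; omega
  · have := h.idlePart_row hq hm; omega
  · rcases (mem_shapePart_sub hq).1 hm with ⟨-, hj⟩ | ⟨j, ⟨hj, hr⟩, e⟩
    · obtain ⟨i, rfl⟩ := sr_surjective hq hzS
      rcases Relation.reflTransGen_iff_eq_or_transGen.1 hz with e | hlt
      · exact absurd e hne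
      · exact absurd rfl (hj i ((h.sr_lt_iff hq).1
          (Or.inr ⟨((ribbonOf_eq_iff hzS).2 hsame).symm, hlt⟩)))
    · exact ⟨j, hj, hr, e⟩

/-- A rearranged robot finds its way free: the robots rearranged earlier on its ribbon have stopped
further to the front than its target. -/
theorem rearrangedMove (h : Scenario S D J lt) (hq : IsAddSubtractPlan S D J lt q) {r : ℝ}
    (hr : 0 < r) {k : Fin S.card} (hk : ¬ IsRecycled S D (q.sr k)) :
    RearrangedMove S r (initialRobots J) q.starts q.stops (Fin.natAdd S.card k) := by
  have hs := sr_mem hq k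
  obtain ⟨F, hF, hFl, hFm⟩ := h.region.exists_guide hs
  have hpath : Relation.ReflTransGen (RibbonArc S) (q.sr k) (q.tr k) := by
    rcases h.tr_eq_or_lt hq hk with e | e
    · rw [e]
    · exact e.to_reflTransGen
  have hsame := sameRibbon_of_arcs hpath
  have hloc : ∀ z, SameRibbon S (q.sr k) z → CanLocalizeAt r (initialRobots J) q.starts q.stops
      (Fin.natAdd S.card k) z := by
    intro z hz
    have hzS : z ∈ S := hz.mem hs
    obtain ⟨c, hc⟩ := h.region.exists_lower hzS
    have hcm := h.lower_mem_lowerRibbons hzS hc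
    refine h.canLocalizeAt_shape hq hr hs (h.lowerRibbons_subset hq) hc.1 ?_
    rwa [lowerRibbons, ← (ribbonOf_eq_iff hzS).2 hz] at hcm
  refine ⟨F, ?_⟩
  rw [starts_natAdd, stops_natAdd]
  refine ⟨hF, ?_, hloc _ (SimpleGraph.Reachable.refl _), hloc _ hsame⟩
  refine h.region.ribbonFollows hr hs hpath hFl (h.guide_subset hq hFm) ?_
  intro z hz hz' hzQ
  obtain ⟨j, hj, hjr, rfl⟩ := h.free_ahead hq hz hzQ
  have hmono := tr_mono hq hj hjr hk
  have hjS := (Finset.mem_sdiff.1 (tr_mem_sdiff hq hjr)).1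
  have hkS := (Finset.mem_sdiff.1 (tr_mem_sdiff hq hk)).1
  rcases Relation.reflTransGen_iff_eq_or_transGen.1 hz' with e | hlt
  · rw [e] at hmono
    exact h.strictOn_react.irrefl _ hjS hmono
  · refine h.strictOn_react.asymm hjS hkS hmono (Or.inr ⟨?_, hlt⟩)
    exact ((ribbonOf_eq_iff hkS).2 (sameRibbon_of_arcs hz')).symm

theorem isRecycled_of_lt {x y : LatticePoint} (hy : y ∈ S) (hxy : RibbonLT S x y)
    (h : IsRecycled S D y) : IsRecycled S D x := by
  unfold IsRecycled at *
  rw [(ribbonOf_eq_iff hy).2 hxy.sameRibbon]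
  refine lt_of_le_of_lt (Set.ncard_le_ncard ?_ ?_) h
  · exact fun z hz => ⟨hz.1, hz.2.trans hxy⟩
  · exact (Finset.finite_toSet S).subset fun z hz => hz.1

/-- When a recycled robot returns to the idle half-plane, the points before its target are occupied,
and no others. -/
theorem idlePart_eq (h : Scenario S D J lt) (hq : IsAddSubtractPlan S D J lt q) {k : Fin S.card}
    (hk : IsRecycled S D (q.sr k)) :
    idlePart S D J q (S.card + k) = idleBefore J (q.tr k) := by
  classical
  have hI : ∀ {x}, x ∈ J → x ∈ idleHalf := fun hx => h.idle.subset _ hx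
  have htI := hI (tr_mem_idle hq hk)
  ext w
  rw [mem_idlePart_sub, mem_idleBefore]
  constructor
  · rintro (⟨hw, hj⟩ | ⟨j, ⟨hj, hr⟩, rfl⟩)
    · obtain ⟨i, e⟩ := tr_mem_range hq hk
      rw [← e] at htI ⊢
      refine ⟨hw, (IdleLT.total (hI hw) htI (hj i).symm).resolve_right fun hlt => ?_⟩
      obtain ⟨j, -, e'⟩ := h.s_downward hq hw hlt
      exact hj j e'
    · have := greedy_mono (tr_spec hq) (show j < k from hj) (by rw [if_pos hr, if_pos hk])
      rw [if_pos hr, ribbonLex_idle_iff (hI (tr_mem_idle hq hr)) htI] at this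
      exact ⟨tr_mem_idle hq hr, this⟩
  · rintro ⟨hw, hlt⟩
    by_cases hws : ∃ i, q.s i = w
    · obtain ⟨i, rfl⟩ := hws
      obtain ⟨j, hj, hr, e⟩ := h.tr_downward_idle hq hk hlt
      exact Or.inr ⟨j, ⟨hj, hr⟩, e⟩
    · push Not at hws
      exact Or.inl ⟨hw, hws⟩

/-- A boundary point of `S` that is not on the ribbon of the moving robot is occupied: it is not a
hole, smaller ribbons are intact, and larger ones have been rearranged. -/
theorem beside_stationary (h : Scenario S D J lt) (hq : IsAddSubtractPlan S D J lt q)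
    {k : Fin S.card} {y z : LatticePoint} (hy : y ∈ S)
    (hne : ribbonOf (S : Set LatticePoint) y ≠ ribbonOf S (q.sr k)) (hz : z ∉ S)
    (hyz : lattice.Adj y z) :
    y ∈ stationary (initialRobots J) q.starts q.stops (Fin.natAdd S.card k) := by
  have hyD := h.boundary y hy z hz hyz
  rcases h.order.total _ (ribbonOf_mem_ribbons hy) _ (ribbonOf_mem_ribbons (sr_mem hq k)) hne
    with hlt | hlt
  · exact h.lowerRibbons_subset hq y ⟨hy, hlt⟩
  · obtain ⟨j, hj, rfl⟩ := h.tr_surjective hq (Finset.mem_sdiff.2 ⟨hy, hyD⟩)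
    have hrib : ribbonOf (S : Set LatticePoint) (q.tr j) = ribbonOf S (q.sr j) := by
      rcases h.tr_eq_or_lt hq hj with e | e
      · rw [e]
      · exact (ribbonOf_eq_iff (sr_mem hq j)).2 e.sameRibbon
    have hjk : j < k := (h.sr_lt_iff hq).1 (Or.inl (hrib ▸ hlt))
    refine (h.mem_stationary_sub hq).2 ⟨?_, mem_robots.2 (Or.inr (Or.inr
      ((mem_shapePart_sub hq).2 (Or.inr ⟨j, ⟨hjk, hj⟩, rfl⟩))))⟩
    intro e
    exact hne (by rw [e])

/-- A recycled robot runs to the front of its ribbon, leaves it to the merging point, and follows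
the boundary of the configuration in which `S` is still complete. This walk leads around boundary
points of `S` off its own ribbon, and these are occupied. -/
theorem recycledMove (h : Scenario S D J lt) (hq : IsAddSubtractPlan S D J lt q) {r : ℝ}
    (hr : 0 < r) {k : Fin S.card} (hk : IsRecycled S D (q.sr k)) :
    RecycledMove S r (initialRobots J) q.starts q.stops (Fin.natAdd S.card k) := by
  have hs := sr_mem hq k
  have ht := tr_mem_idle hq hk
  obtain ⟨F, hF, hFl, hFm⟩ := h.region.exists_guide hs
  have hFQ := h.guide_subset hq hFm
  obtain ⟨x, hxfirst, hx⟩ := h.region.exists_firstVertex (Finset.finite_toSet S) hs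
  have hxR := hxfirst.1
  have hxS : x ∈ S := hxR.1
  obtain ⟨u, hu⟩ := h.region.exists_lowerPivot hxR.1
  have hm : x + rot u ∉ S := h.region.front_leaves hxR.1 hu fun y hy =>
    hxfirst.2 y ⟨(ribbonArc_iff.1 hy).2.1, SameRibbon.trans hxR.2 hy.sameRibbon⟩ (.single hy)
  obtain ⟨hmseed, hmrow⟩ := h.region.front_free h.row hxS hu hm
  have hpath := hx _ (mem_ribbonOf_self (P := (S : Set LatticePoint)) hs)
  -- no rearranged robot precedes a recycled one on its ribbon
  have hfree : ∀ z, Relation.ReflTransGen (RibbonArc S) (q.sr k) z →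
      z ∉ stationary (initialRobots J) q.starts q.stops (Fin.natAdd S.card k) := by
    intro z hz hzQ
    obtain ⟨j, hj, hjr, rfl⟩ := h.free_ahead hq hz hzQ
    have hsame : SameRibbon S (q.tr j) (q.sr j) := by
      rcases h.tr_eq_or_lt hq hjr with e | e
      · rw [e]; exact SimpleGraph.Reachable.refl _
      · exact e.sameRibbon
    have hrib := (ribbonOf_eq_iff (P := (S : Set LatticePoint)) (sr_mem hq j)).2
      ((sameRibbon_of_arcs hz).trans hsame)
    rcases sr_mono hq hj with h' | ⟨-, h'⟩
    · rw [hrib] at h'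
      exact h.order.irrefl _ (ribbonOf_mem_ribbons (sr_mem hq j)) h'
    · exact hjr (isRecycled_of_lt hs h' hk)
  have hC := h.idlePart_eq hq hk
  have hCQ : ∀ w ∈ idleBefore J (q.tr k),
      w ∈ stationary (initialRobots J) q.starts q.stops (Fin.natAdd S.card k) := by
    intro w hw
    refine (h.mem_stationary_sub hq).2 ⟨?_, mem_robots.2 (Or.inr (Or.inl (hC ▸ hw)))⟩
    rintro rfl
    have := h.row _ hs
    have := h.idle_row (mem_idleBefore.1 hw).1
    omega
  have hQA : {w | w ∈ stationary (initialRobots J) q.starts q.stops (Fin.natAdd S.card k)} ⊆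
      (seeds : Set LatticePoint) ∪ idleBefore J (q.tr k) ∪ S := by
    intro w hw
    rcases mem_robots.1 ((h.mem_stationary_sub hq).1 hw).2 with h' | h' | h'
    · exact Or.inl (Or.inl h')
    · exact Or.inl (Or.inr (hC ▸ h'))
    · exact Or.inr (shapePart_subset hq _ h')
  have hfull : FrontClosed (S : Set LatticePoint) S :=
    ⟨subset_rfl, fun _ _ z hz _ => hz, fun _ _ z h => (ribbonArc_iff.1 h).2.1,
      fun _ _ _ _ z hz _ => hz⟩
  obtain ⟨hA, -⟩ := oneOrbit_join h.region idle_ribbonRegion h.row (fun x hx => hx) hfull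
    (h.frontClosed_idleBefore (q.tr k))
  have hdetour := exists_detour h.region idle_ribbonRegion h.row (fun x hx => hx)
    (h.frontClosed_idleBefore (q.tr k)) hs hxR hx hu hm (h.touches_idle ht) (fun hm => by
      have := h.row _ hm
      have := h.idle_row ht
      omega)
  have hloc : ∀ z c, lattice.Adj z c → c ∈ lowerRibbons S lt (q.sr k) ∪ {p₁, p₂} →
      CanLocalizeAt r (initialRobots J) q.starts q.stops (Fin.natAdd S.card k) z :=
    fun z c hzc hc => h.canLocalizeAt_shape hq hr hs (h.lowerRibbons_subset hq) hzc hc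
  obtain ⟨c, hc⟩ := h.region.exists_lower (P := (S : Set LatticePoint)) hs
  have hxu : x + u ∈ lowerRibbons S lt (q.sr k) ∪ {p₁, p₂} := by
    have := h.lower_mem_lowerRibbons hxS ⟨adj_add hu.1, hu.2.1⟩
    rwa [lowerRibbons, ← (ribbonOf_eq_iff hxR.1).2 hxR.2] at this
  have hmu : lattice.Adj (x + rot u) (x + u) := by
    rw [adj_iff, add_sub_add_left_eq_sub]; exact hu.1.sub_rot
  refine ⟨F, x, x + rot u, ?_⟩
  rw [starts_natAdd, stops_natAdd]
  refine ⟨hF, hxfirst, ⟨hm, (adj_add hu.1.rot).symm, x + u, ?_, (adj_add hu.1).symm, hmu.symm⟩,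
    ?_, ?_, ?_, hloc _ c hc.1 (h.lower_mem_lowerRibbons hs hc), hloc _ _ (adj_add hu.1) hxu,
    hloc _ _ hmu hxu, h.canLocalizeAt_idle hq hr ht hCQ⟩
  · exact (hFl x hxR _ (adj_add hu.1)).2 hu.2.1
  · exact h.region.ribbonFollows hr hs hpath hFl hFQ fun z hz _ => hfree z hz
  · refine h.region.followStep_arc hr hxR.1 hu (hFl x hxR) hFQ (hfree x hpath) fun hmQ => ?_
    rcases hQA hmQ with (h' | h') | h'
    · exact hmseed h'
    · have := h.idle_row (mem_idleBefore.1 h').1; omega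
    · exact hm h'
  · refine Relation.ReflTransGen.mono ?_ _ _ hdetour
    rintro z z' ⟨v, hv, rfl, hzv⟩
    refine followStep_of_subset hr hA hQA hv ?_
    rcases hzv with (h' | h') | h'
    · exact h.seeds_subset_stationary hq _ _ h'
    · exact hCQ _ h'
    · exact h.beside_stationary hq h'.1 h'.2.1 (fun h'' => hv.2.1 (Or.inr h''))
        (adj_add hv.1).symm

end Scenario

theorem mainTheorem1 (r : ℝ) (hr : 0 < r) (S D J : Finset LatticePoint) (hD : D ⊆ S)
    (hS : HoleFree S) (hproper : ProperRibbonization S D) (hJ : IdlePlacement J)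
    (hsufficient : S.card ≤ J.card)
    (lt : Set LatticePoint → Set LatticePoint → Prop) (hlt : IsCompleteTreeOrder S lt) :
    (∃! q : MovementPlan S.card, IsAddSubtractPlan S D J lt q) ∧
    ∀ q : MovementPlan S.card, IsAddSubtractPlan S D J lt q →
      formationPart (Finset.univ.val.map q.stops - Finset.univ.val.map q.starts) = (S \ D).val ∧
      formationPart (config (initialRobots J) q.starts q.stops (S.card + S.card)) = (S \ D).val ∧
      (∀ n : Fin (S.card + S.card),
        q.starts n ∈ config (initialRobots J) q.starts q.stops n ∧
        q.stops n ∉ stationary (initialRobots J) q.starts q.stops n) ∧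
      (∀ k : Fin S.card,
        AdditiveMove r (initialRobots J) q.starts q.stops (Fin.castAdd S.card k)) ∧
      (∀ k : Fin S.card,
        (IsRecycled S D (q.sr k) →
          RecycledMove S r (initialRobots J) q.starts q.stops (Fin.natAdd S.card k)) ∧
        (¬ IsRecycled S D (q.sr k) →
          RearrangedMove S r (initialRobots J) q.starts q.stops (Fin.natAdd S.card k))) := by
  have h : Scenario S D J lt := ⟨hproper.ribbonRegion hS, fun x hx => hproper.row hx,
    fun x hx y hy hxy => hproper.boundary x hx ⟨y, hy, hxy⟩, hlt, hJ, hsufficient⟩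
  refine ⟨h.existsUnique_plan, fun q hq => ⟨h.final_difference hq, h.final_config hq, fun n => ?_,
    fun k => h.additiveMove hq hr k,
    fun k => ⟨fun hk => h.recycledMove hq hr hk, fun hk => h.rearrangedMove hq hr hk⟩⟩⟩
  obtain ⟨h1, h2, -⟩ := h.robots_step hq n
  rw [stationary_eq (h.config_eq_robots hq n.2.le), h.config_eq_robots hq n.2.le]
  exact ⟨h1, h2⟩
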